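/- For every integer $L\ge 2$ let positive reals $\omega_m=\omega^{(L)}_m$ ($1\le m\le L-1$, degrees of freedom) and $r_{m+1/2}=r^{(L)}_{m+1/2}$ ($0\le m\le L-1$, rates) be given, all lying in a fixed interval $[c,C]$ with $0<c\le C<\infty$ independent of $L$ and $m$, and let $T(0),T(1)\ge 0$. Write $\Gamma(a,\theta)$ for the Gamma law with shape $a$ and scale $\theta$, with $\Gamma(a,0)=\delta_0$. Let $\mathbf X^{(L)}(t)=(\xi_1(t),\dots,\xi_{L-1}(t))\in[0,\infty)^{L-1}$ be the Markov jump process in which, independently, (i) for $1\le m\le L-2$, at rate $r_{m+1/2}$, the pair $(\xi_m,\xi_{m+1})$ is replaced by $(p(\xi_m+\xi_{m+1}),(1-p)(\xi_m+\xi_{m+1}))$ with $p$ an independent $\mathrm{Beta}(\omega_m/2,\omega_{m+1}/2)$ variable; (ii) at rate $r_{1/2}$, $\xi_1$ is replaced by an independent $\Gamma(\omega_1/2,T(0))$ variable; (iii) at rate $r_{L-1/2}$, $\xi_{L-1}$ is replaced by an independent $\Gamma(\omega_{L-1}/2,T(1))$ variable. Then for every $L\ge2$ the process $\mathbf X^{(L)}$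 has a unique invariant probability measure $\mu^{(L)}$. Moreover, put $\omega_0:=\omega_1$, $\omega_L:=\omega_{L-1}$, $$\psi(m)=\frac{\omega_{m-1}+\omega_m}{r_{m-1/2}\,\omega_{m-1}\,\omega_m}\quad(1\le m\le L),\qquad \mathcal A^{(L)}(x)=\frac{\sum_{m=1}^{\lfloor xL\rfloor}\psi(m)}{\sum_{m=1}^{L}\psi(m)},$$ $$u^{(L)}(x)=(1-\mathcal A^{(L)}(x))\,T(0)+\mathcal A^{(L)}(x)\,T(1).$$ Then for every $x\in(0,1)$ and every finite $S\subset\mathbb Z$, with $\langle xL\rangle$ the integer closest to $xL$, the Lévy–Prokhorov distance between the law of $(\xi_{\langle xL\rangle+s})_{s\in S}$ under $\mu^{(L)}$ and the product law $$\prod_{s\in S}\Gamma\!\left(\frac{\omega_{\langle xL\rangle+s}}{2},\,u^{(L)}(x)\right)$$ tends to $0$ as $L\to\infty$. -/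

import Mathlib

open MeasureTheory ProbabilityTheory Filter Topology

noncomputable section

namespace HeatChain

/-- The sites of the chain: the integers strictly between `0` and `L`, that is `L · (0,1) ∩ ℤ`. -/
abbrev Site (L : ℕ) : Type := Set.Ioo (0 : ℤ) (L : ℤ)

/-- Energy configurations. Energies are nonnegative; the dynamics preserves nonnegativity, and
invariant measures are required to live on nonnegative configurations. -/
abbrev Config (L : ℕ) : Type := Site L → ℝ

/-- The Gamma distribution with shape parameter `a` and scale parameter `c`; for `c = 0` it is
the point mass at `0` (temperature zero). Mathlib's `gammaMeasure` takes the inverse scale. -/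
def gammaLaw (a c : ℝ) : Measure ℝ :=
  if c = 0 then Measure.dirac 0 else gammaMeasure a c⁻¹

/-- Pool the energies at `u` and `v`; give the fraction `p` to `u` and the rest to `v`. -/
def pool {L : ℕ} (u v : Site L) (ξ : Config L) (p : ℝ) : Config L := fun w =>
  if w = u then p * (ξ u + ξ v) else if w = v then (1 - p) * (ξ u + ξ v) else ξ w

/-- The edges `(m, m + 1)` with both endpoints in the chain, each listed once. -/
def bulkEdges (L : ℕ) : Finset (Site L × Site L) :=
  Finset.univ.filter fun e => (e.2 : ℤ) = (e.1 : ℤ) + 1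

/-- The site adjacent to the left bath, which sits at `0`. -/
def leftSites (L : ℕ) : Finset (Site L) := Finset.univ.filter fun u => (u : ℤ) - 1 = 0

/-- The site adjacent to the right bath, which sits at `L`. -/
def rightSites (L : ℕ) : Finset (Site L) := Finset.univ.filter fun u => (u : ℤ) + 1 = L

/-- The generator `G = G₁ + G₂`. The rate of the edge `(m, m + 1)` is `r m`, for `0 ≤ m < L`; the
edges `(0, 1)` and `(L - 1, L)` connect the chain to the baths, of temperature `T₀` and `T₁`. -/
def generator (L : ℕ) (r ω : ℤ → ℝ) (T₀ T₁ : ℝ) (f : Config L → ℝ) (ξ : Config L) : ℝ :=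
  (∑ e ∈ bulkEdges L, r e.1 *
      ∫ p, (f (pool e.1 e.2 ξ p) - f ξ) ∂(betaMeasure (ω e.1 / 2) (ω e.2 / 2)))
  + ((∑ u ∈ leftSites L, r 0 *
      ∫ η, (f (Function.update ξ u η) - f ξ) ∂(gammaLaw (ω u / 2) T₀))
  + ∑ u ∈ rightSites L, r ((L : ℤ) - 1) *
      ∫ η, (f (Function.update ξ u η) - f ξ) ∂(gammaLaw (ω u / 2) T₁))

/-- The total rate at which the exponential clocks ring. -/
def totalRate (L : ℕ) (r : ℤ → ℝ) : ℝ :=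
  (∑ e ∈ bulkEdges L, r e.1)
  + ((∑ _u ∈ leftSites L, r 0) + ∑ _u ∈ rightSites L, r ((L : ℤ) - 1))

/-- The effect of one ring on a law `ν`, with every edge weighted by its rate: the gain part
`G + totalRate` of the generator, acting on measures. -/
def gain (L : ℕ) (r ω : ℤ → ℝ) (T₀ T₁ : ℝ) (ν : Measure (Config L)) : Measure (Config L) :=
  (∑ e ∈ bulkEdges L, ENNReal.ofReal (r e.1) •
      (ν.prod (betaMeasure (ω e.1 / 2) (ω e.2 / 2))).map fun q => pool e.1 e.2 q.1 q.2)
  + ((∑ u ∈ leftSites L, ENNReal.ofReal (r 0) •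
      (ν.prod (gammaLaw (ω u / 2) T₀)).map fun q => Function.update q.1 u q.2)
  + ∑ u ∈ rightSites L, ENNReal.ofReal (r ((L : ℤ) - 1)) •
      (ν.prod (gammaLaw (ω u / 2) T₁)).map fun q => Function.update q.1 u q.2)

/-- The law at time `t ≥ 0` of the Markov jump process started from the law `ν`: sum over the
number `n` of rings up to time `t`, i.e. `exp (t G)` acting on `ν`. -/
def lawAt (L : ℕ) (r ω : ℤ → ℝ) (T₀ T₁ : ℝ) (t : ℝ) (ν : Measure (Config L)) :
    Measure (Config L) :=
  Measure.sum fun n : ℕ =>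
    ENNReal.ofReal (Real.exp (-(totalRate L r * t)) * (t ^ n / n.factorial)) •
      (gain L r ω T₀ T₁)^[n] ν

/-- `μ` is an invariant probability measure of the process with sites `1, …, L - 1`. -/
structure IsInvariantMeasure (L : ℕ) (r ω : ℤ → ℝ) (T₀ T₁ : ℝ) (μ : Measure (Config L)) :
    Prop where
  isProbabilityMeasure : IsProbabilityMeasure μ
  nonneg : ∀ᵐ ξ ∂μ, ∀ w, 0 ≤ ξ w
  invariant : ∀ t : ℝ, 0 ≤ t → lawAt L r ω T₀ T₁ t μ = μ

/-- `ω` with the conventions `ω 0 = ω 1` and `ω L = ω (L - 1)`. -/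
def omegaBar (L : ℕ) (ω : ℤ → ℝ) (m : ℤ) : ℝ := ω (max 1 (min ((L : ℤ) - 1) m))

/-- `ψ(m) = (ω_{m-1} + ω_m) / (r_{m-1/2} ω_{m-1} ω_m)`, where `r_{m-1/2}` is `r (m - 1)`. -/
def psi (L : ℕ) (r ω : ℤ → ℝ) (m : ℤ) : ℝ :=
  (omegaBar L ω (m - 1) + omegaBar L ω m) /
    (r (m - 1) * omegaBar L ω (m - 1) * omegaBar L ω m)

/-- `𝒜(x)`, the normalized cumulative sum of `ψ`. -/
def cumulative (L : ℕ) (r ω : ℤ → ℝ) (x : ℝ) : ℝ :=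
  (∑ m ∈ Finset.Icc (1 : ℤ) ⌊x * L⌋, psi L r ω m) / ∑ m ∈ Finset.Icc (1 : ℤ) L, psi L r ω m

/-- The local temperature `u(x) = (1 - 𝒜(x)) T₀ + 𝒜(x) T₁`. -/
def temperature (L : ℕ) (r ω : ℤ → ℝ) (T₀ T₁ : ℝ) (x : ℝ) : ℝ :=
  (1 - cumulative L r ω x) * T₀ + cumulative L r ω x * T₁

/-- The components `ξ_{⟨xL⟩ + s}`, `s ∈ S`, of a configuration, `⟨xL⟩` being the integer closest
to `xL`. For `0 < x < 1` all of them are sites as soon as `L` is large; the value `0` is a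
placeholder for the finitely many `L` for which some are not. -/
def localConfig (L : ℕ) (x : ℝ) (S : Finset ℤ) (ξ : Config L) : S → ℝ := fun s =>
  if h : round (x * L) + (s : ℤ) ∈ Set.Ioo (0 : ℤ) (L : ℤ) then
    ξ ⟨round (x * L) + (s : ℤ), h⟩ else 0

/-- Local equilibrium, with local temperature `u L x`, of the measures `μ L` as `L → ∞`: the
Lévy–Prokhorov distance of the law of `(ξ_{⟨xL⟩ + s})_{s ∈ S}` and the product of the
`Γ(ω_{⟨xL⟩ + s} / 2, u L x)` tends to `0`, for all `x ∈ (0,1)` and all finite `S ⊂ ℤ`. -/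
def ApproachesLocalEquilibrium (ω : ℕ → ℤ → ℝ) (μ : (L : ℕ) → Measure (Config L))
    (u : ℕ → ℝ → ℝ) : Prop :=
  ∀ x ∈ Set.Ioo (0 : ℝ) 1, ∀ S : Finset ℤ,
    Tendsto (fun L : ℕ =>
      levyProkhorovEDist ((μ L).map (localConfig L x S))
        (Measure.pi fun s : S => gammaLaw (ω L (round (x * L) + (s : ℤ)) / 2) (u L x)))
      atTop (𝓝 0)

/-! ### The laws `lawAt t ν` are those of the Markov process with generator `generator` -/

section Forward

variable {L : ℕ} {r ω : ℤ → ℝ} {T₀ T₁ : ℝ}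

lemma isProbabilityMeasure_gammaLaw {a c : ℝ} (ha : 0 < a) (hc : 0 ≤ c) :
    IsProbabilityMeasure (gammaLaw a c) := by
  unfold gammaLaw
  split_ifs with h
  · infer_instance
  · exact isProbabilityMeasure_gammaMeasure ha (inv_pos.2 (lt_of_le_of_ne hc (Ne.symm h)))

lemma measurable_pool (u v : Site L) :
    Measurable fun q : Config L × ℝ => pool u v q.1 q.2 := by
  refine measurable_pi_lambda _ fun w => ?_
  unfold pool
  split_ifs <;> fun_prop

lemma measurable_reset (u : Site L) :
    Measurable fun q : Config L × ℝ => Function.update q.1 u q.2 := by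
  refine measurable_pi_lambda _ fun w => ?_
  by_cases h : w = u
  · subst h; simpa using measurable_snd
  · simp only [Function.update_of_ne h]; fun_prop

/-- A bounded measurable function is integrable for a finite measure. -/
lemma integrable_of_bdd {X : Type*} [MeasurableSpace X] (ν : Measure X) [IsFiniteMeasure ν]
    {f : X → ℝ} (hf : Measurable f) {M : ℝ} (hM : ∀ x, |f x| ≤ M) : Integrable f ν :=
  Integrable.of_bound hf.aestronglyMeasurable M (ae_of_all _ hM)

lemma integral_smul_map (ν : Measure (Config L)) [IsFiniteMeasure ν] (β : Measure ℝ)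
    [IsProbabilityMeasure β] {g : Config L × ℝ → Config L} (hg : Measurable g)
    {f : Config L → ℝ} (hf : Measurable f) {M : ℝ} (hM : ∀ x, |f x| ≤ M) {a : ℝ} (ha : 0 ≤ a) :
    Integrable (fun ξ => a * ∫ p, (f (g (ξ, p)) - f ξ) ∂β) ν ∧
    ∫ x, f x ∂(ENNReal.ofReal a • (ν.prod β).map g) =
      ∫ ξ, a * ∫ p, (f (g (ξ, p)) - f ξ) ∂β ∂ν + a * ∫ ξ, f ξ ∂ν := by
  have hi : Integrable (fun q => f (g q)) (ν.prod β) :=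
    integrable_of_bdd _ (hf.comp hg) fun x => hM _
  have hi' : Integrable f ν := integrable_of_bdd _ hf hM
  have hsub : ∀ ξ, ∫ p, (f (g (ξ, p)) - f ξ) ∂β = (∫ p, f (g (ξ, p)) ∂β) - f ξ := by
    intro ξ
    have hm : Measurable fun p : ℝ => f (g (ξ, p)) := hf.comp (hg.comp (by fun_prop))
    rw [integral_sub (integrable_of_bdd β hm fun x => hM _) (integrable_const _)]
    simp
  have h1 : Integrable (fun ξ => ∫ p, f (g (ξ, p)) ∂β) ν := hi.integral_prod_left
  simp_rw [hsub]
  refine ⟨(h1.sub hi').const_mul a, ?_⟩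
  rw [integral_smul_measure, integral_map hg.aemeasurable hf.aestronglyMeasurable,
    integral_prod _ hi, integral_const_mul, integral_sub h1 hi', ENNReal.toReal_ofReal ha,
    smul_eq_mul]
  ring

/-- Positivity of the parameters of a chain. -/
def Admissible (L : ℕ) (r ω : ℤ → ℝ) (T₀ T₁ : ℝ) : Prop :=
  (∀ m : ℤ, 0 ≤ m → m < L → 0 < r m) ∧ (∀ m : ℤ, 0 < m → m < L → 0 < ω m) ∧ 0 ≤ T₀ ∧ 0 ≤ T₁

lemma Admissible.rate_nonneg (h : Admissible L r ω T₀ T₁) :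
    (∀ e : Site L × Site L, 0 ≤ r e.1) ∧ (∀ _u : Site L, 0 ≤ r 0) ∧
      (∀ _u : Site L, 0 ≤ r ((L : ℤ) - 1)) := by
  refine ⟨fun e => ?_, fun u => ?_, fun u => ?_⟩
  · exact (h.1 _ e.1.2.1.le e.1.2.2).le
  · exact (h.1 _ le_rfl (u.2.1.trans u.2.2)).le
  · have := u.2.1.trans u.2.2
    exact (h.1 _ (by omega) (by omega)).le

lemma Admissible.totalRate_nonneg (h : Admissible L r ω T₀ T₁) : 0 ≤ totalRate L r := by
  obtain ⟨h1, h2, h3⟩ := h.rate_nonneg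
  exact add_nonneg (Finset.sum_nonneg fun e _ => h1 e)
    (add_nonneg (Finset.sum_nonneg fun u _ => h2 u) (Finset.sum_nonneg fun u _ => h3 u))

lemma isFiniteMeasure_gain (h : Admissible L r ω T₀ T₁) (ν : Measure (Config L))
    [IsFiniteMeasure ν] : IsFiniteMeasure (gain L r ω T₀ T₁ ν) := by
  have hω : ∀ u : Site L, 0 < ω u / 2 := fun u => half_pos (h.2.1 _ u.2.1 u.2.2)
  have : ∀ u v : Site L, IsProbabilityMeasure (betaMeasure (ω u / 2) (ω v / 2)) :=
    fun u v => isProbabilityMeasureBeta (hω u) (hω v)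
  have : ∀ u : Site L, IsProbabilityMeasure (gammaLaw (ω u / 2) T₀) :=
    fun u => isProbabilityMeasure_gammaLaw (hω u) h.2.2.1
  have : ∀ u : Site L, IsProbabilityMeasure (gammaLaw (ω u / 2) T₁) :=
    fun u => isProbabilityMeasure_gammaLaw (hω u) h.2.2.2
  refine ⟨?_⟩
  simp only [gain, Measure.add_apply, Measure.finsetSum_apply, Measure.smul_apply, smul_eq_mul]
  refine ENNReal.add_lt_top.2 ⟨?_, ENNReal.add_lt_top.2 ⟨?_, ?_⟩⟩ <;>
  · refine ENNReal.sum_lt_top.2 fun e _ => ENNReal.mul_lt_top ENNReal.ofReal_lt_top ?_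
    exact measure_lt_top _ _

/-- `gain` is the adjoint of `G + totalRate`. -/
lemma integral_gain (h : Admissible L r ω T₀ T₁) (ν : Measure (Config L)) [IsFiniteMeasure ν]
    {f : Config L → ℝ} (hf : Measurable f) {M : ℝ} (hM : ∀ x, |f x| ≤ M) :
    ∫ x, f x ∂(gain L r ω T₀ T₁ ν) =
      ∫ ξ, generator L r ω T₀ T₁ f ξ ∂ν + totalRate L r * ∫ ξ, f ξ ∂ν := by
  have hω : ∀ u : Site L, 0 < ω u / 2 := fun u => half_pos (h.2.1 _ u.2.1 u.2.2)
  have : ∀ u v : Site L, IsProbabilityMeasure (betaMeasure (ω u / 2) (ω v / 2)) :=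
    fun u v => isProbabilityMeasureBeta (hω u) (hω v)
  have : ∀ u : Site L, IsProbabilityMeasure (gammaLaw (ω u / 2) T₀) :=
    fun u => isProbabilityMeasure_gammaLaw (hω u) h.2.2.1
  have : ∀ u : Site L, IsProbabilityMeasure (gammaLaw (ω u / 2) T₁) :=
    fun u => isProbabilityMeasure_gammaLaw (hω u) h.2.2.2
  obtain ⟨h1, h2, h3⟩ := h.rate_nonneg
  have k1 := fun e : Site L × Site L => integral_smul_map ν (betaMeasure (ω e.1 / 2) (ω e.2 / 2))
    (measurable_pool e.1 e.2) hf hM (h1 e)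
  have k2 := fun u : Site L => integral_smul_map ν (gammaLaw (ω u / 2) T₀)
    (measurable_reset u) hf hM (h2 u)
  have k3 := fun u : Site L => integral_smul_map ν (gammaLaw (ω u / 2) T₁)
    (measurable_reset u) hf hM (h3 u)
  have hfin : ∀ (a : ℝ) (ρ : Measure (Config L)) [IsFiniteMeasure ρ],
      Integrable f (ENNReal.ofReal a • ρ) := fun a ρ _ =>
    (integrable_of_bdd ρ hf hM).smul_measure ENNReal.ofReal_ne_top
  unfold gain generator totalRate
  have i1 := integrable_finsetSum_measure.2 fun e (_ : e ∈ bulkEdges L) =>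
    hfin (r e.1) ((ν.prod (betaMeasure (ω e.1 / 2) (ω e.2 / 2))).map
      fun q => pool e.1 e.2 q.1 q.2)
  have i2 := integrable_finsetSum_measure.2 fun u (_ : u ∈ leftSites L) =>
    hfin (r 0) ((ν.prod (gammaLaw (ω u / 2) T₀)).map fun q => Function.update q.1 u q.2)
  have i3 := integrable_finsetSum_measure.2 fun u (_ : u ∈ rightSites L) =>
    hfin (r ((L : ℤ) - 1))
      ((ν.prod (gammaLaw (ω u / 2) T₁)).map fun q => Function.update q.1 u q.2)
  rw [integral_add_measure i1 (i2.add_measure i3), integral_add_measure i2 i3,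
    integral_finsetSum_measure (fun e _ => hfin _ _),
    integral_finsetSum_measure (fun e _ => hfin _ _),
    integral_finsetSum_measure (fun e _ => hfin _ _)]
  rw [integral_add, integral_add, integral_finsetSum _ (fun e _ => (k1 e).1),
    integral_finsetSum _ (fun e _ => (k2 e).1), integral_finsetSum _ (fun e _ => (k3 e).1)]
  · rw [Finset.sum_congr rfl (fun e _ => (k1 e).2), Finset.sum_congr rfl (fun e _ => (k2 e).2),
      Finset.sum_congr rfl (fun e _ => (k3 e).2)]
    simp only [Finset.sum_add_distrib, ← Finset.sum_mul]
    ring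
  · exact integrable_finsetSum _ (fun e _ => (k2 e).1)
  · exact integrable_finsetSum _ (fun e _ => (k3 e).1)
  · exact integrable_finsetSum _ (fun e _ => (k1 e).1)
  · exact (integrable_finsetSum _ (fun e _ => (k2 e).1)).add
      (integrable_finsetSum _ (fun e _ => (k3 e).1))

lemma isFiniteMeasure_iterate (h : Admissible L r ω T₀ T₁) (ν : Measure (Config L))
    [IsFiniteMeasure ν] (n : ℕ) : IsFiniteMeasure ((gain L r ω T₀ T₁)^[n] ν) := by
  induction n with
  | zero => simpa
  | succ n ih =>
    rw [Function.iterate_succ_apply']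
    exact isFiniteMeasure_gain h _

lemma generator_one (ξ : Config L) : generator L r ω T₀ T₁ (fun _ => 1) ξ = 0 := by
  simp [generator]

lemma mass_iterate (h : Admissible L r ω T₀ T₁) (ν : Measure (Config L))
    [IsFiniteMeasure ν] (n : ℕ) :
    ((gain L r ω T₀ T₁)^[n] ν).real Set.univ = totalRate L r ^ n * ν.real Set.univ := by
  induction n with
  | zero => simp
  | succ n ih =>
    have := isFiniteMeasure_iterate h ν n
    have k := integral_gain h ((gain L r ω T₀ T₁)^[n] ν) (f := fun _ => 1) measurable_const
      (M := 1) (by simp)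
    simp only [generator_one, integral_const, smul_eq_mul, mul_one, mul_zero, zero_add] at k
    rw [Function.iterate_succ_apply', k, ih]
    ring

lemma abs_integral_iterate_le (h : Admissible L r ω T₀ T₁) (ν : Measure (Config L))
    [IsFiniteMeasure ν] {f : Config L → ℝ} {M : ℝ}
    (hM : ∀ x, |f x| ≤ M) (n : ℕ) :
    |∫ x, f x ∂((gain L r ω T₀ T₁)^[n] ν)| ≤ M * ν.real Set.univ * totalRate L r ^ n := by
  have := isFiniteMeasure_iterate h ν n
  have k := norm_integral_le_of_norm_le_const (μ := (gain L r ω T₀ T₁)^[n] ν) (f := f) (C := M)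
    (ae_of_all _ hM)
  rw [mass_iterate h] at k
  rw [Real.norm_eq_abs] at k
  linarith [mul_comm (totalRate L r ^ n) (ν.real Set.univ), mul_assoc M (ν.real Set.univ)
    (totalRate L r ^ n), congrArg (M * ·) (mul_comm (totalRate L r ^ n) (ν.real Set.univ))]

lemma isFiniteMeasure_lawAt (h : Admissible L r ω T₀ T₁) (ν : Measure (Config L))
    [IsFiniteMeasure ν] {t : ℝ} (ht : 0 ≤ t) : IsFiniteMeasure (lawAt L r ω T₀ T₁ t ν) := by
  refine ⟨?_⟩
  have hΛ := h.totalRate_nonneg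
  have hfin := isFiniteMeasure_iterate h ν
  have e : ∀ n : ℕ, ((ENNReal.ofReal (Real.exp (-(totalRate L r * t)) * (t ^ n / n.factorial)) •
      (gain L r ω T₀ T₁)^[n] ν) : Measure (Config L)) Set.univ = ENNReal.ofReal
      (Real.exp (-(totalRate L r * t)) * ν.real Set.univ *
        ((totalRate L r * t) ^ n / n.factorial)) := by
    intro n
    rw [Measure.smul_apply, smul_eq_mul, ← ofReal_measureReal, mass_iterate h,
      ← ENNReal.ofReal_mul (by positivity)]
    congr 1
    rw [mul_pow]; ring
  rw [lawAt, Measure.sum_apply _ MeasurableSet.univ]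
  simp_rw [e]
  rw [← ENNReal.ofReal_tsum_of_nonneg (fun n => by positivity)
    ((Real.summable_pow_div_factorial _).mul_left _)]
  exact ENNReal.ofReal_lt_top

lemma integral_lawAt (h : Admissible L r ω T₀ T₁) (ν : Measure (Config L)) [IsFiniteMeasure ν]
    {f : Config L → ℝ} (hf : Measurable f) {M : ℝ} (hM : ∀ x, |f x| ≤ M) {t : ℝ} (ht : 0 ≤ t) :
    ∫ x, f x ∂(lawAt L r ω T₀ T₁ t ν) = Real.exp (-(totalRate L r * t)) *
      ∑' n : ℕ, t ^ n / n.factorial * ∫ x, f x ∂((gain L r ω T₀ T₁)^[n] ν) := by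
  have := isFiniteMeasure_lawAt h ν ht
  have hi : Integrable f (lawAt L r ω T₀ T₁ t ν) := integrable_of_bdd _ hf hM
  rw [lawAt] at hi ⊢
  rw [integral_sum_measure hi, ← tsum_mul_left]
  refine tsum_congr fun n => ?_
  rw [integral_smul_measure, ENNReal.toReal_ofReal (by positivity), smul_eq_mul]
  ring

/-- Termwise differentiation of an exponential series. -/
lemma hasDerivAt_expSeries (a : ℕ → ℝ) {K Λ : ℝ} (ha : ∀ n, |a n| ≤ K * Λ ^ n)
    (t : ℝ) :
    HasDerivAt (fun s : ℝ => ∑' n : ℕ, s ^ n / n.factorial * a n)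
      (∑' n : ℕ, t ^ n / n.factorial * a (n + 1)) t := by
  have hK : 0 ≤ K := by simpa using (abs_nonneg _).trans (ha 0)
  set R : ℝ := |t| + 1 with hR
  have hRp : 0 ≤ R := by positivity
  let u : ℕ → ℝ := fun n => match n with
    | 0 => 0
    | n + 1 => K * Λ * ((R * Λ) ^ n / n.factorial)
  have hu : Summable u := by
    rw [← summable_nat_add_iff 1]
    exact (Real.summable_pow_div_factorial _).mul_left _
  let g' : ℕ → ℝ → ℝ := fun n s => match n with
    | 0 => 0
    | n + 1 => s ^ n / n.factorial * a (n + 1)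
  have hg : ∀ (n : ℕ) (s : ℝ), s ∈ Metric.ball (0 : ℝ) R →
      HasDerivAt (fun s : ℝ => s ^ n / n.factorial * a n) (g' n s) s := by
    intro n s _
    cases n with
    | zero => simpa [g'] using hasDerivAt_const s (a 0)
    | succ n =>
      have k := ((hasDerivAt_pow (n + 1) s).div_const ((n + 1).factorial : ℝ)).mul_const (a (n + 1))
      convert! k using 1
      simp only [g', Nat.factorial_succ]
      push_cast
      have : (n.factorial : ℝ) ≠ 0 := by positivity
      have : (n : ℝ) + 1 ≠ 0 := by positivity
      try simp only [Nat.add_sub_cancel]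
      field_simp
  have hb : ∀ (n : ℕ) (s : ℝ), s ∈ Metric.ball (0 : ℝ) R → ‖g' n s‖ ≤ u n := by
    intro n s hs
    have hs' : |s| ≤ R := by simpa using (mem_ball_zero_iff.1 hs).le
    cases n with
    | zero => simp [g', u]
    | succ n =>
      simp only [g', u]
      rw [norm_mul, norm_div, norm_pow, Real.norm_eq_abs, Real.norm_eq_abs, Real.norm_eq_abs,
        abs_of_nonneg (by positivity : (0 : ℝ) ≤ n.factorial)]
      calc |s| ^ n / n.factorial * |a (n + 1)| ≤ R ^ n / n.factorial * (K * Λ ^ (n + 1)) := by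
            gcongr
            exact ha _
        _ = _ := by rw [mul_pow]; ring
  have ht : t ∈ Metric.ball (0 : ℝ) R := by
    rw [mem_ball_zero_iff, Real.norm_eq_abs]; linarith
  have h0 : Summable fun n : ℕ => (0 : ℝ) ^ n / n.factorial * a n := by
    refine summable_of_ne_finset_zero (s := {0}) fun n hn => ?_
    have : n ≠ 0 := by simpa using hn
    simp [this]
  have main := hasDerivAt_tsum_of_isPreconnected hu Metric.isOpen_ball
    (convex_ball (0 : ℝ) R).isPreconnected hg hb (Metric.mem_ball_self (by positivity)) h0 ht
  have hs : Summable fun n => g' n t := Summable.of_norm_bounded hu fun n => hb n t ht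
  rw [hs.tsum_eq_zero_add] at main
  simpa [g'] using main

lemma measurable_loss (β : Measure ℝ) [IsProbabilityMeasure β]
    {g : Config L × ℝ → Config L} (hg : Measurable g) {f : Config L → ℝ} (hf : Measurable f) :
    Measurable fun ξ => ∫ p, (f (g (ξ, p)) - f ξ) ∂β := by
  have hm : Measurable fun q : Config L × ℝ => f (g q) - f q.1 :=
    (hf.comp hg).sub (hf.comp measurable_fst)
  exact (StronglyMeasurable.integral_prod_right (ν := β) hm.stronglyMeasurable).measurable

lemma abs_loss_le (β : Measure ℝ) [IsProbabilityMeasure β] (g : Config L × ℝ → Config L)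
    {f : Config L → ℝ} {M : ℝ} (hM : ∀ x, |f x| ≤ M) (ξ : Config L) :
    |∫ p, (f (g (ξ, p)) - f ξ) ∂β| ≤ 2 * M := by
  have k := norm_integral_le_of_norm_le_const (μ := β) (f := fun p => f (g (ξ, p)) - f ξ)
    (C := 2 * M) (ae_of_all _ fun p => by
      rw [Real.norm_eq_abs]
      have h1 := hM (g (ξ, p))
      have h2 := hM ξ
      rw [abs_le] at *
      constructor <;> linarith [h1.1, h1.2, h2.1, h2.2])
  simpa using k

lemma measurable_generator (h : Admissible L r ω T₀ T₁) {f : Config L → ℝ} (hf : Measurable f) :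
    Measurable (generator L r ω T₀ T₁ f) := by
  have hω : ∀ u : Site L, 0 < ω u / 2 := fun u => half_pos (h.2.1 _ u.2.1 u.2.2)
  have : ∀ u v : Site L, IsProbabilityMeasure (betaMeasure (ω u / 2) (ω v / 2)) :=
    fun u v => isProbabilityMeasureBeta (hω u) (hω v)
  have : ∀ u : Site L, IsProbabilityMeasure (gammaLaw (ω u / 2) T₀) :=
    fun u => isProbabilityMeasure_gammaLaw (hω u) h.2.2.1
  have : ∀ u : Site L, IsProbabilityMeasure (gammaLaw (ω u / 2) T₁) :=
    fun u => isProbabilityMeasure_gammaLaw (hω u) h.2.2.2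
  refine Measurable.add ?_ (Measurable.add ?_ ?_)
  · exact Finset.measurable_sum _ fun e _ =>
      (measurable_loss _ (measurable_pool e.1 e.2) hf).const_mul _
  · exact Finset.measurable_sum _ fun u _ =>
      (measurable_loss _ (measurable_reset u) hf).const_mul _
  · exact Finset.measurable_sum _ fun u _ =>
      (measurable_loss _ (measurable_reset u) hf).const_mul _

lemma abs_generator_le (h : Admissible L r ω T₀ T₁) {f : Config L → ℝ} {M : ℝ}
    (hM : ∀ x, |f x| ≤ M) (ξ : Config L) :
    |generator L r ω T₀ T₁ f ξ| ≤ totalRate L r * (2 * M) := by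
  have hω : ∀ u : Site L, 0 < ω u / 2 := fun u => half_pos (h.2.1 _ u.2.1 u.2.2)
  have : ∀ u v : Site L, IsProbabilityMeasure (betaMeasure (ω u / 2) (ω v / 2)) :=
    fun u v => isProbabilityMeasureBeta (hω u) (hω v)
  have : ∀ u : Site L, IsProbabilityMeasure (gammaLaw (ω u / 2) T₀) :=
    fun u => isProbabilityMeasure_gammaLaw (hω u) h.2.2.1
  have : ∀ u : Site L, IsProbabilityMeasure (gammaLaw (ω u / 2) T₁) :=
    fun u => isProbabilityMeasure_gammaLaw (hω u) h.2.2.2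
  obtain ⟨h1, h2, h3⟩ := h.rate_nonneg
  have key : ∀ {a b : ℝ}, 0 ≤ a → |b| ≤ 2 * M → |a * b| ≤ a * (2 * M) := by
    intro a b ha hb
    rw [abs_mul, abs_of_nonneg ha]
    exact mul_le_mul_of_nonneg_left hb ha
  unfold generator totalRate
  rw [add_mul, add_mul, Finset.sum_mul, Finset.sum_mul, Finset.sum_mul]
  refine (abs_add_le _ _).trans (add_le_add ?_ ((abs_add_le _ _).trans (add_le_add ?_ ?_)))
  · exact (Finset.abs_sum_le_sum_abs _ _).trans (Finset.sum_le_sum fun e _ =>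
      key (h1 e) (abs_loss_le _ (fun q => pool e.1 e.2 q.1 q.2) hM ξ))
  · exact (Finset.abs_sum_le_sum_abs _ _).trans (Finset.sum_le_sum fun u _ =>
      key (h2 u) (abs_loss_le _ (fun q => Function.update q.1 u q.2) hM ξ))
  · exact (Finset.abs_sum_le_sum_abs _ _).trans (Finset.sum_le_sum fun u _ =>
      key (h3 u) (abs_loss_le _ (fun q => Function.update q.1 u q.2) hM ξ))

/-- At time `0` the law is the initial law. -/
theorem lawAt_zero (ν : Measure (Config L)) : lawAt L r ω T₀ T₁ 0 ν = ν := by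
  ext s hs
  rw [lawAt, Measure.sum_apply _ hs, tsum_eq_single 0]
  · simp
  · intro n hn
    simp [hn]

/-- Kolmogorov's forward equation: the laws `lawAt t ν` evolve according to `generator`. -/
theorem hasDerivWithinAt_lawAt (h : Admissible L r ω T₀ T₁) (ν : Measure (Config L))
    [IsFiniteMeasure ν] {f : Config L → ℝ} (hf : Measurable f) {M : ℝ} (hM : ∀ x, |f x| ≤ M) {t : ℝ}
    (ht : 0 ≤ t) :
    HasDerivWithinAt (fun s => ∫ x, f x ∂(lawAt L r ω T₀ T₁ s ν))
      (∫ x, generator L r ω T₀ T₁ f x ∂(lawAt L r ω T₀ T₁ t ν)) (Set.Ici 0) t := by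
  have hΛ := h.totalRate_nonneg
  have hfin := isFiniteMeasure_iterate h ν
  have hGf := measurable_generator h hf
  have hGM := abs_generator_le h hM
  set Λ := totalRate L r with hΛdef
  let a : ℕ → ℝ := fun n => ∫ x, f x ∂((gain L r ω T₀ T₁)^[n] ν)
  let b : ℕ → ℝ := fun n => ∫ x, generator L r ω T₀ T₁ f x ∂((gain L r ω T₀ T₁)^[n] ν)
  have hab : ∀ n, a (n + 1) = b n + Λ * a n := by
    intro n
    simp only [a, b]
    rw [Function.iterate_succ_apply']
    exact integral_gain h _ hf hM
  have ha : ∀ n, |a n| ≤ M * ν.real Set.univ * Λ ^ n := abs_integral_iterate_le h ν hM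
  have hb : ∀ n, |b n| ≤ Λ * (2 * M) * ν.real Set.univ * Λ ^ n :=
    abs_integral_iterate_le h ν hGM
  have hsum : ∀ (c : ℕ → ℝ) (K : ℝ), (∀ n, |c n| ≤ K * Λ ^ n) →
      Summable fun n : ℕ => t ^ n / n.factorial * c n := by
    intro c K hc
    refine Summable.of_norm_bounded
      ((Real.summable_pow_div_factorial (t * Λ)).mul_left K) fun n => ?_
    rw [Real.norm_eq_abs, abs_mul, abs_of_nonneg (by positivity : 0 ≤ t ^ n / n.factorial)]
    calc t ^ n / n.factorial * |c n| ≤ t ^ n / n.factorial * (K * Λ ^ n) := by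
          gcongr
          exact hc n
      _ = _ := by rw [mul_pow]; ring
  have hexp : HasDerivAt (fun s : ℝ => Real.exp (-(Λ * s))) (Real.exp (-(Λ * t)) * (-Λ)) t := by
    simpa using (((hasDerivAt_id t).const_mul Λ).neg).exp
  have main := (hexp.mul (hasDerivAt_expSeries a ha t)).hasDerivWithinAt (s := Set.Ici 0)
  have hval : ∫ x, generator L r ω T₀ T₁ f x ∂(lawAt L r ω T₀ T₁ t ν) =
      Real.exp (-(Λ * t)) * (-Λ) * (∑' n : ℕ, t ^ n / n.factorial * a n) +
        Real.exp (-(Λ * t)) * ∑' n : ℕ, t ^ n / n.factorial * a (n + 1) := by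
    rw [integral_lawAt h ν hGf hGM ht]
    have e : ∀ n : ℕ, t ^ n / n.factorial * a (n + 1) =
        t ^ n / n.factorial * b n + Λ * (t ^ n / n.factorial * a n) := by
      intro n; rw [hab]; ring
    simp_rw [e]
    rw [(hsum b _ hb).tsum_add ((hsum a _ ha).mul_left Λ), tsum_mul_left]
    ring
  rw [hval]
  exact main.congr (fun s hs => integral_lawAt h ν hf hM hs) (integral_lawAt h ν hf hM ht)

end Forward

end HeatChain

end

/-!
The invariant measure is found by writing the energies as `ξ w = θ w * X w`, with independent
`X w ∼ Γ(ω w / 2, 1)` and a random field `θ` of *hidden temperatures*, independent of `X`. By the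
Beta–Gamma algebra, an exchange across an edge `(u, v)` acts on such a mixture by replacing both
`θ u` and `θ v` by `b θ u + (1 - b) θ v`, with `b` a Beta variable (`merge`), and a contact with a
bath by setting the temperature of the site to that of the bath: `gain_mixture` says that `mixture`
intertwines the hidden chain with the chain of energies. The hidden chain lives on a product of
compact intervals, so that it has a stationary law `ν` by Krylov–Bogoliubov
(`exists_hiddenGain_eq_smul`), and `mixture L ω ν` is invariant. A measure is invariant if and only
if one ring fixes it up to the factor `totalRate`, and one ring contracts Lipschitz functions for a
weighted `ℓ¹` distance; its weight `barrier` is a strictly superharmonic profile. Hence uniqueness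
(`existsUnique_isInvariantMeasure`).

In the resistance coordinate `R`, in which the edge `(m, m + 1)` has length
`(ω m + ω (m + 1)) / (r m * ω m * ω (m + 1))`, the averaged moves are harmonic averages. So the
means of the hidden temperatures under `ν` are affine in `R`
(`IsHiddenStationary.integral_apply`), and they are within `O(1 / L)` of the local temperature,
since the increments of `R` are those of the cumulative sum of `psi`. Their covariances solve a
two-particle equation, with a nonzero source only where the two particles are moved together. With
`Z` the total resistance, the function `Z - |R i - R k|` is superharmonic for the two particles and,
as in Tanaka's formula, has its defect at the same places, so a multiple of it dominates the
covariance by the comparison principle `nonpos_of_subsolution`. At `i = k` this bounds the variance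
of `θ i` by a constant times `1 / Z`, that is `O(1 / L)` (`IsHiddenStationary.variance_le`).
The hidden temperatures near `x L` are therefore within `o(1)` of the local temperature `u` in
quadratic mean. By Chebyshev's inequality, replacing `θ w` by `u` in the finitely many products
`θ w * X w` moves their law by `o(1)` in the Lévy–Prokhorov distance
(`IsHiddenStationary.levyProkhorovEDist_le`), and the law of the `u * X w` is the product of the
Gamma laws.
-/

noncomputable section

namespace HeatChain

/-! ### Gamma and Beta laws -/

lemma measurable_gammaPDF (a r : ℝ) : Measurable (gammaPDF a r) :=
  (measurable_gammaPDFReal a r).ennreal_ofReal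

lemma measurable_betaPDF (a b : ℝ) : Measurable (betaPDF a b) :=
  (measurable_betaPDFReal a b).ennreal_ofReal

lemma lintegral_comp_mul_left_volume {s : ℝ} (hs : 0 < s) {f : ℝ → ENNReal} (hf : Measurable f) :
    ∫⁻ x, f x = ∫⁻ p, ENNReal.ofReal s * f (p * s) := by
  conv_lhs => rw [← Real.smul_map_volume_mul_right hs.ne']
  rw [lintegral_smul_measure, lintegral_map hf (measurable_mul_const s), abs_of_pos hs,
    smul_eq_mul, ← lintegral_const_mul _ (by fun_prop)]

/-- The Jacobian identity behind the beta–gamma algebra: at the point `(p s, (1 - p) s)` the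
product of two Gamma densities, times the Jacobian `s`, is the product of a Beta density at `p`
and a Gamma density at `s`. -/
lemma gammaPDF_mul_gammaPDF {a b : ℝ} (ha : 0 < a) (hb : 0 < b) {s p : ℝ} (hs : 0 < s)
    (hp0 : p ≠ 0) (hp1 : p ≠ 1) :
    ENNReal.ofReal s * (gammaPDF a 1 (p * s) * gammaPDF b 1 (s - p * s)) =
      betaPDF a b p * gammaPDF (a + b) 1 s := by
  rcases lt_or_gt_of_ne hp0 with h0 | h0
  · rw [gammaPDF_of_neg (mul_neg_of_neg_of_pos h0 hs), betaPDF_eq_zero_of_nonpos h0.le]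
    simp
  rcases lt_or_gt_of_ne hp1 with h1 | h1
  · have hq : 0 < 1 - p := by linarith
    have e : s - p * s = (1 - p) * s := by ring
    rw [e, gammaPDF_of_nonneg (by positivity), gammaPDF_of_nonneg (by positivity),
      gammaPDF_of_nonneg hs.le, betaPDF_of_pos_lt_one h0 h1,
      ← ENNReal.ofReal_mul (by have := Real.Gamma_pos_of_pos ha; positivity),
      ← ENNReal.ofReal_mul hs.le,
      ← ENNReal.ofReal_mul (by have := beta_pos ha hb; positivity)]
    congr 1
    have ga := (Real.Gamma_pos_of_pos ha).ne'
    have gb := (Real.Gamma_pos_of_pos hb).ne'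
    have gab := (Real.Gamma_pos_of_pos (add_pos ha hb)).ne'
    rw [Real.mul_rpow h0.le hs.le, Real.mul_rpow hq.le hs.le]
    have e1 : Real.exp (-(1 * s)) = Real.exp (-(1 * (p * s))) * Real.exp (-(1 * ((1 - p) * s))) := by
      rw [← Real.exp_add]; congr 1; ring
    have e2 : s ^ (a + b - 1) = s * (s ^ (a - 1) * s ^ (b - 1)) := by
      rw [← Real.rpow_add hs]
      nth_rewrite 2 [← Real.rpow_one s]
      rw [← Real.rpow_add hs]; congr 1; ring
    rw [e1, e2, beta]
    simp only [Real.one_rpow]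
    field_simp
  · rw [gammaPDF_of_neg (a := b) (by nlinarith), betaPDF_eq_zero_of_one_le h1.le]
    simp

/-- Beta–gamma algebra: if `p ∼ Beta(a, b)` and `s ∼ Γ(a + b)` are independent then `p s` and
`(1 - p) s` are independent with laws `Γ(a)` and `Γ(b)`. -/
lemma lintegral_gamma_gamma {a b : ℝ} (ha : 0 < a) (hb : 0 < b) {h : ℝ → ℝ → ENNReal}
    (hh : Measurable (Function.uncurry h)) :
    ∫⁻ x, ∫⁻ y, h x y ∂(gammaMeasure b 1) ∂(gammaMeasure a 1) =
      ∫⁻ p, ∫⁻ s, h (p * s) ((1 - p) * s) ∂(gammaMeasure (a + b) 1) ∂(betaMeasure a b) := by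
  have mga := measurable_gammaPDF a 1
  have mgb := measurable_gammaPDF b 1
  have mgab := measurable_gammaPDF (a + b) 1
  have mb := measurable_betaPDF a b
  have h2 : ∀ {X : Type} [MeasurableSpace X] {f g : X → ℝ}, Measurable f → Measurable g →
      Measurable fun x => h (f x) (g x) := fun hf hg => hh.comp (hf.prodMk hg)
  have lhs : ∫⁻ x, ∫⁻ y, h x y ∂(gammaMeasure b 1) ∂(gammaMeasure a 1) =
      ∫⁻ s, ∫⁻ x, gammaPDF a 1 x * (gammaPDF b 1 (s - x) * h x (s - x)) := by
    rw [lintegral_lintegral_swap (f := fun s x => gammaPDF a 1 x *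
      (gammaPDF b 1 (s - x) * h x (s - x)))]
    · rw [gammaMeasure, gammaMeasure, lintegral_withDensity_eq_lintegral_mul _ mga
        (Measurable.lintegral_prod_right hh)]
      refine lintegral_congr fun x => ?_
      have m1 : Measurable fun y => h x y := h2 measurable_const measurable_id
      rw [Pi.mul_apply, lintegral_withDensity_eq_lintegral_mul _ mgb m1,
        ← lintegral_const_mul _ (mgb.mul m1), ← lintegral_sub_right_eq_self _ x]
      rfl
    · exact ((mga.comp measurable_snd).mul ((mgb.comp (measurable_fst.sub measurable_snd)).mul
        (h2 measurable_snd (measurable_fst.sub measurable_snd)))).aemeasurable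
  have rhs : ∫⁻ p, ∫⁻ s, h (p * s) ((1 - p) * s) ∂(gammaMeasure (a + b) 1) ∂(betaMeasure a b) =
      ∫⁻ s, ∫⁻ p, betaPDF a b p * (gammaPDF (a + b) 1 s * h (p * s) ((1 - p) * s)) := by
    have m2 : Measurable fun q : ℝ × ℝ => h (q.1 * q.2) ((1 - q.1) * q.2) :=
      h2 (by fun_prop) (by fun_prop)
    rw [lintegral_lintegral_swap (f := fun s p => betaPDF a b p *
      (gammaPDF (a + b) 1 s * h (p * s) ((1 - p) * s)))]
    · rw [gammaMeasure, betaMeasure, lintegral_withDensity_eq_lintegral_mul _ mb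
        (Measurable.lintegral_prod_right' m2)]
      refine lintegral_congr fun x => ?_
      have m1 : Measurable fun y => h (x * y) ((1 - x) * y) :=
        m2.comp measurable_prodMk_left
      rw [Pi.mul_apply, lintegral_withDensity_eq_lintegral_mul _ mgab m1,
        ← lintegral_const_mul _ (mgab.mul m1)]
      rfl
    · exact ((mb.comp measurable_snd).mul ((mgab.comp measurable_fst).mul
        (m2.comp measurable_swap))).aemeasurable
  rw [lhs, rhs]
  have h0 : ∀ᵐ s : ℝ, s ≠ 0 := Measure.ae_ne volume 0
  have h1 : ∀ᵐ s : ℝ, s ≠ 1 := Measure.ae_ne volume 1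
  refine lintegral_congr_ae (h0.mono fun s hs => ?_)
  dsimp only
  rcases lt_or_gt_of_ne hs with hs | hs
  · rw [lintegral_eq_zero_of_ae_eq_zero, lintegral_eq_zero_of_ae_eq_zero]
    · refine ae_of_all _ fun p => ?_
      simp [gammaPDF_of_neg hs]
    · refine ae_of_all _ fun x => ?_
      rcases lt_or_ge x 0 with hx | hx
      · simp [gammaPDF_of_neg hx]
      · simp [gammaPDF_of_neg (show s - x < 0 by linarith)]
  · have m3 : Measurable fun x => gammaPDF a 1 x * (gammaPDF b 1 (s - x) * h x (s - x)) :=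
      mga.mul ((mgb.comp (measurable_const.sub measurable_id)).mul
        (h2 measurable_id (measurable_const.sub measurable_id)))
    rw [lintegral_comp_mul_left_volume hs m3]
    refine lintegral_congr_ae ((h0.and h1).mono fun p hp => ?_)
    dsimp only
    rw [← mul_assoc (betaPDF a b p), ← gammaPDF_mul_gammaPDF ha hb hs hp.1 hp.2,
      show s - p * s = (1 - p) * s by ring]
    ring

lemma ae_pos_gammaMeasure (a : ℝ) : ∀ᵐ x ∂(gammaMeasure a 1), 0 < x := by
  rw [gammaMeasure, ae_withDensity_iff (measurable_gammaPDF a 1)]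
  refine (Measure.ae_ne volume (0 : ℝ)).mono fun x hx h => ?_
  by_contra hneg
  exact h (gammaPDF_of_neg (lt_of_le_of_ne (not_lt.1 hneg) hx))

lemma ae_mem_Ioo_betaMeasure (a b : ℝ) : ∀ᵐ p ∂(betaMeasure a b), p ∈ Set.Ioo (0 : ℝ) 1 := by
  rw [betaMeasure, ae_withDensity_iff (measurable_betaPDF a b)]
  refine ae_of_all _ fun x h => ⟨?_, ?_⟩
  · by_contra hneg; exact h (betaPDF_eq_zero_of_nonpos (not_lt.1 hneg))
  · by_contra hneg; exact h (betaPDF_eq_zero_of_one_le (not_lt.1 hneg))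

/-- `Γ(a, c)` is the law of `c X` with `X ∼ Γ(a, 1)`, also for `c = 0`. -/
lemma gammaLaw_eq_map {a c : ℝ} (ha : 0 < a) (hc : 0 ≤ c) :
    gammaLaw a c = (gammaMeasure a 1).map (fun x => c * x) := by
  have := isProbabilityMeasure_gammaMeasure ha one_pos
  unfold gammaLaw
  split_ifs with h
  · subst h
    simp
  have hc : 0 < c := lt_of_le_of_ne hc (Ne.symm h)
  refine Measure.ext_of_lintegral _ fun f hf => ?_
  have m1 := measurable_gammaPDF a 1
  have m2 := measurable_gammaPDF a c⁻¹
  rw [lintegral_map hf (by fun_prop), gammaMeasure, gammaMeasure,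
    lintegral_withDensity_eq_lintegral_mul _ m2 hf,
    lintegral_withDensity_eq_lintegral_mul _ m1 (by fun_prop),
    lintegral_comp_mul_left_volume hc (m2.mul hf)]
  refine lintegral_congr fun x => ?_
  simp only [Pi.mul_apply]
  rw [← mul_assoc, mul_comm x c]
  congr 1
  rcases lt_or_ge x 0 with hx | hx
  · rw [gammaPDF_of_neg hx, gammaPDF_of_neg (by nlinarith), mul_zero]
  · rw [gammaPDF_of_nonneg hx, gammaPDF_of_nonneg (by positivity), ← ENNReal.ofReal_mul hc.le]
    congr 1
    rw [Real.mul_rpow hc.le hx, Real.inv_rpow hc.le, Real.rpow_sub_one hc.ne']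
    have e : c⁻¹ * (c * x) = 1 * x := by field_simp
    have := (Real.rpow_pos_of_pos hc a).ne'
    have := (Real.Gamma_pos_of_pos ha).ne'
    rw [e, Real.one_rpow]
    field_simp

lemma lintegral_sq_gammaMeasure {a : ℝ} (ha : 0 < a) :
    ∫⁻ x, ENNReal.ofReal (x ^ 2) ∂(gammaMeasure a 1) = ENNReal.ofReal (a * (a + 1)) := by
  have m1 := measurable_gammaPDF a 1
  have m2 := measurable_gammaPDF (a + 2) 1
  rw [gammaMeasure, lintegral_withDensity_eq_lintegral_mul _ m1 (by fun_prop)]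
  have key : ∀ᵐ x : ℝ, (gammaPDF a 1 * fun x => ENNReal.ofReal (x ^ 2)) x =
      ENNReal.ofReal (a * (a + 1)) * gammaPDF (a + 2) 1 x := by
    refine (Measure.ae_ne volume (0 : ℝ)).mono fun x hx => ?_
    rw [Pi.mul_apply]
    rcases lt_or_gt_of_ne hx with hx | hx
    · rw [gammaPDF_of_neg hx, gammaPDF_of_neg hx]; simp
    · have hg := Real.Gamma_pos_of_pos ha
      rw [gammaPDF_of_nonneg hx.le, gammaPDF_of_nonneg hx.le,
        ← ENNReal.ofReal_mul (by positivity), ← ENNReal.ofReal_mul (by positivity)]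
      congr 1
      have e1 : Real.Gamma (a + 2) = (a + 1) * (a * Real.Gamma a) := by
        rw [← Real.Gamma_add_one ha.ne', ← Real.Gamma_add_one (by positivity)]; congr 1; ring
      have e2 : x ^ (a + 2 - 1) = x ^ (a - 1) * x ^ 2 := by
        rw [← Real.rpow_natCast x 2, ← Real.rpow_add hx]; congr 1; push_cast; ring
      rw [e1, e2]
      simp only [Real.one_rpow]
      field_simp
  rw [lintegral_congr_ae key, lintegral_const_mul _ m2,
    lintegral_gammaPDF_eq_one (by positivity) one_pos, mul_one]

/-- Size-biasing a Beta density by `p` or `p (1 - p)` gives Beta densities again. -/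
lemma integral_betaMeasure_pow_mul {a b : ℝ} (ha : 0 < a) (hb : 0 < b) (k l : ℕ) :
    ∫ p, p ^ k * (1 - p) ^ l ∂(betaMeasure a b) = beta (a + k) (b + l) / beta a b := by
  have hak : 0 < a + k := by positivity
  have hbl : 0 < b + l := by positivity
  have m1 := measurable_betaPDF a b
  have m2 := measurable_betaPDF (a + k) (b + l)
  rw [integral_eq_lintegral_of_nonneg_ae]
  rotate_left
  · exact (ae_mem_Ioo_betaMeasure a b).mono fun p hp => by
      have : 0 ≤ 1 - p := by linarith [hp.2]
      have := hp.1.le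
      dsimp; positivity
  · exact Measurable.aestronglyMeasurable (by fun_prop)
  rw [betaMeasure, lintegral_withDensity_eq_lintegral_mul _ m1 (by fun_prop)]
  have hB := beta_pos ha hb
  have hB' := beta_pos hak hbl
  have key : ∀ p : ℝ, (betaPDF a b * fun p => ENNReal.ofReal (p ^ k * (1 - p) ^ l)) p =
      ENNReal.ofReal (beta (a + k) (b + l) / beta a b) * betaPDF (a + k) (b + l) p := by
    intro p
    rw [Pi.mul_apply]
    rcases le_or_gt p 0 with h0 | h0
    · rw [betaPDF_eq_zero_of_nonpos h0, betaPDF_eq_zero_of_nonpos h0]; simp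
    rcases le_or_gt 1 p with h1 | h1
    · rw [betaPDF_eq_zero_of_one_le h1, betaPDF_eq_zero_of_one_le h1]; simp
    have hq : 0 < 1 - p := by linarith
    rw [betaPDF_of_pos_lt_one h0 h1, betaPDF_of_pos_lt_one h0 h1,
      ← ENNReal.ofReal_mul (by positivity), ← ENNReal.ofReal_mul (by positivity)]
    congr 1
    have e1 : p ^ (a + k - 1) = p ^ (a - 1) * p ^ k := by
      rw [← Real.rpow_natCast p k, ← Real.rpow_add h0]; congr 1; ring
    have e2 : (1 - p) ^ (b + l - 1) = (1 - p) ^ (b - 1) * (1 - p) ^ l := by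
      rw [← Real.rpow_natCast (1 - p) l, ← Real.rpow_add hq]; congr 1; ring
    rw [e1, e2]
    field_simp
  simp_rw [key]
  rw [lintegral_const_mul _ m2, lintegral_betaPDF_eq_one hak hbl, mul_one,
    ENNReal.toReal_ofReal (by positivity)]

lemma integral_id_betaMeasure {a b : ℝ} (ha : 0 < a) (hb : 0 < b) :
    ∫ p, p ∂(betaMeasure a b) = a / (a + b) := by
  have := integral_betaMeasure_pow_mul ha hb 1 0
  simp only [pow_one, pow_zero, mul_one, Nat.cast_one, Nat.cast_zero, add_zero] at this
  rw [this, beta, beta, show a + 1 + b = (a + b) + 1 by ring, Real.Gamma_add_one ha.ne',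
    Real.Gamma_add_one (by positivity)]
  have := Real.Gamma_pos_of_pos ha
  have := Real.Gamma_pos_of_pos hb
  have := Real.Gamma_pos_of_pos (add_pos ha hb)
  field_simp

lemma integral_mul_one_sub_betaMeasure {a b : ℝ} (ha : 0 < a) (hb : 0 < b) :
    ∫ p, p * (1 - p) ∂(betaMeasure a b) = a * b / ((a + b) * (a + b + 1)) := by
  have := integral_betaMeasure_pow_mul ha hb 1 1
  simp only [pow_one, Nat.cast_one] at this
  rw [this, beta, beta, show a + 1 + (b + 1) = (a + b + 1) + 1 by ring, Real.Gamma_add_one ha.ne',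
    Real.Gamma_add_one hb.ne', Real.Gamma_add_one (s := a + b + 1) (by positivity),
    Real.Gamma_add_one (s := a + b) (by positivity)]
  have := Real.Gamma_pos_of_pos ha
  have := Real.Gamma_pos_of_pos hb
  have := Real.Gamma_pos_of_pos (add_pos ha hb)
  field_simp

/-! ### Stationary laws on compact spaces -/

open scoped BoundedContinuousFunction in
/-- Krylov–Bogoliubov: a Feller Markov operator on a compact space has a stationary law. The
operator is given by its action `P` on probability measures and its action `T` on functions. -/
theorem exists_fixed_probabilityMeasure {K : Type*} [TopologicalSpace K] [T2Space K]
    [CompactSpace K] [HasOuterApproxClosed K] [MeasurableSpace K] [BorelSpace K] [Nonempty K]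
    (P : ProbabilityMeasure K → ProbabilityMeasure K) (T : (K →ᵇ ℝ) → (K →ᵇ ℝ))
    (hPT : ∀ (m : ProbabilityMeasure K) (f : K →ᵇ ℝ),
      ∫ x, f x ∂(P m : Measure K) = ∫ x, T f x ∂(m : Measure K)) :
    ∃ m : ProbabilityMeasure K, P m = m := by
  obtain ⟨x₀⟩ := ‹Nonempty K›
  let m₀ : ProbabilityMeasure K := ⟨Measure.dirac x₀, inferInstance⟩
  let m : ℕ → ProbabilityMeasure K := fun n => P^[n] m₀
  let ρ' : ℕ → Measure K := fun n =>
    ((n + 1 : ℕ) : ENNReal)⁻¹ • ∑ k ∈ Finset.range (n + 1), (m k : Measure K)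
  have hρ' : ∀ n, IsProbabilityMeasure (ρ' n) := fun n => ⟨by
    simp only [ρ', Measure.smul_apply, Measure.finsetSum_apply, measure_univ, smul_eq_mul,
      Finset.sum_const, Finset.card_range, nsmul_eq_mul, mul_one]
    exact ENNReal.inv_mul_cancel (by simp) (by simp)⟩
  let ρ : ℕ → ProbabilityMeasure K := fun n => ⟨ρ' n, hρ' n⟩
  have hint : ∀ (n : ℕ) (f : K →ᵇ ℝ), ∫ x, f x ∂(ρ n : Measure K) =
      ((n + 1 : ℕ) : ℝ)⁻¹ * ∑ k ∈ Finset.range (n + 1), ∫ x, f x ∂(m k : Measure K) := by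
    intro n f
    change ∫ x, f x ∂(ρ' n) = _
    rw [integral_smul_measure, integral_finsetSum_measure fun k _ => f.integrable _,
      ENNReal.toReal_inv, ENNReal.toReal_natCast, smul_eq_mul]
  have hdiff : ∀ f : K →ᵇ ℝ, Tendsto (fun n => ∫ x, T f x ∂(ρ n : Measure K) -
      ∫ x, f x ∂(ρ n : Measure K)) atTop (𝓝 0) := by
    intro f
    have e : ∀ n, ∫ x, T f x ∂(ρ n : Measure K) - ∫ x, f x ∂(ρ n : Measure K) =
        ((n + 1 : ℕ) : ℝ)⁻¹ *
          (∫ x, f x ∂(m (n + 1) : Measure K) - ∫ x, f x ∂(m 0 : Measure K)) := by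
      intro n
      rw [hint, hint, ← mul_sub, ← Finset.sum_sub_distrib,
        ← Finset.sum_range_sub (fun k => ∫ x, f x ∂(m k : Measure K))]
      congr 1
      refine Finset.sum_congr rfl fun k _ => ?_
      rw [← hPT, ← Function.iterate_succ_apply' P]
    have hb : ∀ k, |∫ x, f x ∂(m k : Measure K)| ≤ ‖f‖ := fun k => by
      simpa using f.norm_integral_le_norm (μ := (m k : Measure K))
    have hlim : Tendsto (fun n : ℕ => ((n + 1 : ℕ) : ℝ)⁻¹ * (2 * ‖f‖)) atTop (𝓝 0) := by
      have := (tendsto_inv_atTop_nhds_zero_nat (𝕜 := ℝ)).comp (tendsto_add_atTop_nat 1)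
      simpa using this.mul_const (2 * ‖f‖)
    refine squeeze_zero_norm (fun n => ?_) hlim
    rw [e, norm_mul, norm_inv, Real.norm_natCast, Real.norm_eq_abs]
    gcongr
    have h1 := abs_le.1 (hb (n + 1))
    have h2 := abs_le.1 (hb 0)
    exact abs_le.2 ⟨by linarith [h1.1, h2.2], by linarith [h1.2, h2.1]⟩
  let F : Ultrafilter (ProbabilityMeasure K) := (hyperfilter ℕ).map ρ
  have hF : Tendsto ρ (hyperfilter ℕ) (𝓝 F.lim) := F.le_nhds_lim
  have hconv := ProbabilityMeasure.tendsto_iff_forall_integral_tendsto.1 hF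
  refine ⟨F.lim, Subtype.ext ?_⟩
  change (P F.lim : Measure K) = (F.lim : Measure K)
  refine ext_of_forall_integral_eq_of_IsFiniteMeasure fun f => ?_
  rw [hPT, ← sub_eq_zero]
  exact tendsto_nhds_unique ((hconv (T f)).sub (hconv f))
    ((hdiff f).mono_left Nat.hyperfilter_le_atTop)

/-- One step of the superposition of finitely many randomly rung maps: ring `j` has rate `a j`,
draws `p` from `β j`, and applies `g j (·, p)`. -/
def ringGain {ι X : Type*} [MeasurableSpace X] (J : Finset ι) (a : ι → ℝ) (β : ι → Measure ℝ)
    (g : ι → X × ℝ → X) (ν : Measure X) : Measure X :=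
  ∑ j ∈ J, ENNReal.ofReal (a j) • (ν.prod (β j)).map (g j)

open scoped BoundedContinuousFunction in
theorem exists_ringGain_eq_smul {ι K : Type*} [TopologicalSpace K] [T2Space K]
    [CompactSpace K] [HasOuterApproxClosed K] [SecondCountableTopology K]
    [MeasurableSpace K] [BorelSpace K] [Nonempty K]
    (J : Finset ι) {a : ι → ℝ} (ha : ∀ j ∈ J, 0 < a j) (hJ : J.Nonempty) (β : ι → Measure ℝ)
    (hβ : ∀ j, IsProbabilityMeasure (β j)) {g : ι → K × ℝ → K} (hg : ∀ j, Continuous (g j)) :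
    ∃ m : Measure K, IsProbabilityMeasure m ∧
      ringGain J a β g m = ENNReal.ofReal (∑ j ∈ J, a j) • m := by
  set A := ∑ j ∈ J, a j with hA
  have hApos : 0 < A := Finset.sum_pos ha hJ
  have hA0 : ENNReal.ofReal A ≠ 0 := by simpa using hApos
  have hprob : ∀ m : ProbabilityMeasure K,
      IsProbabilityMeasure ((ENNReal.ofReal A)⁻¹ • ringGain J a β g (m : Measure K)) := by
    intro m
    constructor
    have : ∀ j, ((m : Measure K).prod (β j)).map (g j) Set.univ = 1 := fun j => by
      rw [Measure.map_apply (hg j).measurable MeasurableSet.univ]; simp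
    simp only [ringGain, Measure.smul_apply, Measure.finsetSum_apply, this, smul_eq_mul, mul_one]
    rw [← ENNReal.ofReal_sum_of_nonneg fun j hj => (ha j hj).le]
    exact ENNReal.inv_mul_cancel hA0 ENNReal.ofReal_ne_top
  have hcont : ∀ (j : ι) (f : K →ᵇ ℝ), Continuous fun x => ∫ p, f (g j (x, p)) ∂(β j) := by
    intro j f
    refine continuous_of_dominated (bound := fun _ => ‖f‖) (fun x => ?_) (fun x => ?_)
      (integrable_const _) ?_
    · exact (f.continuous.comp ((hg j).comp (by fun_prop))).aestronglyMeasurable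
    · exact ae_of_all _ fun p => f.norm_coe_le_norm _
    · exact ae_of_all _ fun p => f.continuous.comp ((hg j).comp (by fun_prop))
  let T : (K →ᵇ ℝ) → (K →ᵇ ℝ) := fun f => BoundedContinuousFunction.mkOfCompact
    ⟨fun x => A⁻¹ * ∑ j ∈ J, a j * ∫ p, f (g j (x, p)) ∂(β j),
      continuous_const.mul (continuous_finsetSum _ fun j _ => continuous_const.mul (hcont j f))⟩
  obtain ⟨m, hm⟩ := exists_fixed_probabilityMeasure (fun m => ⟨_, hprob m⟩) T (by
    intro m f
    change ∫ x, f x ∂((ENNReal.ofReal A)⁻¹ • ringGain J a β g (m : Measure K)) =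
      ∫ x, A⁻¹ * ∑ j ∈ J, a j * ∫ p, f (g j (x, p)) ∂(β j) ∂(m : Measure K)
    have hmap : ∀ j, IsProbabilityMeasure (((m : Measure K).prod (β j)).map (g j)) := fun j =>
      Measure.isProbabilityMeasure_map (hg j).measurable.aemeasurable
    have hi : ∀ j, Integrable (fun x => ∫ p, f (g j (x, p)) ∂(β j)) (m : Measure K) := fun j =>
      (BoundedContinuousFunction.mkOfCompact ⟨_, hcont j f⟩).integrable _
    rw [integral_smul_measure, ringGain, integral_finsetSum_measure fun j _ =>
      (f.integrable _).smul_measure ENNReal.ofReal_ne_top, integral_const_mul,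
      integral_finsetSum _ fun j _ => (hi j).const_mul _, ENNReal.toReal_inv,
      ENNReal.toReal_ofReal hApos.le, smul_eq_mul]
    congr 1
    refine Finset.sum_congr rfl fun j hj => ?_
    rw [integral_smul_measure, ENNReal.toReal_ofReal (ha j hj).le, smul_eq_mul,
      integral_const_mul, integral_map (hg j).measurable.aemeasurable
        f.continuous.aestronglyMeasurable, integral_prod]
    exact ((f.compContinuous ⟨g j, hg j⟩).integrable _))
  refine ⟨m, inferInstance, ?_⟩
  have hm' : (ENNReal.ofReal A)⁻¹ • ringGain J a β g (m : Measure K) = (m : Measure K) :=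
    congrArg Subtype.val hm
  conv_rhs => rw [← hm']
  rw [smul_smul, ENNReal.mul_inv_cancel hA0 ENNReal.ofReal_ne_top, one_smul]

/-! ### The moves of the chain and of its hidden temperatures -/

/-- The moves of the chain: exchange across an edge, or contact with the left or the right bath. -/
abbrev Move (L : ℕ) : Type := (Site L × Site L) ⊕ (Site L ⊕ Site L)

/-- The moves that actually occur. -/
def moves (L : ℕ) : Finset (Move L) :=
  (bulkEdges L).disjSum ((leftSites L).disjSum (rightSites L))

/-- The rate of a move. -/
def rate (L : ℕ) (r : ℤ → ℝ) : Move L → ℝ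
  | .inl e => r e.1
  | .inr (.inl _) => r 0
  | .inr (.inr _) => r ((L : ℤ) - 1)

/-- The law of the random number drawn by a move of the energies. -/
def energyNoise {L : ℕ} (ω : ℤ → ℝ) (T₀ T₁ : ℝ) : Move L → Measure ℝ
  | .inl e => betaMeasure (ω e.1 / 2) (ω e.2 / 2)
  | .inr (.inl u) => gammaLaw (ω u / 2) T₀
  | .inr (.inr u) => gammaLaw (ω u / 2) T₁

/-- The effect of a move on the energies. -/
def energyMap {L : ℕ} : Move L → Config L × ℝ → Config L
  | .inl e => fun q => pool e.1 e.2 q.1 q.2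
  | .inr (.inl u) => fun q => Function.update q.1 u q.2
  | .inr (.inr u) => fun q => Function.update q.1 u q.2

/-- Replace the temperatures at `u` and `v` by their average with weights `b` and `1 - b`. -/
def merge {L : ℕ} (u v : Site L) (θ : Config L) (b : ℝ) : Config L := fun w =>
  if w = u ∨ w = v then b * θ u + (1 - b) * θ v else θ w

/-- The law of the random number drawn by a move of the hidden temperatures; contact with a bath
is deterministic. -/
def hiddenNoise {L : ℕ} (ω : ℤ → ℝ) : Move L → Measure ℝ
  | .inl e => betaMeasure (ω e.1 / 2) (ω e.2 / 2)
  | .inr _ => Measure.dirac 0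

/-- The effect of a move on the hidden temperatures. -/
def hiddenMap {L : ℕ} (T₀ T₁ : ℝ) : Move L → Config L × ℝ → Config L
  | .inl e => fun q => merge e.1 e.2 q.1 q.2
  | .inr (.inl u) => fun q => Function.update q.1 u T₀
  | .inr (.inr u) => fun q => Function.update q.1 u T₁

/-- The effect of one ring of the hidden chain on the law `ν` of the temperatures, every move
weighted by its rate. -/
def hiddenGain (L : ℕ) (r ω : ℤ → ℝ) (T₀ T₁ : ℝ) (ν : Measure (Config L)) :
    Measure (Config L) :=
  ringGain (moves L) (rate L r) (hiddenNoise ω) (hiddenMap T₀ T₁) ν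

variable {L : ℕ} {r ω : ℤ → ℝ} {T₀ T₁ : ℝ}

lemma gain_eq_ringGain (ν : Measure (Config L)) :
    gain L r ω T₀ T₁ ν = ringGain (moves L) (rate L r) (energyNoise ω T₀ T₁) energyMap ν := by
  rw [ringGain, moves, Finset.sum_disjSum, Finset.sum_disjSum]
  rfl

lemma totalRate_eq_sum : totalRate L r = ∑ j ∈ moves L, rate L r j := by
  rw [moves, Finset.sum_disjSum, Finset.sum_disjSum]
  rfl

lemma mem_moves_inl {e : Site L × Site L} :
    (Sum.inl e : Move L) ∈ moves L ↔ (e.2 : ℤ) = (e.1 : ℤ) + 1 := by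
  simp [moves, bulkEdges]

lemma Admissible.rate_pos (h : Admissible L r ω T₀ T₁) (j : Move L) : 0 < rate L r j := by
  rcases j with e | u | u
  · exact h.1 _ e.1.2.1.le e.1.2.2
  · exact h.1 _ le_rfl (u.2.1.trans u.2.2)
  · have := u.2.1.trans u.2.2
    exact h.1 _ (by omega) (by omega)

lemma Admissible.omega_half_pos (h : Admissible L r ω T₀ T₁) (u : Site L) : 0 < ω u / 2 :=
  half_pos (h.2.1 _ u.2.1 u.2.2)

lemma Admissible.isProbabilityMeasure_energyNoise (h : Admissible L r ω T₀ T₁) (j : Move L) :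
    IsProbabilityMeasure (energyNoise ω T₀ T₁ j) := by
  rcases j with e | u | u
  · exact isProbabilityMeasureBeta (h.omega_half_pos _) (h.omega_half_pos _)
  · exact isProbabilityMeasure_gammaLaw (h.omega_half_pos u) h.2.2.1
  · exact isProbabilityMeasure_gammaLaw (h.omega_half_pos u) h.2.2.2

lemma Admissible.isProbabilityMeasure_hiddenNoise (h : Admissible L r ω T₀ T₁) (j : Move L) :
    IsProbabilityMeasure (hiddenNoise ω j) := by
  rcases j with e | u
  · exact isProbabilityMeasureBeta (h.omega_half_pos _) (h.omega_half_pos _)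
  · exact Measure.dirac.isProbabilityMeasure

lemma measurable_energyMap (j : Move L) : Measurable (energyMap j) := by
  rcases j with e | u | u
  · exact measurable_pool _ _
  · exact measurable_reset _
  · exact measurable_reset _

lemma continuous_merge (u v : Site L) :
    Continuous fun q : Config L × ℝ => merge u v q.1 q.2 := by
  refine continuous_pi fun w => ?_
  unfold merge
  split_ifs <;> fun_prop

lemma continuous_hiddenMap (j : Move L) : Continuous (hiddenMap T₀ T₁ j) := by
  rcases j with e | u | u
  · exact continuous_merge _ _
  · exact continuous_fst.update u continuous_const
  · exact continuous_fst.update u continuous_const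

lemma moves_nonempty (hL : 2 ≤ L) : (moves L).Nonempty := by
  let u : Site L := ⟨1, by simp, by simp; omega⟩
  exact ⟨.inr (.inl u), by simp [moves, leftSites, u]⟩

/-! ### The energies are Gamma variables modulated by the hidden temperatures -/

/-- The standard Gamma variables: independent, of shape `ω w / 2` and scale `1`. -/
def gammaPi (L : ℕ) (ω : ℤ → ℝ) : Measure (Config L) :=
  Measure.pi fun w : Site L => gammaMeasure (ω w / 2) 1

/-- The law of `(θ w * X w)_w`, where `θ` has law `ν` and `X` consists of independent standard
Gamma variables. -/
def mixture (L : ℕ) (ω : ℤ → ℝ) (ν : Measure (Config L)) : Measure (Config L) :=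
  (ν.prod (gammaPi L ω)).map fun q => q.1 * q.2

lemma Admissible.isProbabilityMeasure_gamma (h : Admissible L r ω T₀ T₁) (w : Site L) :
    IsProbabilityMeasure (gammaMeasure (ω w / 2) 1) :=
  isProbabilityMeasure_gammaMeasure (h.omega_half_pos w) one_pos

lemma Admissible.isProbabilityMeasure_gammaPi (h : Admissible L r ω T₀ T₁) :
    IsProbabilityMeasure (gammaPi L ω) := by
  have := h.isProbabilityMeasure_gamma
  unfold gammaPi
  infer_instance

/-- Resampling one coordinate of a product measure does not change it. -/
lemma lintegral_pi_resample {ι : Type*} [Fintype ι] [DecidableEq ι] (γ : ι → Measure ℝ)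
    [∀ i, IsProbabilityMeasure (γ i)] (u : ι) {F : (ι → ℝ) → ENNReal} (hF : Measurable F) :
    ∫⁻ X, F X ∂(Measure.pi γ) =
      ∫⁻ X, ∫⁻ a, F (Function.update X u a) ∂(γ u) ∂(Measure.pi γ) := by
  have hm : Measurable fun q : (ι → ℝ) × ℝ => Function.update q.1 u q.2 := by
    refine measurable_pi_lambda _ fun w => ?_
    by_cases h : w = u
    · subst h; simpa using measurable_snd
    · simp only [Function.update_of_ne h]; fun_prop
  have key : Measure.pi γ =
      ((Measure.pi γ).prod (γ u)).map fun q => Function.update q.1 u q.2 := by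
    refine (Measure.pi_eq fun s hs => ?_)
    rw [Measure.map_apply hm (MeasurableSet.univ_pi hs)]
    have : (fun q : (ι → ℝ) × ℝ => Function.update q.1 u q.2) ⁻¹' Set.univ.pi s =
        (Set.univ.pi (Function.update s u Set.univ)) ×ˢ s u := by
      ext q
      simp only [Set.mem_preimage, Set.mem_univ_pi, Set.mem_prod]
      constructor
      · refine fun h => ⟨fun i => ?_, by simpa using h u⟩
        by_cases hi : i = u
        · subst hi; simp
        · simpa [hi] using h i
      · rintro ⟨h, h'⟩ i
        by_cases hi : i = u
        · subst hi; simpa using h'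
        · simpa [hi] using h i
    rw [this, Measure.prod_prod, Measure.pi_pi, ← Finset.prod_erase_mul _ _ (Finset.mem_univ u),
      ← Finset.prod_erase_mul _ _ (Finset.mem_univ u)]
    simp only [Function.update_self, measure_univ, mul_one]
    congr 1
    refine Finset.prod_congr rfl fun i hi => ?_
    rw [Function.update_of_ne (Finset.ne_of_mem_erase hi)]
  conv_lhs => rw [key]
  rw [lintegral_map hF hm, lintegral_prod (fun q : (ι → ℝ) × ℝ => F (Function.update q.1 u q.2))
    (hF.comp hm).aemeasurable]

/-- Two sites: pooling and redistributing the energies `x X, y Y` is the same in law as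
giving both sites the temperature `q x + (1 - q) y`, with `q` a Beta variable. -/
lemma lintegral_gamma_pool {a b : ℝ} (ha : 0 < a) (hb : 0 < b) (x y : ℝ)
    {g : ℝ → ℝ → ENNReal} (hg : Measurable (Function.uncurry g)) :
    ∫⁻ X, ∫⁻ Y, ∫⁻ p, g (p * (x * X + y * Y)) ((1 - p) * (x * X + y * Y))
        ∂(betaMeasure a b) ∂(gammaMeasure b 1) ∂(gammaMeasure a 1) =
      ∫⁻ q, ∫⁻ X, ∫⁻ Y, g ((q * x + (1 - q) * y) * X) ((q * x + (1 - q) * y) * Y)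
        ∂(gammaMeasure b 1) ∂(gammaMeasure a 1) ∂(betaMeasure a b) := by
  have := isProbabilityMeasureBeta ha hb
  have := isProbabilityMeasure_gammaMeasure (add_pos ha hb) one_pos
  have h2 : ∀ {X : Type} [MeasurableSpace X] {f f' : X → ℝ}, Measurable f → Measurable f' →
      Measurable fun x => g (f x) (f' x) := fun hf hf' => hg.comp (hf.prodMk hf')
  rw [lintegral_gamma_gamma ha hb (h := fun X Y => ∫⁻ p, g (p * (x * X + y * Y))
    ((1 - p) * (x * X + y * Y)) ∂(betaMeasure a b))]
  · refine lintegral_congr fun q => ?_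
    rw [lintegral_gamma_gamma ha hb
      (h := fun X Y => g ((q * x + (1 - q) * y) * X) ((q * x + (1 - q) * y) * Y))
      (h2 (f := fun z : ℝ × ℝ => (q * x + (1 - q) * y) * z.1)
        (f' := fun z : ℝ × ℝ => (q * x + (1 - q) * y) * z.2) (by fun_prop) (by fun_prop)),
      lintegral_lintegral_swap]
    · refine lintegral_congr fun p => lintegral_congr fun s => ?_
      congr 1 <;> ring
    · exact (h2 (f := fun z : ℝ × ℝ => z.2 * (x * (q * z.1) + y * ((1 - q) * z.1)))
        (f' := fun z : ℝ × ℝ => (1 - z.2) * (x * (q * z.1) + y * ((1 - q) * z.1)))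
        (by fun_prop) (by fun_prop)).aemeasurable
  · exact Measurable.lintegral_prod_right' (f := fun z : (ℝ × ℝ) × ℝ =>
      g (z.2 * (x * z.1.1 + y * z.1.2)) ((1 - z.2) * (x * z.1.1 + y * z.1.2)))
      (h2 (by fun_prop) (by fun_prop))

/-- The mixture intertwines the bath contacts of energies and hidden temperatures. -/
lemma lintegral_reset_gammaPi (h : Admissible L r ω T₀ T₁) (u : Site L) {T : ℝ} (hT : 0 ≤ T)
    (θ : Config L) {f : Config L → ENNReal} (hf : Measurable f) :
    ∫⁻ X, ∫⁻ η, f (Function.update (θ * X) u η) ∂(gammaLaw (ω u / 2) T) ∂(gammaPi L ω) =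
      ∫⁻ X, f (Function.update θ u T * X) ∂(gammaPi L ω) := by
  have := h.isProbabilityMeasure_gamma
  conv_rhs => rw [gammaPi, lintegral_pi_resample _ u (F := fun X => f (Function.update θ u T * X))
    (hf.comp (measurable_const_mul _))]
  refine lintegral_congr fun X => ?_
  have hm : Measurable fun η => f (Function.update (θ * X) u η) :=
    hf.comp ((measurable_reset u).comp (f := fun η : ℝ => (θ * X, η)) (by fun_prop))
  rw [gammaLaw_eq_map (h.omega_half_pos u) hT, lintegral_map hm (by fun_prop)]
  refine lintegral_congr fun a => congrArg f ?_
  ext w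
  by_cases hw : w = u
  · subst hw; simp
  · simp [hw]

/-- The mixture intertwines the exchange of energies with the merging of hidden temperatures. -/
lemma lintegral_pool_gammaPi (h : Admissible L r ω T₀ T₁) {u v : Site L} (huv : u ≠ v)
    (θ : Config L) {f : Config L → ENNReal} (hf : Measurable f) :
    ∫⁻ X, ∫⁻ p, f (pool u v (θ * X) p) ∂(betaMeasure (ω u / 2) (ω v / 2)) ∂(gammaPi L ω) =
      ∫⁻ b, ∫⁻ X, f (merge u v θ b * X) ∂(gammaPi L ω) ∂(betaMeasure (ω u / 2) (ω v / 2)) := by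
  have := h.isProbabilityMeasure_gamma
  have := h.isProbabilityMeasure_gammaPi
  have hu := h.omega_half_pos u
  have hv := h.omega_half_pos v
  have := isProbabilityMeasureBeta hu hv
  set β := betaMeasure (ω u / 2) (ω v / 2)
  set G := gammaPi L ω with hG
  -- resample the standard variables at `u` and `v` on both sides
  have resample : ∀ {F : Config L → ENNReal}, Measurable F → ∫⁻ X, F X ∂G =
      ∫⁻ X, ∫⁻ a, ∫⁻ b, F (Function.update (Function.update X u a) v b)
        ∂(gammaMeasure (ω v / 2) 1) ∂(gammaMeasure (ω u / 2) 1) ∂G := by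
    intro F hF
    rw [hG, gammaPi, lintegral_pi_resample _ v hF]
    exact lintegral_pi_resample _ u (Measurable.lintegral_prod_right'
      (f := fun q : Config L × ℝ => F (Function.update q.1 v q.2)) (hF.comp (measurable_reset v)))
  let E : Config L → ℝ → ℝ → Config L := fun X y z =>
    Function.update (Function.update (θ * X) u y) v z
  have hE : Measurable fun q : Config L × ℝ × ℝ => E q.1 q.2.1 q.2.2 := by
    refine (measurable_reset v).comp (f := fun q : Config L × ℝ × ℝ =>
      (Function.update (θ * q.1) u q.2.1, q.2.2)) (Measurable.prodMk ?_ (by fun_prop))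
    exact (measurable_reset u).comp (f := fun q : Config L × ℝ × ℝ => (θ * q.1, q.2.1))
      ((measurable_fst.const_mul θ).prodMk (by fun_prop))
  have e1 : ∀ (X : Config L) (a b p : ℝ),
      pool u v (θ * Function.update (Function.update X u a) v b) p =
        E X (p * (θ u * a + θ v * b)) ((1 - p) * (θ u * a + θ v * b)) := by
    intro X a b p
    ext w
    by_cases hw : w = u
    · subst hw; simp [pool, E, huv]
    · by_cases hw' : w = v
      · subst hw'; simp [pool, E, hw, huv]
      · simp [pool, E, hw, hw']
  have e2 : ∀ (X : Config L) (a b q : ℝ),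
      merge u v θ q * Function.update (Function.update X u a) v b =
        E X ((q * θ u + (1 - q) * θ v) * a) ((q * θ u + (1 - q) * θ v) * b) := by
    intro X a b q
    ext w
    by_cases hw : w = u
    · subst hw; simp [merge, E, huv]
    · by_cases hw' : w = v
      · subst hw'; simp [merge, E]
      · simp [merge, E, hw, hw']
  have hpool : Measurable fun q : Config L × ℝ => f (pool u v (θ * q.1) q.2) :=
    hf.comp ((measurable_pool u v).comp (f := fun q : Config L × ℝ => (θ * q.1, q.2))
      ((measurable_fst.const_mul θ).prodMk measurable_snd))
  have hmerge : Measurable fun q : Config L × ℝ => f (merge u v θ q.2 * q.1) :=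
    hf.comp (((continuous_merge u v).measurable.comp (f := fun q : Config L × ℝ => (θ, q.2))
      (measurable_const.prodMk measurable_snd)).mul measurable_fst)
  rw [lintegral_lintegral_swap (f := fun b X => f (merge u v θ b * X))
    (hmerge.comp measurable_swap).aemeasurable,
    resample (Measurable.lintegral_prod_right' hpool),
    resample (Measurable.lintegral_prod_right' hmerge)]
  refine lintegral_congr fun X => ?_
  have hfE : Measurable (Function.uncurry fun y z => f (E X y z)) :=
    hf.comp (hE.comp measurable_prodMk_left)
  simp only [e1, e2]
  rw [lintegral_gamma_pool hu hv (θ u) (θ v) (g := fun y z => f (E X y z)) hfE]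
  -- move the integral over the Beta variable inside
  have hm3 : Measurable fun q : ℝ × ℝ × ℝ => f (E X ((q.1 * θ u + (1 - q.1) * θ v) * q.2.1)
      ((q.1 * θ u + (1 - q.1) * θ v) * q.2.2)) :=
    hfE.comp (f := fun q : ℝ × ℝ × ℝ => ((q.1 * θ u + (1 - q.1) * θ v) * q.2.1,
      (q.1 * θ u + (1 - q.1) * θ v) * q.2.2)) (by fun_prop)
  rw [lintegral_lintegral_swap]
  · refine lintegral_congr fun a => ?_
    rw [lintegral_lintegral_swap]
    exact (hm3.comp (f := fun q : ℝ × ℝ => (q.1, a, q.2)) (by fun_prop)).aemeasurable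
  · exact (Measurable.lintegral_prod_right' (hm3.comp
      (f := fun q : (ℝ × ℝ) × ℝ => (q.1.1, q.1.2, q.2)) (by fun_prop))).aemeasurable

lemma lintegral_energyMap_gammaPi (h : Admissible L r ω T₀ T₁) {j : Move L} (hj : j ∈ moves L)
    (θ : Config L) {f : Config L → ENNReal} (hf : Measurable f) :
    ∫⁻ X, ∫⁻ p, f (energyMap j (θ * X, p)) ∂(energyNoise ω T₀ T₁ j) ∂(gammaPi L ω) =
      ∫⁻ b, ∫⁻ X, f (hiddenMap T₀ T₁ j (θ, b) * X) ∂(gammaPi L ω) ∂(hiddenNoise ω j) := by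
  rcases j with e | u | u
  · refine lintegral_pool_gammaPi h (fun heq => ?_) θ hf
    have := mem_moves_inl.1 hj
    rw [heq] at this
    omega
  · simp only [hiddenMap, hiddenNoise, lintegral_const, measure_univ, mul_one]
    exact lintegral_reset_gammaPi h u h.2.2.1 θ hf
  · simp only [hiddenMap, hiddenNoise, lintegral_const, measure_univ, mul_one]
    exact lintegral_reset_gammaPi h u h.2.2.2 θ hf

lemma lintegral_ringGain {ι X : Type*} [MeasurableSpace X] (J : Finset ι) (a : ι → ℝ)
    {β : ι → Measure ℝ} (hβ : ∀ j, SFinite (β j)) {g : ι → X × ℝ → X} (hg : ∀ j, Measurable (g j))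
    (ν : Measure X) {f : X → ENNReal} (hf : Measurable f) :
    ∫⁻ x, f x ∂(ringGain J a β g ν) =
      ∑ j ∈ J, ENNReal.ofReal (a j) * ∫⁻ x, ∫⁻ p, f (g j (x, p)) ∂(β j) ∂ν := by
  rw [ringGain, lintegral_finsetSum_measure]
  refine Finset.sum_congr rfl fun j _ => ?_
  rw [lintegral_smul_measure, lintegral_map hf (hg j), smul_eq_mul,
    lintegral_prod (fun q => f (g j q)) (hf.comp (hg j)).aemeasurable]

lemma lintegral_mixture (h : Admissible L r ω T₀ T₁) (ν : Measure (Config L))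
    {f : Config L → ENNReal} (hf : Measurable f) :
    ∫⁻ ξ, f ξ ∂(mixture L ω ν) = ∫⁻ θ, ∫⁻ X, f (θ * X) ∂(gammaPi L ω) ∂ν := by
  have := h.isProbabilityMeasure_gammaPi
  have hm : Measurable fun q : Config L × Config L => q.1 * q.2 := measurable_fst.mul measurable_snd
  rw [mixture, lintegral_map hf hm,
    lintegral_prod (fun q : Config L × Config L => f (q.1 * q.2)) (hf.comp hm).aemeasurable]

/-- The mixture intertwines the energy dynamics with the hidden temperature dynamics. -/
theorem gain_mixture (h : Admissible L r ω T₀ T₁) (ν : Measure (Config L)) :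
    gain L r ω T₀ T₁ (mixture L ω ν) = mixture L ω (hiddenGain L r ω T₀ T₁ ν) := by
  have := h.isProbabilityMeasure_gammaPi
  have i1 := h.isProbabilityMeasure_energyNoise
  have i2 := h.isProbabilityMeasure_hiddenNoise
  refine Measure.ext_of_lintegral _ fun f hf => ?_
  have hm : Measurable fun q : Config L × Config L => f (q.1 * q.2) :=
    hf.comp (measurable_fst.mul measurable_snd)
  rw [lintegral_mixture h _ hf, gain_eq_ringGain, hiddenGain,
    lintegral_ringGain _ _ (fun j => inferInstance) measurable_energyMap _ hf,
    lintegral_ringGain _ _ (fun j => inferInstance) (fun j => (continuous_hiddenMap j).measurable) _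
      (Measurable.lintegral_prod_right' hm)]
  refine Finset.sum_congr rfl fun j hj => ?_
  congr 1
  rw [lintegral_mixture h _ (Measurable.lintegral_prod_right'
    (f := fun q => f (energyMap j q)) (hf.comp (measurable_energyMap j)))]
  exact lintegral_congr fun θ => lintegral_energyMap_gammaPi h hj θ hf

/-! ### A stationary law of the hidden temperatures -/

lemma merge_mem_Icc {u v : Site L} {θ : Config L} {b x y : ℝ} (hb : b ∈ Set.Icc (0 : ℝ) 1)
    (hθ : ∀ w, θ w ∈ Set.Icc x y) (w : Site L) : merge u v θ b w ∈ Set.Icc x y := by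
  unfold merge
  split_ifs
  · exact (convex_Icc x y) (hθ u) (hθ v) hb.1 (by linarith [hb.2]) (by ring)
  · exact hθ w

lemma hiddenMap_mem_Icc (j : Move L) {θ : Config L} {b : ℝ} (hb : b ∈ Set.Icc (0 : ℝ) 1)
    (hθ : ∀ w, θ w ∈ Set.Icc (min T₀ T₁) (max T₀ T₁)) (w : Site L) :
    hiddenMap T₀ T₁ j (θ, b) w ∈ Set.Icc (min T₀ T₁) (max T₀ T₁) := by
  rcases j with e | u | u
  · exact merge_mem_Icc hb hθ w
  · by_cases hw : w = u
    · subst hw; simp [hiddenMap]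
    · simpa [hiddenMap, hw] using hθ w
  · by_cases hw : w = u
    · subst hw; simp [hiddenMap]
    · simpa [hiddenMap, hw] using hθ w

lemma ae_hiddenNoise_mem_Icc (j : Move L) : ∀ᵐ b ∂(hiddenNoise ω j), b ∈ Set.Icc (0 : ℝ) 1 := by
  rcases j with e | u
  · exact (ae_mem_Ioo_betaMeasure _ _).mono fun b hb => Set.Ioo_subset_Icc_self hb
  · simp [hiddenNoise]

/-- The hidden temperatures have a stationary law, with all temperatures between those of the
baths. -/
theorem exists_hiddenGain_eq_smul (h : Admissible L r ω T₀ T₁) (hL : 2 ≤ L) :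
    ∃ ν : Measure (Config L), IsProbabilityMeasure ν ∧
      (∀ᵐ θ ∂ν, ∀ w, θ w ∈ Set.Icc (min T₀ T₁) (max T₀ T₁)) ∧
      hiddenGain L r ω T₀ T₁ ν = ENNReal.ofReal (totalRate L r) • ν := by
  have hT : min T₀ T₁ ≤ max T₀ T₁ := min_le_max
  set I := Set.Icc (min T₀ T₁) (max T₀ T₁) with hI
  have : Nonempty I := ⟨⟨min T₀ T₁, le_rfl, hT⟩⟩
  have i2 := h.isProbabilityMeasure_hiddenNoise
  let ι : (Site L → I) → Config L := fun θ w => θ w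
  have hι : Continuous ι := by fun_prop
  -- the hidden chain on the compact box; the projection only acts on a null set of noises
  let g : Move L → (Site L → I) × ℝ → (Site L → I) := fun j q w =>
    Set.projIcc _ _ hT (hiddenMap T₀ T₁ j (ι q.1, q.2) w)
  have hg : ∀ j, Continuous (g j) := fun j => continuous_pi fun w => continuous_projIcc.comp
    ((continuous_apply w).comp ((continuous_hiddenMap j).comp
      ((hι.comp continuous_fst).prodMk continuous_snd)))
  obtain ⟨m, hm, hm'⟩ := exists_ringGain_eq_smul (moves L) (a := rate L r)
    (fun j _ => h.rate_pos j) (moves_nonempty hL) (hiddenNoise ω) i2 hg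
  refine ⟨m.map ι, Measure.isProbabilityMeasure_map hι.aemeasurable, ?_, ?_⟩
  · rw [ae_map_iff hι.aemeasurable]
    · exact ae_of_all _ fun θ w => (θ w).2
    · rw [Set.ofPred_forall]
      exact MeasurableSet.iInter fun w => measurable_pi_apply w measurableSet_Icc
  · refine Measure.ext_of_lintegral _ fun f hf => ?_
    rw [totalRate_eq_sum, lintegral_smul_measure, lintegral_map hf hι.measurable,
      ← lintegral_smul_measure, ← hm', hiddenGain,
      lintegral_ringGain _ _ (fun j => inferInstance) (fun j => (continuous_hiddenMap j).measurable)
        _ hf,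
      lintegral_ringGain _ _ (fun j => inferInstance) (fun j => (hg j).measurable) _
        (f := fun θ => f (ι θ)) (hf.comp hι.measurable)]
    refine Finset.sum_congr rfl fun j _ => ?_
    rw [lintegral_map (Measurable.lintegral_prod_right' (f := fun q => f (hiddenMap T₀ T₁ j q))
      (hf.comp (continuous_hiddenMap j).measurable)) hι.measurable]
    congr 1
    refine lintegral_congr fun θ => lintegral_congr_ae ?_
    filter_upwards [ae_hiddenNoise_mem_Icc (ω := ω) j] with b hb
    refine congrArg f (funext fun w => ?_)
    have hmem := hiddenMap_mem_Icc (T₀ := T₀) (T₁ := T₁) j hb (fun w => (θ w).2) w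
    simp only [ι, g]
    rw [Set.projIcc_of_mem hT hmem]

/-! ### Invariant measures are the fixed points of one ring -/

open scoped BoundedContinuousFunction in
lemma IsInvariantMeasure.gain_eq (h : Admissible L r ω T₀ T₁) {μ : Measure (Config L)}
    (hμ : IsInvariantMeasure L r ω T₀ T₁ μ) :
    gain L r ω T₀ T₁ μ = ENNReal.ofReal (totalRate L r) • μ := by
  have := hμ.isProbabilityMeasure
  have := isFiniteMeasure_gain h μ
  have : IsFiniteMeasure (ENNReal.ofReal (totalRate L r) • μ) :=
    μ.smul_finite ENNReal.ofReal_ne_top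
  refine ext_of_forall_integral_eq_of_IsFiniteMeasure fun f => ?_
  have hM : ∀ x, |f x| ≤ ‖f‖ := f.norm_coe_le_norm
  have hd := hasDerivWithinAt_lawAt h μ f.continuous.measurable hM (le_refl (0 : ℝ))
  have hc : HasDerivWithinAt (fun s => ∫ x, f x ∂(lawAt L r ω T₀ T₁ s μ)) 0 (Set.Ici 0) 0 :=
    (hasDerivWithinAt_const (0 : ℝ) _ (∫ x, f x ∂μ)).congr
      (fun s hs => by rw [hμ.invariant s hs]) (by rw [hμ.invariant 0 le_rfl])
  have h0 := (uniqueDiffWithinAt_Ici (0 : ℝ)).eq_deriv _ hd hc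
  rw [lawAt_zero] at h0
  rw [integral_gain h μ f.continuous.measurable hM, h0, zero_add, integral_smul_measure,
    ENNReal.toReal_ofReal h.totalRate_nonneg, smul_eq_mul]

lemma gain_smul (h : Admissible L r ω T₀ T₁) (c : ENNReal) (μ : Measure (Config L)) :
    gain L r ω T₀ T₁ (c • μ) = c • gain L r ω T₀ T₁ μ := by
  have i1 := h.isProbabilityMeasure_energyNoise
  refine Measure.ext_of_lintegral _ fun f hf => ?_
  rw [lintegral_smul_measure, gain_eq_ringGain, gain_eq_ringGain,
    lintegral_ringGain _ _ (fun j => inferInstance) measurable_energyMap _ hf,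
    lintegral_ringGain _ _ (fun j => inferInstance) measurable_energyMap _ hf, smul_eq_mul,
    Finset.mul_sum]
  refine Finset.sum_congr rfl fun j _ => ?_
  rw [lintegral_smul_measure, smul_eq_mul]
  ring

lemma isInvariantMeasure_of_gain_eq (h : Admissible L r ω T₀ T₁) {μ : Measure (Config L)}
    (hp : IsProbabilityMeasure μ) (hnn : ∀ᵐ ξ ∂μ, ∀ w, 0 ≤ ξ w)
    (hg : gain L r ω T₀ T₁ μ = ENNReal.ofReal (totalRate L r) • μ) :
    IsInvariantMeasure L r ω T₀ T₁ μ := by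
  refine ⟨hp, hnn, fun t ht => ?_⟩
  set Λ := totalRate L r with hΛ
  have hΛ0 : 0 ≤ Λ := h.totalRate_nonneg
  have hit : ∀ n : ℕ, (gain L r ω T₀ T₁)^[n] μ = ENNReal.ofReal (Λ ^ n) • μ := by
    intro n
    induction n with
    | zero => simp
    | succ n ih =>
      rw [Function.iterate_succ_apply', ih, gain_smul h, hg, smul_smul,
        ← ENNReal.ofReal_mul (by positivity), pow_succ]
  ext s hs
  rw [lawAt, Measure.sum_apply _ hs]
  have e : ∀ n : ℕ, (ENNReal.ofReal (Real.exp (-(totalRate L r * t)) * (t ^ n / n.factorial)) •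
      (gain L r ω T₀ T₁)^[n] μ) s =
      ENNReal.ofReal (Real.exp (-(Λ * t)) * ((Λ * t) ^ n / n.factorial)) * μ s := by
    intro n
    rw [hit, smul_smul, Measure.smul_apply, smul_eq_mul, ← ENNReal.ofReal_mul (by positivity)]
    congr 2
    rw [mul_pow]; ring
  simp_rw [e]
  have hsum := NormedSpace.expSeries_div_hasSum_exp (Λ * t)
  rw [ENNReal.tsum_mul_right, ← ENNReal.ofReal_tsum_of_nonneg (fun n => by positivity)
    (hsum.summable.mul_left _), tsum_mul_left, hsum.tsum_eq, ← Real.exp_eq_exp_ℝ,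
    ← Real.exp_add]
  simp

/-! ### Uniqueness by contraction -/

/-- If rung maps contract a cost `N` on average, then two stationary laws integrate every bounded
function that is Lipschitz for `N` to the same value. `B j x y` bounds the cost between `x` and
`y` after ring `j`, driven by the same noise. -/
theorem integral_eq_of_ringGain_eq {ι X : Type*} [MeasurableSpace X] {J : Finset ι} {a : ι → ℝ}
    (ha : ∀ j ∈ J, 0 < a j) {β : ι → Measure ℝ} (hβ : ∀ j, IsProbabilityMeasure (β j))
    {g : ι → X × ℝ → X} (hg : ∀ j, Measurable (g j)) {N : X → X → ℝ}
    {B : ι → X → X → ℝ → ℝ} (hB : ∀ j ∈ J, ∀ x y, Integrable (B j x y) (β j))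
    (hNB : ∀ j ∈ J, ∀ x y, ∀ᵐ p ∂(β j), N (g j (x, p)) (g j (y, p)) ≤ B j x y p)
    {κ : ℝ} (hκ0 : 0 ≤ κ) (hκ : κ < ∑ j ∈ J, a j)
    (hcontr : ∀ x y, ∑ j ∈ J, a j * ∫ p, B j x y p ∂(β j) ≤ κ * N x y)
    {μ₁ μ₂ : Measure X} [IsProbabilityMeasure μ₁] [IsProbabilityMeasure μ₂]
    (h₁ : ringGain J a β g μ₁ = ENNReal.ofReal (∑ j ∈ J, a j) • μ₁)
    (h₂ : ringGain J a β g μ₂ = ENNReal.ofReal (∑ j ∈ J, a j) • μ₂)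
    {f : X → ℝ} (hf : Measurable f) {M : ℝ} (hM : ∀ x, |f x| ≤ M) {K : ℝ} (hK : 0 ≤ K)
    (hfN : ∀ x y, |f x - f y| ≤ K * N x y) :
    ∫ x, f x ∂μ₁ = ∫ x, f x ∂μ₂ := by
  set A := ∑ j ∈ J, a j with hA
  have hA0 : 0 < A := hκ0.trans_lt hκ
  let Q : (X → ℝ) → X → ℝ := fun f x => A⁻¹ * ∑ j ∈ J, a j * ∫ p, f (g j (x, p)) ∂(β j)
  -- the class of functions that the Markov operator `Q` improves
  let good : ℝ → (X → ℝ) → Prop := fun K f =>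
    Measurable f ∧ (∀ x, |f x| ≤ M) ∧ ∀ x y, |f x - f y| ≤ K * N x y
  have hint : ∀ {f : X → ℝ}, Measurable f → (∀ x, |f x| ≤ M) → ∀ j x,
      Integrable (fun p => f (g j (x, p))) (β j) := fun hf hM j x =>
    integrable_of_bdd _ (hf.comp ((hg j).comp measurable_prodMk_left)) fun p => hM _
  have hmeas : ∀ {f : X → ℝ}, Measurable f → ∀ j,
      Measurable fun x => ∫ p, f (g j (x, p)) ∂(β j) := fun hf j =>
    (StronglyMeasurable.integral_prod_right' (ν := β j)
      (hf.comp (hg j)).stronglyMeasurable).measurable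
  have hbd : ∀ {f : X → ℝ}, (∀ x, |f x| ≤ M) → ∀ j x, |∫ p, f (g j (x, p)) ∂(β j)| ≤ M := by
    intro f hM j x
    simpa using norm_integral_le_of_norm_le_const (μ := β j) (f := fun p => f (g j (x, p)))
      (C := M) (ae_of_all _ fun p => hM _)
  have hQ : ∀ K f, 0 ≤ K → good K f → good (K * (κ / A)) (Q f) := by
    rintro K f hK ⟨hf, hM, hL⟩
    refine ⟨?_, fun x => ?_, fun x y => ?_⟩
    · exact (Finset.measurable_sum _ fun j _ => (hmeas hf j).const_mul _).const_mul _
    · have : |∑ j ∈ J, a j * ∫ p, f (g j (x, p)) ∂(β j)| ≤ A * M := by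
        rw [hA, Finset.sum_mul]
        refine (Finset.abs_sum_le_sum_abs _ _).trans (Finset.sum_le_sum fun j hj => ?_)
        rw [abs_mul, abs_of_pos (ha j hj)]
        exact mul_le_mul_of_nonneg_left (hbd hM j x) (ha j hj).le
      simp only [Q]
      rw [abs_mul, abs_of_pos (inv_pos.2 hA0), inv_mul_le_iff₀ hA0]
      exact this
    · have : |∑ j ∈ J, a j * ∫ p, f (g j (x, p)) ∂(β j) -
          ∑ j ∈ J, a j * ∫ p, f (g j (y, p)) ∂(β j)| ≤ K * (κ * N x y) := by
        refine le_trans ?_ (mul_le_mul_of_nonneg_left (hcontr x y) hK)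
        rw [← Finset.sum_sub_distrib, Finset.mul_sum]
        refine (Finset.abs_sum_le_sum_abs _ _).trans (Finset.sum_le_sum fun j hj => ?_)
        rw [← mul_sub, abs_mul, abs_of_pos (ha j hj), mul_left_comm,
          ← integral_sub (hint hf hM j x) (hint hf hM j y), ← integral_const_mul]
        refine mul_le_mul_of_nonneg_left ?_ (ha j hj).le
        rw [← Real.norm_eq_abs]
        refine norm_integral_le_of_norm_le ((hB j hj x y).const_mul K) ?_
        filter_upwards [hNB j hj x y] with p hp
        exact (hL _ _).trans (mul_le_mul_of_nonneg_left hp hK)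
      simp only [Q]
      rw [← mul_sub, abs_mul, abs_of_pos (inv_pos.2 hA0), inv_mul_le_iff₀ hA0]
      refine this.trans (le_of_eq ?_)
      field_simp
  have hQint : ∀ {μ : Measure X} [IsProbabilityMeasure μ] {f : X → ℝ},
      ringGain J a β g μ = ENNReal.ofReal A • μ → Measurable f → (∀ x, |f x| ≤ M) →
      ∫ x, Q f x ∂μ = ∫ x, f x ∂μ := by
    intro μ _ f hμ hf hM
    have hp : ∀ j, IsProbabilityMeasure ((μ.prod (β j)).map (g j)) := fun j =>
      Measure.isProbabilityMeasure_map (hg j).aemeasurable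
    have e : ∫ x, f x ∂(ringGain J a β g μ) = A * ∫ x, f x ∂μ := by
      rw [hμ, integral_smul_measure, ENNReal.toReal_ofReal hA0.le, smul_eq_mul]
    rw [ringGain, integral_finsetSum_measure fun j _ =>
      (integrable_of_bdd _ hf hM).smul_measure ENNReal.ofReal_ne_top] at e
    simp only [Q]
    rw [integral_const_mul, inv_mul_eq_iff_eq_mul₀ hA0.ne', ← e, integral_finsetSum]
    · refine Finset.sum_congr rfl fun j hj => ?_
      rw [integral_smul_measure, ENNReal.toReal_ofReal (ha j hj).le, smul_eq_mul,
        integral_map (hg j).aemeasurable hf.aestronglyMeasurable, integral_const_mul,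
        integral_prod]
      exact integrable_of_bdd _ (hf.comp (hg j)) fun x => hM _
    · exact fun j _ => (integrable_of_bdd _ (hmeas hf j) (hbd hM j)).const_mul _
  have hq0 : 0 ≤ κ / A := by positivity
  have hq1 : κ / A < 1 := (div_lt_one hA0).2 hκ
  have hgood : ∀ n, good (K * (κ / A) ^ n) (Q^[n] f) := by
    intro n
    induction n with
    | zero => simpa [good] using ⟨hf, hM, hfN⟩
    | succ n ih =>
      rw [Function.iterate_succ_apply', pow_succ, ← mul_assoc]
      exact hQ _ _ (by positivity) ih
  have hconst : ∀ {μ : Measure X} [IsProbabilityMeasure μ],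
      ringGain J a β g μ = ENNReal.ofReal A • μ → ∀ n, ∫ x, (Q^[n] f) x ∂μ = ∫ x, f x ∂μ := by
    intro μ _ hμ n
    induction n with
    | zero => rfl
    | succ n ih => rw [Function.iterate_succ_apply', hQint hμ (hgood n).1 (hgood n).2.1, ih]
  have hlim : Tendsto (fun n => ∫ q : X × X, ((Q^[n] f) q.1 - (Q^[n] f) q.2) ∂(μ₁.prod μ₂)) atTop
      (𝓝 (∫ _q : X × X, (0 : ℝ) ∂(μ₁.prod μ₂))) := by
    refine tendsto_integral_of_dominated_convergence (fun _ => 2 * M) (fun n => ?_)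
      (integrable_const _) (fun n => ae_of_all _ fun q => ?_) (ae_of_all _ fun q => ?_)
    · exact (((hgood n).1.comp measurable_fst).sub
        ((hgood n).1.comp measurable_snd)).aestronglyMeasurable
    · have h1 := abs_le.1 ((hgood n).2.1 q.1)
      have h2 := abs_le.1 ((hgood n).2.1 q.2)
      exact abs_le.2 ⟨by linarith [h1.1, h2.2], by linarith [h1.2, h2.1]⟩
    · refine squeeze_zero_norm (fun n => (hgood n).2.2 q.1 q.2) ?_
      simpa using ((tendsto_pow_atTop_nhds_zero_of_lt_one hq0 hq1).const_mul K).mul_const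
        (N q.1 q.2)
  have hsplit : ∀ n, ∫ q : X × X, ((Q^[n] f) q.1 - (Q^[n] f) q.2) ∂(μ₁.prod μ₂) =
      ∫ x, f x ∂μ₁ - ∫ x, f x ∂μ₂ := by
    intro n
    rw [integral_sub, integral_fun_fst, integral_fun_snd, hconst h₁, hconst h₂]
    · simp
    · exact integrable_of_bdd _ ((hgood n).1.comp measurable_fst) fun q => (hgood n).2.1 _
    · exact integrable_of_bdd _ ((hgood n).1.comp measurable_snd) fun q => (hgood n).2.1 _
  simp_rw [hsplit] at hlim
  have := tendsto_nhds_unique hlim tendsto_const_nhds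
  simp only [integral_zero] at this
  exact (sub_eq_zero.1 this.symm)

/-! ### The one-site operator and the resistance coordinate -/

/-- The mean of the noise of a move of the hidden chain. -/
def noiseMean {L : ℕ} (ω : ℤ → ℝ) : Move L → ℝ
  | .inl e => ω e.1 / (ω e.1 + ω e.2)
  | .inr _ => 0

/-- The averaged action of the hidden moves on a profile `w`, with baths at `T₀` and `T₁`. Mean
hidden temperatures are its fixed points up to the factor `totalRate`; for `T₀ = T₁ = 0` it is the
one-particle operator with killing at the baths. -/
def siteGain (L : ℕ) (r ω : ℤ → ℝ) (T₀ T₁ : ℝ) (w : Config L) : Config L := fun i =>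
  ∑ j ∈ moves L, rate L r j * hiddenMap T₀ T₁ j (w, noiseMean ω j) i

/-- The resistance of the edge `(m, m + 1)` of the bulk. -/
def edgeResistance (r ω : ℤ → ℝ) (m : ℤ) : ℝ := (ω m + ω (m + 1)) / (r m * ω m * ω (m + 1))

/-- The resistance between the left bath and the site `m`. -/
def resistance (r ω : ℤ → ℝ) (m : ℤ) : ℝ :=
  1 / (r 0 * ω 1) + ∑ k ∈ Finset.Ico 1 m, edgeResistance r ω k

/-- The resistance between the two baths. -/
def totalResistance (L : ℕ) (r ω : ℤ → ℝ) : ℝ :=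
  resistance r ω ((L : ℤ) - 1) + 1 / (r ((L : ℤ) - 1) * ω ((L : ℤ) - 1))

lemma sum_moves {f : Move L → ℝ} : ∑ j ∈ moves L, f j =
    (∑ e ∈ bulkEdges L, f (.inl e)) +
      ((∑ u ∈ leftSites L, f (.inr (.inl u))) + ∑ u ∈ rightSites L, f (.inr (.inr u))) := by
  rw [moves, Finset.sum_disjSum, Finset.sum_disjSum]

lemma mem_bulkEdges {e : Site L × Site L} : e ∈ bulkEdges L ↔ (e.2 : ℤ) = (e.1 : ℤ) + 1 := by
  simp [bulkEdges]

/-- Every site has exactly one right neighbour, in the chain or in the right bath. -/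
lemma sum_right_neighbour (i : Site L) (c : ℝ) :
    (∑ e ∈ bulkEdges L, if e.1 = i then c else 0) +
      (∑ u ∈ rightSites L, if u = i then c else 0) = c := by
  by_cases hi : (i : ℤ) + 1 = L
  · have h1 : ∑ e ∈ bulkEdges L, (if e.1 = i then c else 0) = 0 := by
      refine Finset.sum_eq_zero fun e he => if_neg ?_
      rintro rfl
      have := e.2.2.2
      rw [mem_bulkEdges] at he
      omega
    rw [h1, Finset.sum_ite_eq', if_pos (by simp [rightSites, hi]), zero_add]
  · have hlt : (i : ℤ) + 1 < L := lt_of_le_of_ne (by have := i.2.2; omega) hi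
    have h2 : ∑ u ∈ rightSites L, (if u = i then c else 0) = 0 := by
      rw [Finset.sum_ite_eq', if_neg (by simp [rightSites, hi])]
    have h0 := i.2.1
    let v : Site L := ⟨i + 1, by omega, hlt⟩
    rw [h2, add_zero, Finset.sum_eq_single (i, v)]
    · simp
    · intro e he hne
      refine if_neg ?_
      rintro rfl
      refine hne (Prod.ext rfl (Subtype.ext ?_))
      exact mem_bulkEdges.1 he
    · intro hn
      exact absurd (mem_bulkEdges.2 rfl) hn

/-- Every site has exactly one left neighbour, in the chain or in the left bath. -/
lemma sum_left_neighbour (i : Site L) (c : ℝ) :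
    (∑ e ∈ bulkEdges L, if e.2 = i then c else 0) +
      (∑ u ∈ leftSites L, if u = i then c else 0) = c := by
  by_cases hi : (i : ℤ) - 1 = 0
  · have h1 : ∑ e ∈ bulkEdges L, (if e.2 = i then c else 0) = 0 := by
      refine Finset.sum_eq_zero fun e he => if_neg ?_
      rintro rfl
      have := e.1.2.1
      rw [mem_bulkEdges] at he
      omega
    rw [h1, Finset.sum_ite_eq', if_pos (by simp [leftSites, hi]), zero_add]
  · have h0 := i.2.1
    have h3 := i.2.2
    have h2 : ∑ u ∈ leftSites L, (if u = i then c else 0) = 0 := by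
      rw [Finset.sum_ite_eq', if_neg (by simp [leftSites, hi])]
    let v : Site L := ⟨i - 1, by omega, by omega⟩
    rw [h2, add_zero, Finset.sum_eq_single (v, i)]
    · simp
    · intro e he hne
      refine if_neg ?_
      rintro rfl
      refine hne (Prod.ext (Subtype.ext ?_) rfl)
      have := mem_bulkEdges.1 he
      simp only [v]
      omega
    · intro hn
      exact absurd (mem_bulkEdges.2 (by simp [v])) hn

lemma Admissible.edgeResistance_pos (h : Admissible L r ω T₀ T₁) {m : ℤ} (h1 : 1 ≤ m)
    (h2 : m + 1 < L) : 0 < edgeResistance r ω m := by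
  have := h.1 m (by omega) (by omega)
  have := h.2.1 m (by omega) (by omega)
  have := h.2.1 (m + 1) (by omega) (by omega)
  unfold edgeResistance
  positivity

lemma resistance_add_one {m : ℤ} (hm : 1 ≤ m) :
    resistance r ω (m + 1) = resistance r ω m + edgeResistance r ω m := by
  have : Finset.Ico 1 (m + 1) = insert m (Finset.Ico 1 m) := by
    ext k; simp only [Finset.mem_insert, Finset.mem_Ico]; omega
  rw [resistance, resistance, this, Finset.sum_insert (by simp)]
  ring

lemma Admissible.resistance_mono (h : Admissible L r ω T₀ T₁) {m n : ℤ} (hmn : m ≤ n)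
    (hn : n < L) : resistance r ω m ≤ resistance r ω n := by
  unfold resistance
  refine add_le_add le_rfl (Finset.sum_le_sum_of_subset_of_nonneg
    (Finset.Ico_subset_Ico_right hmn) fun k hk _ => ?_)
  rw [Finset.mem_Ico] at hk
  exact (h.edgeResistance_pos hk.1 (by omega)).le

lemma Admissible.bath_resistance_pos (h : Admissible L r ω T₀ T₁) (hL : 2 ≤ L) :
    0 < 1 / (r 0 * ω 1) ∧ 0 < 1 / (r ((L : ℤ) - 1) * ω ((L : ℤ) - 1)) := by
  have := h.1 0 (by omega) (by omega)
  have := h.2.1 1 (by omega) (by omega)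
  have := h.1 (L - 1) (by omega) (by omega)
  have := h.2.1 (L - 1) (by omega) (by omega)
  constructor <;> positivity

lemma two_le_of_site (i : Site L) : 2 ≤ L := by
  have := i.2.1; have := i.2.2; omega

lemma Admissible.resistance_pos (h : Admissible L r ω T₀ T₁) (i : Site L) :
    0 < resistance r ω i := by
  have h1 := (h.bath_resistance_pos (two_le_of_site i)).1
  have h2 := h.resistance_mono (m := 1) (n := i) (by have := i.2.1; omega) i.2.2
  have h3 : resistance r ω 1 = 1 / (r 0 * ω 1) := by simp [resistance]
  linarith

lemma Admissible.resistance_lt (h : Admissible L r ω T₀ T₁) (i : Site L) :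
    resistance r ω i < totalResistance L r ω := by
  have h1 := (h.bath_resistance_pos (two_le_of_site i)).2
  have h2 := h.resistance_mono (m := i) (n := (L : ℤ) - 1) (by have := i.2.2; omega) (by omega)
  unfold totalResistance
  linarith

lemma Admissible.totalResistance_pos (h : Admissible L r ω T₀ T₁) (hL : 2 ≤ L) :
    0 < totalResistance L r ω :=
  (h.resistance_pos ⟨1, by simp, by simp; omega⟩).trans (h.resistance_lt _)

/-- The drift of the resistance coordinate across one edge of the bulk, by Ohm's law. -/
lemma Admissible.drift_merge (h : Admissible L r ω T₀ T₁) {e : Site L × Site L}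
    (he : e ∈ bulkEdges L) (i : Site L) :
    r e.1 * (merge e.1 e.2 (fun i => resistance r ω i) (ω e.1 / (ω e.1 + ω e.2)) i
      - resistance r ω i) = (if e.1 = i then 1 / ω i else 0) - if e.2 = i then 1 / ω i else 0 := by
  obtain ⟨u, v⟩ := e
  have huv : (v : ℤ) = u + 1 := mem_bulkEdges.1 he
  have hne : u ≠ v := fun hh => by rw [hh] at huv; omega
  have hr := h.1 u u.2.1.le u.2.2
  have hu := h.2.1 u u.2.1 u.2.2
  have hv := h.2.1 v v.2.1 v.2.2
  have hR : resistance r ω v = resistance r ω u + (ω u + ω v) / (r u * ω u * ω v) := by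
    rw [huv, resistance_add_one (by have := u.2.1; omega), edgeResistance]
  unfold merge
  by_cases h1 : u = i
  · subst h1
    simp only [true_or, if_true, hne.symm, if_false, hR]
    field_simp
    ring
  · by_cases h2 : v = i
    · subst h2
      simp only [h1, if_true, if_false, or_true, hR]
      field_simp
      ring
    · simp [h1, h2, Ne.symm h1, Ne.symm h2]

/-- The resistance coordinate is harmonic. -/
theorem siteGain_resistance (h : Admissible L r ω T₀ T₁) (i : Site L) :
    siteGain L r ω 0 (totalResistance L r ω) (fun i => resistance r ω i) i =
      totalRate L r * resistance r ω i := by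
  rw [totalRate_eq_sum, Finset.sum_mul, ← sub_eq_zero, siteGain, ← Finset.sum_sub_distrib]
  simp_rw [← mul_sub]
  have e1 := Finset.sum_congr rfl fun e he => h.drift_merge (e := e) he i
  have e2 : ∀ u ∈ leftSites L, r 0 * (Function.update (fun i : Site L => resistance r ω i) u 0 i -
      resistance r ω i) = -(if u = i then 1 / ω i else 0) := by
    intro u hu
    have hu' : (u : ℤ) = 1 := by simp [leftSites] at hu; omega
    by_cases hui : u = i
    · subst hui
      have := h.1 0 le_rfl (by have := u.2.1; have := u.2.2; omega)
      have := h.2.1 u u.2.1 u.2.2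
      rw [hu'] at this
      simp [hu', resistance]
      field_simp
    · simp [hui, Ne.symm hui]
  have e3 : ∀ u ∈ rightSites L, r ((L : ℤ) - 1) * (Function.update
      (fun i : Site L => resistance r ω i) u (totalResistance L r ω) i - resistance r ω i) =
      if u = i then 1 / ω i else 0 := by
    intro u hu
    have hu' : (u : ℤ) = (L : ℤ) - 1 := by simp [rightSites] at hu; omega
    by_cases hui : u = i
    · subst hui
      have h1 := h.1 u u.2.1.le u.2.2
      have h2 := h.2.1 u u.2.1 u.2.2
      rw [hu'] at h1 h2
      simp [hu', totalResistance]
      field_simp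
    · simp [hui, Ne.symm hui]
  rw [sum_moves]
  simp only [rate, hiddenMap, noiseMean]
  rw [e1, Finset.sum_congr rfl e2, Finset.sum_congr rfl e3, Finset.sum_sub_distrib,
    Finset.sum_neg_distrib]
  linarith [sum_right_neighbour i (1 / ω i), sum_left_neighbour i (1 / ω i)]

/-- The product of the resistances to the two baths: a strictly superharmonic profile. -/
def barrier (L : ℕ) (r ω : ℤ → ℝ) : Config L := fun i =>
  resistance r ω i * (totalResistance L r ω - resistance r ω i)

lemma Admissible.barrier_pos (h : Admissible L r ω T₀ T₁) (i : Site L) : 0 < barrier L r ω i :=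
  mul_pos (h.resistance_pos i) (sub_pos.2 (h.resistance_lt i))

lemma Admissible.noiseMean_mem (h : Admissible L r ω T₀ T₁) (e : Site L × Site L) :
    0 < noiseMean ω (.inl e : Move L) ∧ noiseMean ω (.inl e : Move L) < 1 := by
  have hu := h.2.1 e.1 e.1.2.1 e.1.2.2
  have hv := h.2.1 e.2 e.2.2.1 e.2.2.2
  simp only [noiseMean]
  exact ⟨by positivity, (div_lt_one (by positivity)).2 (by linarith)⟩

theorem siteGain_barrier_lt (h : Admissible L r ω T₀ T₁) (i : Site L) :
    siteGain L r ω 0 0 (barrier L r ω) i < totalRate L r * barrier L r ω i := by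
  set R : Config L := fun i => resistance r ω i with hR
  set Z := totalResistance L r ω with hZ
  -- by concavity of `ρ ↦ ρ (Z - ρ)`, every move does at most what harmonicity of `R` predicts
  let D : Move L → ℝ := fun j => (Z - 2 * R i) * (hiddenMap 0 Z j (R, noiseMean ω j) i - R i) -
    (hiddenMap 0 0 j (barrier L r ω, noiseMean ω j) i - barrier L r ω i)
  have hDe : ∀ e : Site L × Site L, i = e.1 ∨ i = e.2 → D (.inl e) =
      noiseMean ω (.inl e : Move L) * (R e.1 - R i) ^ 2 +
        (1 - noiseMean ω (.inl e : Move L)) * (R e.2 - R i) ^ 2 := by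
    intro e he
    simp only [D, hiddenMap, merge, if_pos he, barrier, hR]
    ring
  have hD : ∀ j, 0 ≤ D j := by
    rintro (e | u | u)
    · by_cases he : i = e.1 ∨ i = e.2
      · rw [hDe e he]
        have := h.noiseMean_mem e
        have : 0 ≤ 1 - noiseMean ω (.inl e : Move L) := by linarith
        have := (h.noiseMean_mem e).1.le
        positivity
      · simp [D, hiddenMap, merge, he]
    · by_cases hu : i = u
      · subst hu
        simp only [D, hiddenMap, Function.update_self, barrier, hR]
        nlinarith [sq_nonneg (resistance r ω i)]
      · simp [D, hiddenMap, hu]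
    · by_cases hu : i = u
      · subst hu
        simp only [D, hiddenMap, Function.update_self, barrier, hR]
        nlinarith [sq_nonneg (Z - resistance r ω i)]
      · simp [D, hiddenMap, hu]
  have hpos : ∃ j ∈ moves L, 0 < D j := by
    have hi0 := i.2.1
    have hi1 := i.2.2
    by_cases hi : (i : ℤ) = 1
    · refine ⟨.inr (.inl i), by simp [moves, leftSites, hi], ?_⟩
      have := h.resistance_pos i
      simp only [D, hiddenMap, Function.update_self, barrier, hR]
      nlinarith [mul_pos this this]
    · let v : Site L := ⟨i - 1, by omega, by omega⟩
      refine ⟨.inl (v, i), mem_moves_inl.2 (by simp [v]), ?_⟩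
      rw [hDe _ (Or.inr rfl)]
      have h1 := resistance_add_one (r := r) (ω := ω) (m := (i : ℤ) - 1) (by omega)
      rw [sub_add_cancel] at h1
      have h2 := h.edgeResistance_pos (m := (i : ℤ) - 1) (by omega) (by omega)
      have h3 : R v - R i = -edgeResistance r ω ((i : ℤ) - 1) := by
        simp only [hR, v]; linarith
      have := (h.noiseMean_mem (v, i)).1
      have h4 : noiseMean ω (.inl (v, i) : Move L) * (R v - R i) ^ 2 +
          (1 - noiseMean ω (.inl (v, i) : Move L)) * (R i - R i) ^ 2 =
          noiseMean ω (.inl (v, i) : Move L) * edgeResistance r ω ((i : ℤ) - 1) ^ 2 := by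
        rw [h3]; ring
      rw [h4]
      positivity
  have hsum : 0 < ∑ j ∈ moves L, rate L r j * D j := by
    obtain ⟨j, hj, hj'⟩ := hpos
    exact Finset.sum_pos' (fun j _ => mul_nonneg (h.rate_pos j).le (hD j))
      ⟨j, hj, mul_pos (h.rate_pos j) hj'⟩
  have hharm := siteGain_resistance h i
  have hexp : ∑ j ∈ moves L, rate L r j * D j =
      (Z - 2 * R i) * (siteGain L r ω 0 Z R i - totalRate L r * R i) -
        (siteGain L r ω 0 0 (barrier L r ω) i - totalRate L r * barrier L r ω i) := by
    rw [totalRate_eq_sum, siteGain, siteGain, Finset.sum_mul, Finset.sum_mul,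
      ← Finset.sum_sub_distrib, ← Finset.sum_sub_distrib, Finset.mul_sum, ← Finset.sum_sub_distrib]
    refine Finset.sum_congr rfl fun j _ => ?_
    simp only [D]
    ring
  rw [hexp, hharm] at hsum
  simp only [hR, sub_self, mul_zero] at hsum
  linarith

/-! ### Existence and uniqueness of the invariant measure -/

/-- A continuous function is integrable for a Beta law, which lives on `[0, 1]`. -/
lemma integrable_betaMeasure {a b : ℝ} (ha : 0 < a) (hb : 0 < b) {f : ℝ → ℝ}
    (hf : Continuous f) : Integrable f (betaMeasure a b) := by
  have := isProbabilityMeasureBeta ha hb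
  obtain ⟨C, hC⟩ := (isCompact_Icc (a := (0 : ℝ)) (b := 1)).exists_bound_of_continuousOn
    hf.continuousOn
  exact Integrable.of_bound hf.aestronglyMeasurable C
    ((ae_mem_Ioo_betaMeasure a b).mono fun p hp => hC p (Set.Ioo_subset_Icc_self hp))

lemma Admissible.integral_id_hiddenNoise (h : Admissible L r ω T₀ T₁) (e : Site L × Site L) :
    ∫ b, b ∂(betaMeasure (ω e.1 / 2) (ω e.2 / 2)) = noiseMean ω (.inl e : Move L) := by
  have hu := h.omega_half_pos e.1
  have hv := h.omega_half_pos e.2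
  rw [integral_id_betaMeasure hu hv, noiseMean]
  field_simp

lemma Admissible.integral_merge (h : Admissible L r ω T₀ T₁) (e : Site L × Site L)
    (w : Config L) (i : Site L) :
    ∫ b, merge e.1 e.2 w b i ∂(betaMeasure (ω e.1 / 2) (ω e.2 / 2)) =
      merge e.1 e.2 w (noiseMean ω (.inl e : Move L)) i := by
  have := isProbabilityMeasureBeta (h.omega_half_pos e.1) (h.omega_half_pos e.2)
  have hid := integrable_betaMeasure (h.omega_half_pos e.1) (h.omega_half_pos e.2) continuous_id
  unfold merge
  split_ifs
  · have : ∀ b : ℝ, b * w e.1 + (1 - b) * w e.2 = b * (w e.1 - w e.2) + w e.2 := fun b => by ring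
    simp_rw [this]
    rw [integral_add (f := fun b : ℝ => b * (w e.1 - w e.2)) (hid.mul_const _)
      (integrable_const _), integral_mul_const, h.integral_id_hiddenNoise]
    simp
  · simp

lemma Admissible.integrable_merge (h : Admissible L r ω T₀ T₁) (e : Site L × Site L)
    (w : Config L) (i : Site L) :
    Integrable (fun b => merge e.1 e.2 w b i) (betaMeasure (ω e.1 / 2) (ω e.2 / 2)) := by
  refine integrable_betaMeasure (h.omega_half_pos e.1) (h.omega_half_pos e.2) ?_
  unfold merge
  split_ifs <;> fun_prop

/-- Exchange of energies does not increase a weighted `ℓ¹` distance by more than merging of the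
weights does. -/
lemma sum_weight_pool_le {u v : Site L} (huv : u ≠ v) {w : Config L} (hw : ∀ i, 0 ≤ w i)
    (x y : Config L) {p : ℝ} (hp : p ∈ Set.Icc (0 : ℝ) 1) :
    ∑ i, w i * |pool u v x p i - pool u v y p i| ≤ ∑ i, |x i - y i| * merge u v w p i := by
  rw [← sub_nonneg, ← Finset.sum_sub_distrib, Fintype.sum_eq_add u v huv]
  · have eu : pool u v x p u - pool u v y p u = p * ((x u - y u) + (x v - y v)) := by
      simp [pool]; ring
    have ev : pool u v x p v - pool u v y p v = (1 - p) * ((x u - y u) + (x v - y v)) := by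
      simp [pool, huv.symm]; ring
    have mu : merge u v w p u = p * w u + (1 - p) * w v := by simp [merge]
    have mv : merge u v w p v = p * w u + (1 - p) * w v := by simp [merge]
    rw [eu, ev, mu, mv, abs_mul, abs_mul, abs_of_nonneg hp.1, abs_of_nonneg (sub_nonneg.2 hp.2)]
    have hm : 0 ≤ p * w u + (1 - p) * w v :=
      add_nonneg (mul_nonneg hp.1 (hw u)) (mul_nonneg (sub_nonneg.2 hp.2) (hw v))
    nlinarith [mul_le_mul_of_nonneg_left (abs_add_le (x u - y u) (x v - y v)) hm]
  · rintro i ⟨hu, hv⟩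
    simp [pool, merge, hu, hv, mul_comm]

lemma sum_weight_update_le (u : Site L) {w : Config L} (x y : Config L) (p : ℝ) :
    ∑ i, w i * |Function.update x u p i - Function.update y u p i| ≤
      ∑ i, |x i - y i| * Function.update w u 0 i := by
  refine Finset.sum_le_sum fun i _ => ?_
  by_cases hi : i = u
  · subst hi; simp
  · simp [hi, mul_comm]

open scoped BoundedContinuousFunction in
/-- The chain has at most one stationary probability measure: with the same noise, the distance of
two copies in the `ℓ¹` norm weighted by `barrier` contracts on average. -/
theorem eq_of_gain_eq (h : Admissible L r ω T₀ T₁) (hL : 2 ≤ L) {μ₁ μ₂ : Measure (Config L)}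
    [IsProbabilityMeasure μ₁] [IsProbabilityMeasure μ₂]
    (h₁ : gain L r ω T₀ T₁ μ₁ = ENNReal.ofReal (totalRate L r) • μ₁)
    (h₂ : gain L r ω T₀ T₁ μ₂ = ENNReal.ofReal (totalRate L r) • μ₂) : μ₁ = μ₂ := by
  have hne : Nonempty (Site L) := ⟨⟨1, by simp, by simp; omega⟩⟩
  have hN := h.isProbabilityMeasure_energyNoise
  set w := barrier L r ω with hw
  have hwpos : ∀ i, 0 < w i := h.barrier_pos
  obtain ⟨k, -, hk⟩ := Finset.exists_max_image Finset.univ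
    (fun i => siteGain L r ω 0 0 w i / w i) Finset.univ_nonempty
  set κ := siteGain L r ω 0 0 w k / w k with hκ
  have hκ1 : κ < totalRate L r := (div_lt_iff₀ (hwpos k)).2 (siteGain_barrier_lt h k)
  have hκw : ∀ i, siteGain L r ω 0 0 w i ≤ κ * w i := fun i =>
    (div_le_iff₀ (hwpos i)).1 (hk i (Finset.mem_univ i))
  have hκ0 : 0 ≤ κ := by
    refine div_nonneg (Finset.sum_nonneg fun j _ => mul_nonneg (h.rate_pos j).le ?_) (hwpos k).le
    rcases j with e | u | u
    · have hm := h.noiseMean_mem e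
      simp only [hiddenMap, merge]
      split_ifs
      · exact add_nonneg (mul_nonneg hm.1.le (hwpos _).le)
          (mul_nonneg (by linarith) (hwpos _).le)
      · exact (hwpos k).le
    all_goals
      by_cases hu : k = u
      · subst hu; simp [hiddenMap]
      · simpa [hiddenMap, hu] using (hwpos k).le
  let N : Config L → Config L → ℝ := fun x y => ∑ i, w i * |x i - y i|
  let B : Move L → Config L → Config L → ℝ → ℝ := fun j x y p =>
    ∑ i, |x i - y i| * hiddenMap 0 0 j (w, p) i
  have hBi : ∀ (j : Move L) (i : Site L),
      Integrable (fun p => hiddenMap 0 0 j (w, p) i) (energyNoise ω T₀ T₁ j) ∧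
      ∫ p, hiddenMap 0 0 j (w, p) i ∂(energyNoise ω T₀ T₁ j) =
        hiddenMap 0 0 j (w, noiseMean ω j) i := by
    rintro (e | u | u) i
    · exact ⟨h.integrable_merge e w i, h.integral_merge e w i⟩
    · exact ⟨by simp only [hiddenMap]; exact integrable_const _, by simp [hiddenMap]⟩
    · exact ⟨by simp only [hiddenMap]; exact integrable_const _, by simp [hiddenMap]⟩
  have key : ∀ {f : Config L → ℝ}, Measurable f → ∀ {M : ℝ}, (∀ x, |f x| ≤ M) → ∀ {K : ℝ}, 0 ≤ K →
      (∀ x y, |f x - f y| ≤ K * N x y) → ∫ x, f x ∂μ₁ = ∫ x, f x ∂μ₂ := by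
    intro f hf M hM K hK hfN
    rw [gain_eq_ringGain, totalRate_eq_sum] at h₁ h₂
    refine integral_eq_of_ringGain_eq (fun j _ => h.rate_pos j) hN measurable_energyMap (N := N)
      (B := B) ?_ ?_ hκ0 (by rwa [← totalRate_eq_sum]) ?_ h₁ h₂ hf hM hK hfN
    · exact fun j _ x y => integrable_finsetSum _ fun i _ => ((hBi j i).1.const_mul _)
    · rintro (e | u | u) hj x y
      · filter_upwards [ae_mem_Ioo_betaMeasure (ω e.1 / 2) (ω e.2 / 2)] with p hp
        refine sum_weight_pool_le (fun hh => ?_) (fun i => (hwpos i).le) x y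
          (Set.Ioo_subset_Icc_self hp)
        have := mem_moves_inl.1 hj
        rw [hh] at this
        omega
      · exact ae_of_all _ fun p => sum_weight_update_le u x y p
      · exact ae_of_all _ fun p => sum_weight_update_le u x y p
    · intro x y
      have e : ∑ j ∈ moves L, rate L r j * ∫ p, B j x y p ∂(energyNoise ω T₀ T₁ j) =
          ∑ i, |x i - y i| * siteGain L r ω 0 0 w i := by
        simp only [siteGain, Finset.mul_sum]
        rw [Finset.sum_comm]
        refine Finset.sum_congr rfl fun j _ => ?_
        simp only [B]
        rw [integral_finsetSum _ fun i _ => ((hBi j i).1.const_mul _), Finset.mul_sum]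
        refine Finset.sum_congr rfl fun i _ => ?_
        rw [integral_const_mul, (hBi j i).2]
        ring
      rw [e, Finset.mul_sum]
      refine Finset.sum_le_sum fun i _ => ?_
      calc |x i - y i| * siteGain L r ω 0 0 w i ≤ |x i - y i| * (κ * w i) :=
            mul_le_mul_of_nonneg_left (hκw i) (abs_nonneg _)
        _ = _ := by ring
  have hlip : ∀ x y, dist x y ≤ (∑ i, (w i)⁻¹) * N x y := by
    intro x y
    have hN0 : 0 ≤ N x y := Finset.sum_nonneg fun i _ => mul_nonneg (hwpos i).le (abs_nonneg _)
    have hS0 : 0 ≤ ∑ i, (w i)⁻¹ := Finset.sum_nonneg fun i _ => (inv_pos.2 (hwpos i)).le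
    refine (dist_pi_le_iff (mul_nonneg hS0 hN0)).2 fun i => ?_
    have e : dist (x i) (y i) = (w i)⁻¹ * (w i * |x i - y i|) := by
      rw [Real.dist_eq, inv_mul_cancel_left₀ (hwpos i).ne']
    rw [e]
    refine mul_le_mul ?_ ?_ (mul_nonneg (hwpos i).le (abs_nonneg _)) hS0
    · exact Finset.single_le_sum (f := fun i => (w i)⁻¹)
        (fun i _ => (inv_pos.2 (hwpos i)).le) (Finset.mem_univ i)
    · exact Finset.single_le_sum (f := fun i => w i * |x i - y i|)
        (fun i _ => mul_nonneg (hwpos i).le (abs_nonneg _)) (Finset.mem_univ i)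
  -- bounded Lipschitz functions separate probability measures
  let m₁ : ProbabilityMeasure (Config L) := ⟨μ₁, inferInstance⟩
  let m₂ : ProbabilityMeasure (Config L) := ⟨μ₂, inferInstance⟩
  have hlim : Tendsto (fun _ : ℕ => m₁) atTop (𝓝 m₂) := by
    rw [tendsto_iff_forall_lipschitz_integral_tendsto]
    rintro f ⟨C, hC⟩ ⟨l, hl⟩
    have : ∫ x, f x ∂μ₁ = ∫ x, f x ∂μ₂ := by
      refine key hl.continuous.measurable (M := C + |f 0|) (fun x => ?_)
        (K := l * ∑ i, (w i)⁻¹) ?_ fun x y => ?_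
      · have := hC x 0
        rw [Real.dist_eq] at this
        calc |f x| = |(f x - f 0) + f 0| := by ring_nf
          _ ≤ _ := (abs_add_le _ _).trans (by linarith)
      · exact mul_nonneg l.2 (Finset.sum_nonneg fun i _ => (inv_pos.2 (hwpos i)).le)
      · have := hl.dist_le_mul x y
        rw [Real.dist_eq] at this
        rw [mul_assoc]
        exact this.trans (mul_le_mul_of_nonneg_left (hlip x y) l.2)
    change Tendsto (fun _ : ℕ => ∫ x, f x ∂μ₁) atTop (𝓝 (∫ x, f x ∂μ₂))
    rw [this]
    exact tendsto_const_nhds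
  have heq : m₁ = m₂ := tendsto_nhds_unique tendsto_const_nhds hlim
  exact congrArg Subtype.val heq

lemma Admissible.isProbabilityMeasure_mixture (h : Admissible L r ω T₀ T₁)
    (ν : Measure (Config L)) [IsProbabilityMeasure ν] : IsProbabilityMeasure (mixture L ω ν) := by
  have := h.isProbabilityMeasure_gammaPi
  exact Measure.isProbabilityMeasure_map (measurable_fst.mul measurable_snd).aemeasurable

lemma mixture_smul (h : Admissible L r ω T₀ T₁) (c : ENNReal) (ν : Measure (Config L)) :
    mixture L ω (c • ν) = c • mixture L ω ν := by
  refine Measure.ext_of_lintegral _ fun f hf => ?_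
  rw [lintegral_mixture h _ hf, lintegral_smul_measure, lintegral_smul_measure,
    lintegral_mixture h _ hf]

lemma ae_mixture_nonneg (h : Admissible L r ω T₀ T₁) {ν : Measure (Config L)}
    [IsProbabilityMeasure ν] (hν : ∀ᵐ θ ∂ν, ∀ w, 0 ≤ θ w) :
    ∀ᵐ ξ ∂(mixture L ω ν), ∀ w, 0 ≤ ξ w := by
  have := h.isProbabilityMeasure_gamma
  have := h.isProbabilityMeasure_gammaPi
  have hs : MeasurableSet {ξ : Config L | ∀ w, 0 ≤ ξ w} := by
    rw [Set.ofPred_forall]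
    exact MeasurableSet.iInter fun w => measurable_pi_apply w measurableSet_Ici
  have hX : ∀ᵐ X ∂(gammaPi L ω), ∀ w, 0 ≤ X w := by
    rw [ae_all_iff]
    intro w
    have := (measurePreserving_eval (fun w : Site L => gammaMeasure (ω w / 2) 1) w)
    exact this.quasiMeasurePreserving.ae ((ae_pos_gammaMeasure _).mono fun x hx => hx.le)
  have hm : Measurable fun q : Config L × Config L => q.1 * q.2 := measurable_fst.mul measurable_snd
  rw [mixture, ae_map_iff hm.aemeasurable hs]
  have e1 := Measure.quasiMeasurePreserving_fst (μ := ν) (ν := gammaPi L ω) |>.ae hν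
  have e2 := Measure.quasiMeasurePreserving_snd (μ := ν) (ν := gammaPi L ω) |>.ae hX
  filter_upwards [e1, e2] with q h1 h2 w
  exact mul_nonneg (h1 w) (h2 w)

/-- A stationary law of the hidden temperatures yields an invariant measure of the energies. -/
theorem isInvariantMeasure_mixture (h : Admissible L r ω T₀ T₁) {ν : Measure (Config L)}
    [IsProbabilityMeasure ν] (hν : ∀ᵐ θ ∂ν, ∀ w, θ w ∈ Set.Icc (min T₀ T₁) (max T₀ T₁))
    (hg : hiddenGain L r ω T₀ T₁ ν = ENNReal.ofReal (totalRate L r) • ν) :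
    IsInvariantMeasure L r ω T₀ T₁ (mixture L ω ν) := by
  refine isInvariantMeasure_of_gain_eq h (h.isProbabilityMeasure_mixture ν)
    (ae_mixture_nonneg h (hν.mono fun θ hθ w => (le_min h.2.2.1 h.2.2.2).trans (hθ w).1)) ?_
  rw [gain_mixture h, hg, mixture_smul h]

theorem IsInvariantMeasure.eq (h : Admissible L r ω T₀ T₁) (hL : 2 ≤ L)
    {μ₁ μ₂ : Measure (Config L)} (h₁ : IsInvariantMeasure L r ω T₀ T₁ μ₁)
    (h₂ : IsInvariantMeasure L r ω T₀ T₁ μ₂) : μ₁ = μ₂ := by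
  have := h₁.isProbabilityMeasure
  have := h₂.isProbabilityMeasure
  exact eq_of_gain_eq h hL (h₁.gain_eq h) (h₂.gain_eq h)

theorem existsUnique_isInvariantMeasure (h : Admissible L r ω T₀ T₁) (hL : 2 ≤ L) :
    ∃! μ : Measure (Config L), IsInvariantMeasure L r ω T₀ T₁ μ := by
  obtain ⟨ν, hp, hν, hg⟩ := exists_hiddenGain_eq_smul h hL
  have hm := isInvariantMeasure_mixture h hν hg
  exact ⟨_, hm, fun μ hμ => hμ.eq h hL hm⟩

/-! ### Comparison principle and mean temperatures -/

/-- A subsolution of a monotone equation with a strict positive supersolution is nonpositive. -/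
lemma nonpos_of_subsolution {ι : Type*} [Finite ι] (P : (ι → ℝ) → ι → ℝ) {W : ι → ℝ} {A : ℝ}
    (hP : ∀ g c, 0 ≤ c → (∀ i, g i ≤ c * W i) → ∀ i, P g i ≤ c * P W i)
    (hW : ∀ i, 0 < W i) (hPW : ∀ i, P W i < A * W i) {g : ι → ℝ} (hg : ∀ i, A * g i ≤ P g i)
    (i : ι) : g i ≤ 0 := by
  have := Fintype.ofFinite ι
  obtain ⟨k, -, hk⟩ := Finset.exists_max_image Finset.univ (fun i => g i / W i) ⟨i, Finset.mem_univ i⟩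
  by_contra hi
  have hc : 0 < g k / W k :=
    (div_pos (not_le.1 hi) (hW i)).trans_le (hk i (Finset.mem_univ i))
  have h1 := hP g (g k / W k) hc.le (fun i => (div_le_iff₀ (hW i)).1 (hk i (Finset.mem_univ i))) k
  have h2 := mul_lt_mul_of_pos_left (hPW k) hc
  have h3 : g k / W k * (A * W k) = A * g k := by have := (hW k).ne'; field_simp
  linarith [hg k]

/-- The harmonic temperature profile between the baths. -/
def meanTemperature (L : ℕ) (r ω : ℤ → ℝ) (T₀ T₁ : ℝ) (m : ℤ) : ℝ :=
  T₀ + (T₁ - T₀) / totalResistance L r ω * resistance r ω m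

lemma siteGain_meanTemperature (h : Admissible L r ω T₀ T₁) (hL : 2 ≤ L) (i : Site L) :
    siteGain L r ω T₀ T₁ (fun i => meanTemperature L r ω T₀ T₁ i) i =
      totalRate L r * meanTemperature L r ω T₀ T₁ i := by
  have hZ := (h.totalResistance_pos hL).ne'
  set Z := totalResistance L r ω with hZdef
  have hm : ∀ (j : Move L), hiddenMap T₀ T₁ j (fun i => meanTemperature L r ω T₀ T₁ i,
      noiseMean ω j) i = T₀ + (T₁ - T₀) / Z *
        hiddenMap 0 Z j (fun i => resistance r ω i, noiseMean ω j) i := by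
    rintro (e | u | u)
    · simp only [hiddenMap, merge, meanTemperature]
      split_ifs
      · ring
      · rfl
    · by_cases hu : i = u
      · subst hu; simp [hiddenMap]
      · simp only [hiddenMap, Function.update_of_ne hu]; rfl
    · by_cases hu : i = u
      · subst hu; simp [hiddenMap]; field_simp; ring
      · simp only [hiddenMap, Function.update_of_ne hu]; rfl
  have hR := siteGain_resistance h i
  rw [siteGain] at hR ⊢
  simp_rw [hm, mul_add]
  rw [Finset.sum_add_distrib, ← Finset.sum_mul, ← totalRate_eq_sum, meanTemperature, mul_add,
    ← hZdef]
  congr 1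
  rw [mul_left_comm, ← hR, Finset.mul_sum]
  exact Finset.sum_congr rfl fun j _ => by ring

lemma siteGain_le_mul (h : Admissible L r ω T₀ T₁) {g W : Config L} {c : ℝ}
    (hg : ∀ i, g i ≤ c * W i) (i : Site L) :
    siteGain L r ω 0 0 g i ≤ c * siteGain L r ω 0 0 W i := by
  rw [siteGain, siteGain, Finset.mul_sum]
  refine Finset.sum_le_sum fun j _ => ?_
  rw [mul_left_comm]
  refine mul_le_mul_of_nonneg_left ?_ (h.rate_pos j).le
  rcases j with e | u | u
  · have hm := h.noiseMean_mem e
    simp only [hiddenMap, merge]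
    split_ifs
    · rw [mul_add, mul_left_comm, mul_left_comm c]
      exact add_le_add (mul_le_mul_of_nonneg_left (hg _) hm.1.le)
        (mul_le_mul_of_nonneg_left (hg _) (by linarith))
    · exact hg i
  all_goals
    by_cases hu : i = u
    · subst hu; simp [hiddenMap]
    · simpa [hiddenMap, hu] using hg i

/-- A profile fixed by the averaged moves is the harmonic one. -/
lemma eq_meanTemperature (h : Admissible L r ω T₀ T₁) {m : Config L}
    (hm : ∀ i, totalRate L r * m i = siteGain L r ω T₀ T₁ m i) (i : Site L) :
    m i = meanTemperature L r ω T₀ T₁ i := by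
  have hL := two_le_of_site i
  have hdiff : ∀ (m m' : Config L) (i : Site L), siteGain L r ω T₀ T₁ m i -
      siteGain L r ω T₀ T₁ m' i = siteGain L r ω 0 0 (fun i => m i - m' i) i := by
    intro m m' i
    rw [siteGain, siteGain, siteGain, ← Finset.sum_sub_distrib]
    refine Finset.sum_congr rfl fun j _ => ?_
    rw [← mul_sub]
    congr 1
    rcases j with e | u | u
    · simp only [hiddenMap, merge]
      split_ifs <;> ring
    all_goals
      by_cases hu : i = u
      · subst hu; simp [hiddenMap]
      · simp [hiddenMap, hu]
  have ht := siteGain_meanTemperature h hL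
  have key := fun (g : Config L) (hg : ∀ i, totalRate L r * g i ≤ siteGain L r ω 0 0 g i) =>
    nonpos_of_subsolution (siteGain L r ω 0 0) (fun g c _ hg i => siteGain_le_mul h hg i)
      h.barrier_pos (siteGain_barrier_lt h) hg i
  have h1 := key (fun i => m i - meanTemperature L r ω T₀ T₁ i) fun i => by
    rw [← hdiff m (fun i => meanTemperature L r ω T₀ T₁ i), ht, ← hm, mul_sub]
  have h2 := key (fun i => meanTemperature L r ω T₀ T₁ i - m i) fun i => by
    rw [← hdiff (fun i => meanTemperature L r ω T₀ T₁ i) m, ht, ← hm, mul_sub]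
  linarith

/-! ### Moments of the stationary hidden temperatures -/

lemma mul_integral_eq_of_ringGain_eq {ι X : Type*} [MeasurableSpace X] {J : Finset ι} {a : ι → ℝ}
    (ha : ∀ j ∈ J, 0 < a j) {β : ι → Measure ℝ} (hβ : ∀ j, IsProbabilityMeasure (β j))
    {g : ι → X × ℝ → X} (hg : ∀ j, Measurable (g j)) {A : ℝ} (hA : 0 ≤ A) {ν : Measure X}
    [IsProbabilityMeasure ν] (hν : ringGain J a β g ν = ENNReal.ofReal A • ν) {f : X → ℝ}
    (hf : Measurable f) (hfi : Integrable f ν) :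
    A * ∫ x, f x ∂ν = ∑ j ∈ J, a j * ∫ x, ∫ p, f (g j (x, p)) ∂(β j) ∂ν := by
  have h1 : Integrable f (ringGain J a β g ν) := by
    rw [hν]; exact hfi.smul_measure ENNReal.ofReal_ne_top
  have h2 := integrable_finsetSum_measure.1 h1
  have e : ∫ x, f x ∂(ringGain J a β g ν) = A * ∫ x, f x ∂ν := by
    rw [hν, integral_smul_measure, ENNReal.toReal_ofReal hA, smul_eq_mul]
  rw [← e, ringGain, integral_finsetSum_measure h2]
  refine Finset.sum_congr rfl fun j hj => ?_
  have h3 : Integrable f ((ν.prod (β j)).map (g j)) := (integrable_smul_measure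
    (by simpa using ha j hj) ENNReal.ofReal_ne_top).1 (h2 j hj)
  have h4 := h3.comp_measurable (hg j)
  rw [integral_smul_measure, ENNReal.toReal_ofReal (ha j hj).le, smul_eq_mul,
    integral_map (hg j).aemeasurable hf.aestronglyMeasurable]
  congr 1
  exact integral_prod _ h4

/-- The stationary laws of the hidden temperatures, supported between the bath temperatures. -/
structure IsHiddenStationary (L : ℕ) (r ω : ℤ → ℝ) (T₀ T₁ : ℝ) (ν : Measure (Config L)) :
    Prop where
  isProbabilityMeasure : IsProbabilityMeasure ν
  mem_Icc : ∀ᵐ θ ∂ν, ∀ w, θ w ∈ Set.Icc (min T₀ T₁) (max T₀ T₁)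
  hiddenGain_eq : hiddenGain L r ω T₀ T₁ ν = ENNReal.ofReal (totalRate L r) • ν

variable {ν : Measure (Config L)}

lemma IsHiddenStationary.ae_abs_le (hν : IsHiddenStationary L r ω T₀ T₁ ν) :
    ∀ᵐ θ ∂ν, ∀ w, |θ w| ≤ max |T₀| |T₁| := by
  filter_upwards [hν.mem_Icc] with θ hθ w
  have h1 : -max |T₀| |T₁| ≤ min T₀ T₁ := le_min
    ((neg_le_neg (le_max_left _ _)).trans (neg_abs_le T₀))
    ((neg_le_neg (le_max_right _ _)).trans (neg_abs_le T₁))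
  exact abs_le.2 ⟨h1.trans (hθ w).1, (hθ w).2.trans (max_le_max (le_abs_self _) (le_abs_self _))⟩

lemma IsHiddenStationary.integrable_apply (hν : IsHiddenStationary L r ω T₀ T₁ ν) (i : Site L) :
    Integrable (fun θ => θ i) ν := by
  have := hν.isProbabilityMeasure
  exact Integrable.of_bound (measurable_pi_apply i).aestronglyMeasurable (max |T₀| |T₁|)
    (hν.ae_abs_le.mono fun θ hθ => hθ i)

lemma IsHiddenStationary.integrable_mul (hν : IsHiddenStationary L r ω T₀ T₁ ν) (i k : Site L) :
    Integrable (fun θ => θ i * θ k) ν := by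
  have := hν.isProbabilityMeasure
  refine Integrable.of_bound
    ((measurable_pi_apply i).mul (measurable_pi_apply k)).aestronglyMeasurable
    (max |T₀| |T₁| * max |T₀| |T₁|) (hν.ae_abs_le.mono fun θ hθ => ?_)
  rw [norm_mul]
  exact mul_le_mul (hθ i) (hθ k) (abs_nonneg _) ((abs_nonneg _).trans (hθ i))

lemma IsHiddenStationary.mul_integral (h : Admissible L r ω T₀ T₁)
    (hν : IsHiddenStationary L r ω T₀ T₁ ν) {f : Config L → ℝ} (hf : Measurable f)
    (hfi : Integrable f ν) :
    totalRate L r * ∫ θ, f θ ∂ν = ∑ j ∈ moves L, rate L r j *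
      ∫ θ, ∫ b, f (hiddenMap T₀ T₁ j (θ, b)) ∂(hiddenNoise ω j) ∂ν := by
  have := hν.isProbabilityMeasure
  exact mul_integral_eq_of_ringGain_eq (fun j _ => h.rate_pos j)
    h.isProbabilityMeasure_hiddenNoise (fun j => (continuous_hiddenMap j).measurable)
    h.totalRate_nonneg hν.hiddenGain_eq hf hfi

/-- The mean hidden temperatures form the harmonic profile. -/
theorem IsHiddenStationary.integral_apply (h : Admissible L r ω T₀ T₁)
    (hν : IsHiddenStationary L r ω T₀ T₁ ν) (i : Site L) :
    ∫ θ, θ i ∂ν = meanTemperature L r ω T₀ T₁ i := by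
  have := hν.isProbabilityMeasure
  refine eq_meanTemperature h (m := fun i => ∫ θ, θ i ∂ν) (fun i => ?_) i
  rw [hν.mul_integral h (measurable_pi_apply i) (hν.integrable_apply i), siteGain]
  refine Finset.sum_congr rfl fun j _ => ?_
  congr 1
  rcases j with e | u | u
  · simp only [hiddenMap, hiddenNoise, h.integral_merge]
    simp only [merge]
    split_ifs
    · rw [integral_add ((hν.integrable_apply _).const_mul _) ((hν.integrable_apply _).const_mul _),
        integral_const_mul, integral_const_mul]
    · rfl
  all_goals
    simp only [hiddenMap, hiddenNoise, integral_const, probReal_univ, one_smul]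
    by_cases hu : i = u
    · subst hu; simp
    · simp [hu]

/-! ### Two sites: the covariance of the hidden temperatures -/

/-- The mean of `b (1 - b)`, for `b` the Beta noise of the edge `e`. -/
def noiseSpread {L : ℕ} (ω : ℤ → ℝ) (e : Site L × Site L) : ℝ :=
  ω e.1 * ω e.2 / ((ω e.1 + ω e.2) * (ω e.1 + ω e.2 + 2))

/-- The averaged action of a hidden move on second moments `F i k`, the first moments being `m`.
For `T₀ = T₁ = 0` this is the step of two particles, killed together at the baths. -/
def pairMap {L : ℕ} (ω : ℤ → ℝ) (T₀ T₁ : ℝ) (m : Config L) :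
    Move L → (Site L → Site L → ℝ) → Site L → Site L → ℝ
  | .inl e => fun F i k =>
    if i = e.1 ∨ i = e.2 then
      if k = e.1 ∨ k = e.2 then
        noiseMean ω (.inl e : Move L) * F e.1 e.1 + (1 - noiseMean ω (.inl e : Move L)) * F e.2 e.2
          - noiseSpread ω e * (F e.1 e.1 - F e.1 e.2 - F e.2 e.1 + F e.2 e.2)
      else noiseMean ω (.inl e : Move L) * F e.1 k + (1 - noiseMean ω (.inl e : Move L)) * F e.2 k
    else
      if k = e.1 ∨ k = e.2 then
        noiseMean ω (.inl e : Move L) * F i e.1 + (1 - noiseMean ω (.inl e : Move L)) * F i e.2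
      else F i k
  | .inr (.inl u) => fun F i k =>
    if i = u then if k = u then T₀ * T₀ else T₀ * m k else if k = u then m i * T₀ else F i k
  | .inr (.inr u) => fun F i k =>
    if i = u then if k = u then T₁ * T₁ else T₁ * m k else if k = u then m i * T₁ else F i k

lemma Admissible.noiseSpread_pos (h : Admissible L r ω T₀ T₁) (e : Site L × Site L) :
    0 < noiseSpread ω e := by
  have := h.2.1 e.1 e.1.2.1 e.1.2.2
  have := h.2.1 e.2 e.2.2.1 e.2.2.2
  unfold noiseSpread
  positivity

lemma Admissible.noiseSpread_le (h : Admissible L r ω T₀ T₁) (e : Site L × Site L) :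
    noiseSpread ω e ≤ noiseMean ω (.inl e : Move L) ∧
      noiseSpread ω e ≤ 1 - noiseMean ω (.inl e : Move L) := by
  have hu := h.2.1 e.1 e.1.2.1 e.1.2.2
  have hv := h.2.1 e.2 e.2.2.1 e.2.2.2
  have e1 : 1 - noiseMean ω (.inl e : Move L) = ω e.2 / (ω e.1 + ω e.2) := by
    simp only [noiseMean]; field_simp; ring
  rw [e1]
  simp only [noiseSpread, noiseMean]
  constructor <;>
  · rw [div_le_div_iff₀ (by positivity) (by positivity)]
    nlinarith [mul_pos hu hv, mul_pos hu hu, mul_pos hv hv, mul_pos (mul_pos hu hv) hu,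
      mul_pos (mul_pos hu hv) hv, mul_pos (mul_pos hu hu) hu, mul_pos (mul_pos hv hv) hv]

lemma Admissible.integral_merge_mul_merge (h : Admissible L r ω T₀ T₁) (e : Site L × Site L)
    (θ m : Config L) (i k : Site L) :
    ∫ b, merge e.1 e.2 θ b i * merge e.1 e.2 θ b k ∂(betaMeasure (ω e.1 / 2) (ω e.2 / 2)) =
      pairMap ω T₀ T₁ m (.inl e) (fun i k => θ i * θ k) i k := by
  have hu := h.omega_half_pos e.1
  have hv := h.omega_half_pos e.2
  have := isProbabilityMeasureBeta hu hv
  by_cases hi : i = e.1 ∨ i = e.2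
  · by_cases hk : k = e.1 ∨ k = e.2
    · have e0 : ∀ b : ℝ, merge e.1 e.2 θ b i * merge e.1 e.2 θ b k =
          merge e.1 e.2 (fun i => θ i * θ i) b i - b * (1 - b) * (θ e.1 - θ e.2) ^ 2 := by
        intro b
        simp only [merge, hi, hk, if_true]
        ring
      have hsp : ∫ b, b * (1 - b) ∂(betaMeasure (ω e.1 / 2) (ω e.2 / 2)) = noiseSpread ω e := by
        rw [integral_mul_one_sub_betaMeasure hu hv, noiseSpread]
        have := h.2.1 e.1 e.1.2.1 e.1.2.2
        have := h.2.1 e.2 e.2.2.1 e.2.2.2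
        field_simp
      simp_rw [e0]
      rw [integral_sub (h.integrable_merge e _ i) (integrable_betaMeasure hu hv (by fun_prop)),
        h.integral_merge, integral_mul_const, hsp]
      simp only [merge, pairMap, hi, hk, if_true]
      ring
    · have e0 : ∀ b : ℝ, merge e.1 e.2 θ b k = θ k := fun b => by simp [merge, hk]
      simp_rw [e0]
      rw [integral_mul_const, h.integral_merge]
      simp only [merge, pairMap, hi, hk, if_true, if_false]
      ring
  · have e0 : ∀ b : ℝ, merge e.1 e.2 θ b i = θ i := fun b => by simp [merge, hi]
    simp_rw [e0]
    rw [integral_const_mul, h.integral_merge]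
    by_cases hk : k = e.1 ∨ k = e.2
    · simp only [merge, pairMap, hi, hk, if_true, if_false]
      ring
    · simp only [merge, pairMap, hi, hk, if_false]

/-- The stationary second moments are fixed by the averaged moves. -/
lemma IsHiddenStationary.integral_mul (h : Admissible L r ω T₀ T₁)
    (hν : IsHiddenStationary L r ω T₀ T₁ ν) (i k : Site L) :
    totalRate L r * ∫ θ, θ i * θ k ∂ν = ∑ j ∈ moves L, rate L r j *
      pairMap ω T₀ T₁ (fun i => meanTemperature L r ω T₀ T₁ i) j
        (fun i k => ∫ θ, θ i * θ k ∂ν) i k := by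
  have := hν.isProbabilityMeasure
  rw [hν.mul_integral h (f := fun θ => θ i * θ k)
    ((measurable_pi_apply i).mul (measurable_pi_apply k)) (hν.integrable_mul i k)]
  refine Finset.sum_congr rfl fun j _ => ?_
  congr 1
  have hi2 := hν.integrable_mul
  rcases j with e | u | u
  · simp only [hiddenMap, hiddenNoise,
      h.integral_merge_mul_merge e _ (fun i => meanTemperature L r ω T₀ T₁ i)]
    simp only [pairMap]
    split_ifs
    · have i1 := ((hi2 e.1 e.1).const_mul (noiseMean ω (.inl e : Move L)))
      have i2 := ((hi2 e.2 e.2).const_mul (1 - noiseMean ω (.inl e : Move L)))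
      have i3 : Integrable (fun θ : Config L => θ e.1 * θ e.1 - θ e.1 * θ e.2) ν :=
        (hi2 e.1 e.1).sub (hi2 e.1 e.2)
      have i4 : Integrable (fun θ : Config L => θ e.1 * θ e.1 - θ e.1 * θ e.2 - θ e.2 * θ e.1) ν :=
        i3.sub (hi2 e.2 e.1)
      have i5 : Integrable (fun θ : Config L =>
          θ e.1 * θ e.1 - θ e.1 * θ e.2 - θ e.2 * θ e.1 + θ e.2 * θ e.2) ν := i4.add (hi2 e.2 e.2)
      have i6 : Integrable (fun θ : Config L => noiseMean ω (.inl e : Move L) * (θ e.1 * θ e.1) +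
          (1 - noiseMean ω (.inl e : Move L)) * (θ e.2 * θ e.2)) ν := i1.add i2
      rw [integral_sub i6 (i5.const_mul _), integral_add i1 i2, integral_const_mul,
        integral_const_mul, integral_const_mul, integral_add i4 (hi2 e.2 e.2),
        integral_sub i3 (hi2 e.2 e.1), integral_sub (hi2 e.1 e.1) (hi2 e.1 e.2)]
    · rw [integral_add ((hi2 _ _).const_mul _) ((hi2 _ _).const_mul _), integral_const_mul,
        integral_const_mul]
    · rw [integral_add ((hi2 _ _).const_mul _) ((hi2 _ _).const_mul _), integral_const_mul,
        integral_const_mul]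
    · rfl
  all_goals
    simp only [hiddenMap, hiddenNoise, integral_const, probReal_univ, one_smul, pairMap]
    by_cases hu : i = u
    · subst hu
      by_cases hk : k = i
      · subst hk; simp
      · simp [hk, integral_const_mul, hν.integral_apply h]
    · by_cases hk : k = u
      · subst hk; simp [hu, integral_mul_const, hν.integral_apply h]
      · simp [hu, hk]

lemma pairMap_sub_mul (m : Config L) (j : Move L) (F G H : Site L → Site L → ℝ) (c : ℝ)
    (i k : Site L) :
    pairMap ω T₀ T₁ m j F i k - pairMap ω T₀ T₁ m j G i k -
      c * pairMap ω 0 0 0 j H i k =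
      pairMap ω 0 0 0 j (fun i k => F i k - G i k - c * H i k) i k := by
  rcases j with e | u | u <;> simp only [pairMap] <;> split_ifs <;> ring

lemma Admissible.pairMap_le_mul (h : Admissible L r ω T₀ T₁) {F W : Site L → Site L → ℝ} {c : ℝ}
    (hF : ∀ i k, F i k ≤ c * W i k) (j : Move L) (i k : Site L) :
    pairMap ω 0 0 0 j F i k ≤ c * pairMap ω 0 0 0 j W i k := by
  rcases j with e | u | u
  · have hm := h.noiseMean_mem e
    have hs := h.noiseSpread_pos e
    have hs' := h.noiseSpread_le e
    simp only [pairMap]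
    split_ifs
    · have h1 := mul_le_mul_of_nonneg_left (hF e.1 e.1) (sub_nonneg.2 hs'.1)
      have h2 := mul_le_mul_of_nonneg_left (hF e.2 e.2) (sub_nonneg.2 hs'.2)
      have h3 := mul_le_mul_of_nonneg_left (hF e.1 e.2) hs.le
      have h4 := mul_le_mul_of_nonneg_left (hF e.2 e.1) hs.le
      linarith
    · have h1 := mul_le_mul_of_nonneg_left (hF e.1 k) hm.1.le
      have h2 := mul_le_mul_of_nonneg_left (hF e.2 k) (sub_nonneg.2 hm.2.le)
      linarith
    · have h1 := mul_le_mul_of_nonneg_left (hF i e.1) hm.1.le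
      have h2 := mul_le_mul_of_nonneg_left (hF i e.2) (sub_nonneg.2 hm.2.le)
      linarith
    · exact hF i k
  all_goals
    simp only [pairMap]
    split_ifs
    · simp
    · simp
    · simp
    · exact hF i k

lemma Admissible.pairMap_barrier_le (h : Admissible L r ω T₀ T₁) (j : Move L) (i k : Site L) :
    pairMap ω 0 0 0 j (fun i k => barrier L r ω i + barrier L r ω k) i k ≤
      hiddenMap 0 0 j (barrier L r ω, noiseMean ω j) i +
        hiddenMap 0 0 j (barrier L r ω, noiseMean ω j) k := by
  have hw := h.barrier_pos
  rcases j with e | u | u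
  · simp only [pairMap, hiddenMap, merge]
    refine le_of_eq ?_
    split_ifs <;> ring
  all_goals
    simp only [pairMap, hiddenMap, Function.update_apply]
    split_ifs <;> simp [(hw i).le, (hw k).le]

/-- What the product of the mean temperatures fails to satisfy in the second moment equation: the
local production of covariance by a move. -/
def source (L : ℕ) (r ω : ℤ → ℝ) (T₀ T₁ : ℝ) (j : Move L) (i k : Site L) : ℝ :=
  let t : Config L := fun i => meanTemperature L r ω T₀ T₁ i
  pairMap ω T₀ T₁ t j (fun i k => t i * t k) i k - t i * t k -
    (hiddenMap T₀ T₁ j (t, noiseMean ω j) i - t i) * t k -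
    t i * (hiddenMap T₀ T₁ j (t, noiseMean ω j) k - t k)

/-- The covariance of the hidden temperatures solves the two-particle equation with the source
`source`. -/
lemma IsHiddenStationary.covariance_eq (h : Admissible L r ω T₀ T₁)
    (hν : IsHiddenStationary L r ω T₀ T₁ ν) (i k : Site L) :
    totalRate L r * (∫ θ, θ i * θ k ∂ν -
        meanTemperature L r ω T₀ T₁ i * meanTemperature L r ω T₀ T₁ k) =
      ∑ j ∈ moves L, rate L r j * (pairMap ω 0 0 0 j (fun i k => ∫ θ, θ i * θ k ∂ν -
        meanTemperature L r ω T₀ T₁ i * meanTemperature L r ω T₀ T₁ k) i k +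
        source L r ω T₀ T₁ j i k) := by
  set t : Config L := fun i => meanTemperature L r ω T₀ T₁ i with ht
  have hL := two_le_of_site i
  have hharm : ∀ i, ∑ j ∈ moves L, rate L r j *
      (hiddenMap T₀ T₁ j (t, noiseMean ω j) i - t i) = 0 := by
    intro i
    have := siteGain_meanTemperature h hL i
    rw [totalRate_eq_sum, siteGain, Finset.sum_mul] at this
    simp_rw [mul_sub]
    rw [Finset.sum_sub_distrib, sub_eq_zero]
    exact this
  have h1 := hν.integral_mul h i k
  have hp : ∀ j, pairMap ω 0 0 0 j (fun i k => ∫ θ, θ i * θ k ∂ν - t i * t k) i k =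
      pairMap ω T₀ T₁ t j (fun i k => ∫ θ, θ i * θ k ∂ν) i k -
        pairMap ω T₀ T₁ t j (fun i k => t i * t k) i k := by
    intro j
    have := pairMap_sub_mul (ω := ω) (T₀ := T₀) (T₁ := T₁) t j (fun i k => ∫ θ, θ i * θ k ∂ν)
      (fun i k => t i * t k) (fun _ _ => 0) 0 i k
    simp only [zero_mul, sub_zero] at this
    exact this.symm
  have e : ∀ j, rate L r j * (pairMap ω 0 0 0 j (fun i k => ∫ θ, θ i * θ k ∂ν - t i * t k) i k +
      source L r ω T₀ T₁ j i k) =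
      rate L r j * pairMap ω T₀ T₁ t j (fun i k => ∫ θ, θ i * θ k ∂ν) i k -
        rate L r j * (t i * t k) -
        (rate L r j * (hiddenMap T₀ T₁ j (t, noiseMean ω j) i - t i)) * t k -
        t i * (rate L r j * (hiddenMap T₀ T₁ j (t, noiseMean ω j) k - t k)) := by
    intro j
    rw [hp, source]
    ring
  change totalRate L r * (∫ θ, θ i * θ k ∂ν - t i * t k) = ∑ j ∈ moves L, rate L r j *
    (pairMap ω 0 0 0 j (fun i k => ∫ θ, θ i * θ k ∂ν - t i * t k) i k + source L r ω T₀ T₁ j i k)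
  simp_rw [e]
  rw [Finset.sum_sub_distrib, Finset.sum_sub_distrib, Finset.sum_sub_distrib, ← Finset.sum_mul,
    ← Finset.sum_mul, ← Finset.mul_sum, hharm, hharm, ← h1, ← totalRate_eq_sum]
  ring

/-- The dissipation produced by a move when two particles sit close together. -/
def dissipation (L : ℕ) (r ω : ℤ → ℝ) (j : Move L) (i k : Site L) : ℝ :=
  match j with
  | .inl e => if i = e.1 ∨ i = e.2 then if k = e.1 ∨ k = e.2 then
      2 * noiseSpread ω e * (resistance r ω e.2 - resistance r ω e.1) else 0 else 0
  | .inr (.inl u) => if i = u then if k = u then totalResistance L r ω else 0 else 0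
  | .inr (.inr u) => if i = u then if k = u then totalResistance L r ω else 0 else 0

lemma resistance_sub_of_mem_bulkEdges {e : Site L × Site L} (he : e ∈ bulkEdges L) :
    resistance r ω e.2 - resistance r ω e.1 = edgeResistance r ω e.1 := by
  rw [mem_bulkEdges.1 he, resistance_add_one (by have := e.1.2.1; omega)]
  ring

/-- Tanaka's formula for two particles: `Z - |R i - R k|` is superharmonic, with a defect of at
least `dissipation`, because `R` is harmonic and `|x| ≥ ± x`. Here `σ` is the sign of
`R k - R i`. -/
lemma Admissible.pairMap_resistance_le (h : Admissible L r ω T₀ T₁) {j : Move L}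
    (hj : j ∈ moves L) (i k : Site L) {σ : ℝ} (hσ : σ = 1 ∨ σ = -1)
    (hik : |resistance r ω i - resistance r ω k| = σ * (resistance r ω k - resistance r ω i)) :
    pairMap ω 0 0 0 j (fun i k => totalResistance L r ω - |resistance r ω i - resistance r ω k|)
        i k - (totalResistance L r ω - |resistance r ω i - resistance r ω k|) +
        dissipation L r ω j i k ≤
      σ * ((hiddenMap 0 (totalResistance L r ω) j (fun i => resistance r ω i, noiseMean ω j) i -
          resistance r ω i) -
        (hiddenMap 0 (totalResistance L r ω) j (fun i => resistance r ω i, noiseMean ω j) k -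
          resistance r ω k)) := by
  set Z := totalResistance L r ω with hZ
  have hR0 := h.resistance_pos
  have hRZ := h.resistance_lt
  have habs : ∀ x y : ℝ, σ * (y - x) ≤ |x - y| := by
    intro x y
    rcases hσ with rfl | rfl
    · have := neg_abs_le (x - y); linarith
    · have := le_abs_self (x - y); linarith
  rcases j with e | u | u
  · have hm := h.noiseMean_mem e
    have hs := h.noiseSpread_pos e
    have hρ : 0 ≤ resistance r ω e.2 - resistance r ω e.1 := by
      have he : e ∈ bulkEdges L := mem_bulkEdges.2 (mem_moves_inl.1 hj)
      rw [resistance_sub_of_mem_bulkEdges he]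
      have h1 := mem_bulkEdges.1 he
      have h2 := e.2.2.2
      exact (h.edgeResistance_pos (by have := e.1.2.1; omega) (by omega)).le
    have hab : |resistance r ω e.1 - resistance r ω e.2| =
        resistance r ω e.2 - resistance r ω e.1 := by rw [abs_sub_comm, abs_of_nonneg hρ]
    have hab' : |resistance r ω e.2 - resistance r ω e.1| =
        resistance r ω e.2 - resistance r ω e.1 := abs_of_nonneg hρ
    simp only [pairMap, hiddenMap, merge, dissipation]
    by_cases hi : i = e.1 ∨ i = e.2
    · by_cases hk : k = e.1 ∨ k = e.2
      · simp only [hi, hk, if_true, sub_self, abs_zero, hab, hab', hik]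
        linarith
      · simp only [hi, hk, if_true, if_false, hik]
        have h1 := mul_le_mul_of_nonneg_left (habs (resistance r ω e.1) (resistance r ω k)) hm.1.le
        have h2 := mul_le_mul_of_nonneg_left (habs (resistance r ω e.2) (resistance r ω k))
          (sub_nonneg.2 hm.2.le)
        linarith
    · by_cases hk : k = e.1 ∨ k = e.2
      · simp only [hi, hk, if_true, if_false, hik]
        have h1 := mul_le_mul_of_nonneg_left (habs (resistance r ω i) (resistance r ω e.1)) hm.1.le
        have h2 := mul_le_mul_of_nonneg_left (habs (resistance r ω i) (resistance r ω e.2))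
          (sub_nonneg.2 hm.2.le)
        linarith
      · simp [hi, hk]
  all_goals
    have hi0 := hR0 i
    have hk0 := hR0 k
    have hiZ := hRZ i
    have hkZ := hRZ k
    rw [← hZ] at hiZ hkZ
    simp only [pairMap, hiddenMap, dissipation, hik, ← hZ]
    by_cases hi : i = u
    · subst hi
      by_cases hk : k = i
      · subst hk; simp
      · rcases hσ with rfl | rfl <;> simp [hk] <;> linarith
    · by_cases hk : k = u
      · subst hk
        rcases hσ with rfl | rfl <;> simp [hi] <;> linarith
      · simp [hi, hk]

/-- The production of covariance is dominated by the dissipation, for every `D` which bounds the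
resistances to the baths and the ratios `edgeResistance / (2 * noiseSpread)`. -/
lemma Admissible.source_le (h : Admissible L r ω T₀ T₁) {D : ℝ}
    (hD : ∀ e ∈ bulkEdges L, edgeResistance r ω e.1 ≤ 2 * noiseSpread ω e * D)
    (hD₀ : 1 / (r 0 * ω 1) ≤ D) (hD₁ : 1 / (r ((L : ℤ) - 1) * ω ((L : ℤ) - 1)) ≤ D)
    {j : Move L} (hj : j ∈ moves L) (i k : Site L) :
    source L r ω T₀ T₁ j i k ≤
      (T₁ - T₀) ^ 2 * D / totalResistance L r ω ^ 2 * dissipation L r ω j i k := by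
  have hZpos := h.totalResistance_pos (two_le_of_site i)
  set Z := totalResistance L r ω with hZ
  have hc : (T₁ - T₀) ^ 2 * D / Z ^ 2 = ((T₁ - T₀) / Z) ^ 2 * D := by rw [div_pow]; ring
  have hc0 := sq_nonneg ((T₁ - T₀) / Z)
  rw [hc]
  set c := (T₁ - T₀) / Z with hcdef
  have hcZ : c * Z = T₁ - T₀ := by rw [hcdef]; field_simp
  rcases j with e | u | u
  · have he : e ∈ bulkEdges L := mem_bulkEdges.2 (mem_moves_inl.1 hj)
    have hm := h.noiseMean_mem e
    have hs := h.noiseSpread_pos e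
    have hρ := resistance_sub_of_mem_bulkEdges (r := r) (ω := ω) he
    have hρ0 : 0 < edgeResistance r ω e.1 := by
      have h1 := mem_bulkEdges.1 he
      have h2 := e.2.2.2
      exact h.edgeResistance_pos (by have := e.1.2.1; omega) (by omega)
    have hDe := mul_le_mul_of_nonneg_left (mul_le_mul_of_nonneg_right (hD e he) hρ0.le) hc0
    have hb : ∀ x : ℝ, x ≤ 1 → x * (c ^ 2 * edgeResistance r ω e.1 ^ 2) ≤
        c ^ 2 * D * (2 * noiseSpread ω e * edgeResistance r ω e.1) := by
      intro x hx
      have := mul_le_mul_of_nonneg_right hx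
        (mul_nonneg hc0 (sq_nonneg (edgeResistance r ω (e.1 : ℤ))))
      linarith
    have hv : resistance r ω e.2 = resistance r ω e.1 + edgeResistance r ω e.1 := by linarith
    simp only [source, pairMap, hiddenMap, merge, dissipation, meanTemperature, ← hZ, ← hcdef]
    by_cases hi : i = e.1 ∨ i = e.2
    · by_cases hk : k = e.1 ∨ k = e.2
      · simp only [hi, hk, if_true, hv, add_sub_cancel_left]
        rcases hi with hi | hi <;> rcases hk with hk | hk <;> rw [hi, hk]
        · refine le_trans (le_of_eq ?_)
            (hb (1 - noiseMean ω (.inl e : Move L) - noiseSpread ω e) (by linarith))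
          ring
        · refine le_trans (le_of_eq ?_) (hb (-noiseSpread ω e) (by linarith))
          rw [hv]; ring
        · refine le_trans (le_of_eq ?_) (hb (-noiseSpread ω e) (by linarith))
          rw [hv]; ring
        · refine le_trans (le_of_eq ?_)
            (hb (noiseMean ω (.inl e : Move L) - noiseSpread ω e) (by linarith))
          rw [hv]; ring
      · simp only [hi, hk, if_true, if_false]
        exact le_of_eq (by ring)
    · by_cases hk : k = e.1 ∨ k = e.2
      · simp only [hi, hk, if_true, if_false]
        exact le_of_eq (by ring)
      · simp only [hi, hk, if_false]
        exact le_of_eq (by ring)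
  · simp only [source, pairMap, hiddenMap, dissipation, Function.update_apply, ← hZ]
    by_cases hi : i = u
    · subst hi
      by_cases hk : k = i
      · subst hk
        have hu : (k : ℤ) = 1 := by
          simp [moves, leftSites] at hj; omega
        have h1 : resistance r ω k ≤ D := by
          have : resistance r ω 1 = 1 / (r 0 * ω 1) := by simp [resistance]
          rw [hu, this]; exact hD₀
        have h2 := mul_le_mul h1 (h.resistance_lt k).le (h.resistance_pos k).le
          ((h.resistance_pos k).le.trans h1)
        simp only [if_true, meanTemperature, ← hZ, ← hcdef]
        have := mul_le_mul_of_nonneg_left h2 hc0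
        refine le_trans (le_of_eq ?_) (this.trans (le_of_eq ?_)) <;> ring
      · simp only [hk, if_true, if_false]
        exact le_of_eq (by ring)
    · by_cases hk : k = u
      · subst hk
        simp only [hi, if_true, if_false]
        exact le_of_eq (by ring)
      · simp only [hi, hk, if_false]
        exact le_of_eq (by ring)
  · simp only [source, pairMap, hiddenMap, dissipation, Function.update_apply, ← hZ]
    by_cases hi : i = u
    · subst hi
      by_cases hk : k = i
      · subst hk
        have hu : (k : ℤ) = (L : ℤ) - 1 := by
          simp [moves, rightSites] at hj; omega
        have h0 : Z - resistance r ω k = 1 / (r ((L : ℤ) - 1) * ω ((L : ℤ) - 1)) := by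
          rw [hZ, hu, totalResistance]; ring
        have h1 : Z - resistance r ω k ≤ D := h0.trans_le hD₁
        have h3 := h.resistance_pos k
        have h4 := sub_pos.2 (h.resistance_lt k)
        rw [← hZ] at h4
        have h2 := mul_le_mul h1 (show Z - resistance r ω k ≤ Z by linarith) h4.le
          (h4.le.trans h1)
        simp only [if_true, meanTemperature, ← hZ, ← hcdef]
        have := mul_le_mul_of_nonneg_left h2 hc0
        have hT : T₁ = T₀ + c * Z := by linarith
        refine le_trans (le_of_eq ?_) (this.trans (le_of_eq ?_))
        · rw [hT]; ring
        · ring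
      · simp only [hk, if_true, if_false]
        exact le_of_eq (by ring)
    · by_cases hk : k = u
      · subst hk
        simp only [hi, if_true, if_false]
        exact le_of_eq (by ring)
      · simp only [hi, hk, if_false]
        exact le_of_eq (by ring)

/-- The hidden temperatures concentrate: their variance is at most of the order of the inverse of
the total resistance. -/
theorem IsHiddenStationary.variance_le (h : Admissible L r ω T₀ T₁)
    (hν : IsHiddenStationary L r ω T₀ T₁ ν) {D : ℝ}
    (hD : ∀ e ∈ bulkEdges L, edgeResistance r ω e.1 ≤ 2 * noiseSpread ω e * D)
    (hD₀ : 1 / (r 0 * ω 1) ≤ D) (hD₁ : 1 / (r ((L : ℤ) - 1) * ω ((L : ℤ) - 1)) ≤ D)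
    (i : Site L) :
    ∫ θ, (θ i - meanTemperature L r ω T₀ T₁ i) ^ 2 ∂ν ≤
      (T₁ - T₀) ^ 2 * D / totalResistance L r ω := by
  have := hν.isProbabilityMeasure
  have hZpos := h.totalResistance_pos (two_le_of_site i)
  have hDpos : 0 < D := (h.bath_resistance_pos (two_le_of_site i)).1.trans_le hD₀
  set Z := totalResistance L r ω with hZ
  set t : Config L := fun i => meanTemperature L r ω T₀ T₁ i with ht
  set K := (T₁ - T₀) ^ 2 * D / Z ^ 2 with hK
  have hK0 : 0 ≤ K := by positivity
  let φ : Site L → Site L → ℝ := fun i k => ∫ θ, θ i * θ k ∂ν - t i * t k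
  let g : Site L → Site L → ℝ := fun i k => Z - |resistance r ω i - resistance r ω k|
  -- `K • g` is a supersolution of the two-particle equation
  have hsuper : ∀ i k, ∑ j ∈ moves L, rate L r j * (pairMap ω 0 0 0 j g i k - g i k +
      dissipation L r ω j i k) ≤ 0 := by
    intro i k
    obtain ⟨σ, hσ, hik⟩ : ∃ σ : ℝ, (σ = 1 ∨ σ = -1) ∧
        |resistance r ω i - resistance r ω k| = σ * (resistance r ω k - resistance r ω i) := by
      rcases le_total (resistance r ω i) (resistance r ω k) with hle | hle
      · exact ⟨1, Or.inl rfl, by rw [abs_of_nonpos (by linarith)]; ring⟩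
      · exact ⟨-1, Or.inr rfl, by rw [abs_of_nonneg (by linarith)]; ring⟩
    refine (Finset.sum_le_sum fun j hj => mul_le_mul_of_nonneg_left
      (h.pairMap_resistance_le hj i k hσ hik) (h.rate_pos j).le).trans (le_of_eq ?_)
    have hharm : ∀ i, ∑ j ∈ moves L, rate L r j *
        (hiddenMap 0 Z j (fun i => resistance r ω i, noiseMean ω j) i - resistance r ω i) = 0 := by
      intro i
      have := siteGain_resistance h i
      rw [totalRate_eq_sum, siteGain, Finset.sum_mul] at this
      simp_rw [mul_sub]
      rw [Finset.sum_sub_distrib, sub_eq_zero]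
      exact this
    simp_rw [mul_left_comm _ σ, mul_sub (rate L r _) (_ - _)]
    rw [← Finset.mul_sum, Finset.sum_sub_distrib, hharm, hharm]
    ring
  let P : (Site L × Site L → ℝ) → Site L × Site L → ℝ := fun F q =>
    ∑ j ∈ moves L, rate L r j * pairMap ω 0 0 0 j (fun i k => F (i, k)) q.1 q.2
  have hcomp := nonpos_of_subsolution P (A := totalRate L r)
    (W := fun q => barrier L r ω q.1 + barrier L r ω q.2) (fun F c _ hF q => by
      simp only [P]
      rw [Finset.mul_sum]
      refine Finset.sum_le_sum fun j _ => ?_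
      rw [mul_left_comm]
      exact mul_le_mul_of_nonneg_left (h.pairMap_le_mul (fun i k => hF (i, k)) j q.1 q.2)
        (h.rate_pos j).le)
    (fun q => add_pos (h.barrier_pos _) (h.barrier_pos _))
    (fun q => by
      refine lt_of_le_of_lt (Finset.sum_le_sum fun j _ => mul_le_mul_of_nonneg_left
        (h.pairMap_barrier_le j q.1 q.2) (h.rate_pos j).le) ?_
      simp_rw [mul_add]
      rw [Finset.sum_add_distrib]
      exact add_lt_add (siteGain_barrier_lt h q.1) (siteGain_barrier_lt h q.2))
    (g := fun q => φ q.1 q.2 - K * g q.1 q.2) (fun q => by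
      obtain ⟨i, k⟩ := q
      have h1 := hν.covariance_eq h i k
      have h2 := mul_nonpos_of_nonneg_of_nonpos hK0 (hsuper i k)
      have hp : ∀ j, pairMap ω 0 0 0 j (fun i k => φ i k - K * g i k) i k =
          pairMap ω 0 0 0 j φ i k - K * pairMap ω 0 0 0 j g i k := by
        intro j
        have := pairMap_sub_mul (ω := ω) (T₀ := 0) (T₁ := 0) 0 j φ (fun _ _ => 0) g K i k
        have h0 : pairMap ω 0 0 0 j (fun _ _ => 0) i k = 0 := by
          rcases j with e | u | u <;> simp [pairMap]
        simpa [h0] using this.symm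
      have h3 : ∑ j ∈ moves L, rate L r j * source L r ω T₀ T₁ j i k ≤
          ∑ j ∈ moves L, rate L r j * (K * dissipation L r ω j i k) :=
        Finset.sum_le_sum fun j hj => mul_le_mul_of_nonneg_left
          (h.source_le hD hD₀ hD₁ hj i k) (h.rate_pos j).le
      simp only [P, hp]
      change totalRate L r * (φ i k - K * g i k) ≤ _
      change totalRate L r * φ i k = ∑ j ∈ moves L, rate L r j * (pairMap ω 0 0 0 j φ i k +
        source L r ω T₀ T₁ j i k) at h1
      have h4 : K * ∑ j ∈ moves L, rate L r j * (pairMap ω 0 0 0 j g i k - g i k +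
          dissipation L r ω j i k) = ∑ j ∈ moves L, rate L r j * (K * pairMap ω 0 0 0 j g i k) -
          totalRate L r * (K * g i k) +
          ∑ j ∈ moves L, rate L r j * (K * dissipation L r ω j i k) := by
        rw [totalRate_eq_sum, Finset.sum_mul, Finset.mul_sum, ← Finset.sum_sub_distrib,
          ← Finset.sum_add_distrib]
        exact Finset.sum_congr rfl fun j _ => by ring
      simp_rw [mul_sub, mul_add] at h1 ⊢
      rw [Finset.sum_add_distrib] at h1
      rw [Finset.sum_sub_distrib]
      linarith) (i, i)
  have hvar : ∫ θ, (θ i - t i) ^ 2 ∂ν = φ i i := by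
    have e : ∀ θ : Config L, (θ i - t i) ^ 2 = (θ i * θ i - 2 * t i * θ i) + t i * t i :=
      fun θ => by ring
    simp_rw [e]
    have i1 := (hν.integrable_apply i).const_mul (2 * t i)
    rw [integral_add (f := fun θ : Config L => θ i * θ i - 2 * t i * θ i)
        ((hν.integrable_mul i i).sub i1) (integrable_const _),
      integral_sub (hν.integrable_mul i i) i1, integral_const_mul, hν.integral_apply h]
    simp only [integral_const, probReal_univ, one_smul, φ, ht]
    ring
  change ∫ θ, (θ i - t i) ^ 2 ∂ν ≤ _
  rw [hvar]
  have hg : g i i = Z := by simp [g]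
  have hKZ : K * Z = (T₁ - T₀) ^ 2 * D / Z := by rw [hK]; field_simp
  simp only [hg] at hcomp
  linarith

/-! ### From concentration of the temperatures to the Lévy–Prokhorov distance -/

lemma levyProkhorovEDist_map_le {Ω E : Type*} [MeasurableSpace Ω] [PseudoMetricSpace E]
    [MeasurableSpace E] [OpensMeasurableSpace E] (P : Measure Ω) {f g : Ω → E}
    (hf : Measurable f) (hg : Measurable g) {ε : ℝ} (hε : 0 < ε)
    (h : P {x | ε ≤ dist (f x) (g x)} ≤ ENNReal.ofReal ε) :
    levyProkhorovEDist (P.map f) (P.map g) ≤ ENNReal.ofReal ε := by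
  have key : ∀ {f g : Ω → E}, Measurable f → Measurable g →
      P {x | ε ≤ dist (f x) (g x)} ≤ ENNReal.ofReal ε → ∀ B, MeasurableSet B →
      P.map f B ≤ P.map g (Metric.thickening (ENNReal.ofReal ε).toReal B) + ENNReal.ofReal ε := by
    intro f g hf hg h B hB
    rw [ENNReal.toReal_ofReal hε.le, Measure.map_apply hf hB,
      Measure.map_apply hg Metric.isOpen_thickening.measurableSet]
    refine (measure_mono fun x hx => ?_).trans
      ((measure_union_le _ {x | ε ≤ dist (f x) (g x)}).trans (add_le_add le_rfl h))
    by_cases hd : ε ≤ dist (f x) (g x)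
    · exact Or.inr hd
    · refine Or.inl (Metric.mem_thickening_iff.2 ⟨f x, hx, ?_⟩)
      rw [dist_comm]
      exact not_le.1 hd
  refine sInf_le fun B hB => ⟨key hf hg h B hB, key hg hf ?_ B hB⟩
  simpa only [dist_comm] using h

lemma Admissible.map_gammaPi (h : Admissible L r ω T₀ T₁) {S : Type*} [Fintype S]
    {w : S → Site L} (hw : Function.Injective w) {u : ℝ} (hu : 0 ≤ u) :
    (gammaPi L ω).map (fun X s => u * X (w s)) =
      Measure.pi fun s => gammaLaw (ω (w s) / 2) u := by
  have := h.isProbabilityMeasure_gamma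
  have := h.isProbabilityMeasure_gammaPi
  have hm : ∀ i : Site L, Measurable fun X : Config L => u * X i := fun i => by fun_prop
  have hind : iIndepFun (fun (i : Site L) (X : Config L) => u * X i) (gammaPi L ω) :=
    iIndepFun_pi (X := fun _ x => u * x) fun i => (by fun_prop)
  rw [(iIndepFun_iff_map_fun_eq_pi_map fun s => (hm (w s)).aemeasurable).1 (hind.precomp hw)]
  congr 1
  funext s
  have hev := measurePreserving_eval (fun w : Site L => gammaMeasure (ω w / 2) 1) (w s)
  rw [gammaLaw_eq_map (h.omega_half_pos (w s)) hu, ← hev.map_eq,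
    Measure.map_map (by fun_prop) hev.measurable]
  rfl

/-- Replacing the random temperatures `θ` by a constant `u` in `θ w * X w` moves the law of
finitely many energies by little, if `θ` is close to `u` in quadratic mean (Chebyshev). -/
lemma IsHiddenStationary.levyProkhorovEDist_le (h : Admissible L r ω T₀ T₁)
    (hν : IsHiddenStationary L r ω T₀ T₁ ν) {S : Type*} [Fintype S]
    {w : S → Site L} (hw : Function.Injective w) {u : ℝ} (hu : 0 ≤ u) {ε : ℝ} (hε : 0 < ε)
    (hsum : ∑ s, (∫ θ, (θ (w s) - u) ^ 2 ∂ν) * (ω (w s) / 2 * (ω (w s) / 2 + 1)) ≤ ε ^ 3) :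
    levyProkhorovEDist ((mixture L ω ν).map fun ξ s => ξ (w s))
      (Measure.pi fun s => gammaLaw (ω (w s) / 2) u) ≤ ENNReal.ofReal ε := by
  have := hν.isProbabilityMeasure
  have := h.isProbabilityMeasure_gamma
  have := h.isProbabilityMeasure_gammaPi
  set P := ν.prod (gammaPi L ω) with hP
  let f : Config L × Config L → S → ℝ := fun q s => q.1 (w s) * q.2 (w s)
  let g : Config L × Config L → S → ℝ := fun q s => u * q.2 (w s)
  have hm1 : ∀ s, Measurable fun q : Config L × Config L => q.1 (w s) := fun s =>
    (measurable_pi_apply _).comp measurable_fst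
  have hm2 : ∀ s, Measurable fun q : Config L × Config L => q.2 (w s) := fun s =>
    (measurable_pi_apply _).comp measurable_snd
  have hf : Measurable f := measurable_pi_lambda _ fun s => (hm1 s).mul (hm2 s)
  have hg : Measurable g := measurable_pi_lambda _ fun s => (hm2 s).const_mul u
  have e1 : (mixture L ω ν).map (fun ξ s => ξ (w s)) = P.map f := by
    have hmul : Measurable fun q : Config L × Config L => q.1 * q.2 :=
      measurable_fst.mul measurable_snd
    rw [mixture, Measure.map_map (measurable_pi_lambda _ fun s => measurable_pi_apply _) hmul]
    rfl
  have e2 : (Measure.pi fun s => gammaLaw (ω (w s) / 2) u) = P.map g := by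
    have hm : Measurable fun (X : Config L) (s : S) => u * X (w s) :=
      measurable_pi_lambda _ fun s => by fun_prop
    have hsnd : P.map Prod.snd = gammaPi L ω := by
      rw [hP, Measure.map_snd_prod, measure_univ, one_smul]
    rw [← h.map_gammaPi hw hu, ← hsnd, Measure.map_map hm measurable_snd]
    rfl
  rw [e1, e2]
  refine levyProkhorovEDist_map_le P hf hg hε ?_
  have hε2 : ENNReal.ofReal (ε ^ 2) ≠ 0 := (ENNReal.ofReal_pos.2 (pow_pos hε 2)).ne'
  have hcheb : ∀ s, P {q | ε ≤ |(q.1 (w s) - u) * q.2 (w s)|} ≤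
      ENNReal.ofReal ((∫ θ, (θ (w s) - u) ^ 2 ∂ν) * (ω (w s) / 2 * (ω (w s) / 2 + 1)) /
        ε ^ 2) := by
    intro s
    have hint : Integrable (fun θ : Config L => (θ (w s) - u) ^ 2) ν := by
      have e : ∀ θ : Config L, (θ (w s) - u) ^ 2 =
          (θ (w s) * θ (w s) - 2 * u * θ (w s)) + u ^ 2 := fun θ => by ring
      simp_rw [e]
      exact ((hν.integrable_mul _ _).sub ((hν.integrable_apply _).const_mul _)).add
        (integrable_const _)
    have hX : ∫⁻ X, ENNReal.ofReal (X (w s) ^ 2) ∂(gammaPi L ω) =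
        ENNReal.ofReal (ω (w s) / 2 * (ω (w s) / 2 + 1)) := by
      rw [← lintegral_sq_gammaMeasure (h.omega_half_pos (w s))]
      have hev := measurePreserving_eval (fun w : Site L => gammaMeasure (ω w / 2) 1) (w s)
      exact hev.lintegral_comp (f := fun x : ℝ => ENNReal.ofReal (x ^ 2)) (by fun_prop)
    have hprod : ∫⁻ q, ENNReal.ofReal (((q.1 (w s) - u) * q.2 (w s)) ^ 2) ∂P =
        ENNReal.ofReal ((∫ θ, (θ (w s) - u) ^ 2 ∂ν) * (ω (w s) / 2 * (ω (w s) / 2 + 1))) := by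
      rw [ENNReal.ofReal_mul (integral_nonneg fun θ => sq_nonneg _), ← hX,
        ofReal_integral_eq_lintegral_ofReal hint (ae_of_all _ fun θ => sq_nonneg _),
        ← lintegral_prod_mul]
      · refine lintegral_congr fun q => ?_
        rw [← ENNReal.ofReal_mul (sq_nonneg _), mul_pow]
      · exact (by fun_prop : Measurable fun θ : Config L =>
          ENNReal.ofReal ((θ (w s) - u) ^ 2)).aemeasurable
      · exact (by fun_prop : Measurable fun X : Config L =>
          ENNReal.ofReal (X (w s) ^ 2)).aemeasurable
    have hset : {q : Config L × Config L | ε ≤ |(q.1 (w s) - u) * q.2 (w s)|} ⊆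
        {q | ENNReal.ofReal (ε ^ 2) ≤
          ENNReal.ofReal (((q.1 (w s) - u) * q.2 (w s)) ^ 2)} := by
      intro q hq
      refine ENNReal.ofReal_le_ofReal ?_
      rw [← sq_abs ((q.1 (w s) - u) * q.2 (w s))]
      exact pow_le_pow_left₀ hε.le hq 2
    refine (measure_mono hset).trans ?_
    have hmq : Measurable fun q : Config L × Config L =>
        ENNReal.ofReal (((q.1 (w s) - u) * q.2 (w s)) ^ 2) :=
      ((((hm1 s).sub_const u).mul (hm2 s)).pow_const 2).ennreal_ofReal
    refine (meas_ge_le_lintegral_div hmq.aemeasurable hε2 ENNReal.ofReal_ne_top).trans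
      (le_of_eq ?_)
    rw [hprod, ← ENNReal.ofReal_div_of_pos (pow_pos hε 2)]
  have hcover : {q | ε ≤ dist (f q) (g q)} ⊆
      ⋃ s, {q : Config L × Config L | ε ≤ |(q.1 (w s) - u) * q.2 (w s)|} := by
    intro q hq
    by_contra hn
    simp only [Set.mem_iUnion, Set.mem_ofPred_eq, not_exists, not_le] at hn
    refine absurd hq (not_le.2 ((dist_pi_lt_iff hε).2 fun s => ?_))
    rw [Real.dist_eq, show f q s - g q s = (q.1 (w s) - u) * q.2 (w s) by simp only [f, g]; ring]
    exact hn s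
  refine (measure_mono hcover).trans ((measure_iUnion_fintype_le _ _).trans
    ((Finset.sum_le_sum fun s _ => hcheb s).trans ?_))
  rw [← ENNReal.ofReal_sum_of_nonneg, ← Finset.sum_div]
  · refine ENNReal.ofReal_le_ofReal ?_
    rw [div_le_iff₀ (pow_pos hε 2)]
    linarith [hsum, show ε ^ 3 = ε * ε ^ 2 by ring]
  · intro s _
    have := h.omega_half_pos (w s)
    have : 0 ≤ ∫ θ, (θ (w s) - u) ^ 2 ∂ν := integral_nonneg fun θ => sq_nonneg _
    positivity

/-! ### Estimates which are uniform in the length of the chain -/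

/-- Rates and degrees of freedom between `c` and `C`. -/
structure BoundedChain (L : ℕ) (r ω : ℤ → ℝ) (c C : ℝ) : Prop where
  two_le : 2 ≤ L
  pos : 0 < c
  rate_mem : ∀ m : ℤ, 0 ≤ m → m < L → c ≤ r m ∧ r m ≤ C
  omega_mem : ∀ m : ℤ, 0 < m → m < L → c ≤ ω m ∧ ω m ≤ C

variable {c C : ℝ}

lemma BoundedChain.admissible (hb : BoundedChain L r ω c C) (hT₀ : 0 ≤ T₀) (hT₁ : 0 ≤ T₁) :
    Admissible L r ω T₀ T₁ :=
  ⟨fun m h1 h2 => hb.pos.trans_le (hb.rate_mem m h1 h2).1,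
    fun m h1 h2 => hb.pos.trans_le (hb.omega_mem m h1 h2).1, hT₀, hT₁⟩

lemma BoundedChain.le (hb : BoundedChain L r ω c C) : c ≤ C := by
  have := hb.two_le
  have := hb.rate_mem 0 le_rfl (by omega)
  exact this.1.trans this.2

lemma BoundedChain.edgeResistance_mem (hb : BoundedChain L r ω c C) {m : ℤ} (h1 : 1 ≤ m)
    (h2 : m + 1 < L) :
    c / C ^ 3 ≤ edgeResistance r ω m ∧ edgeResistance r ω m ≤ 2 * C / c ^ 3 := by
  have hc := hb.pos
  have hC := hc.trans_le hb.le
  obtain ⟨r1, r2⟩ := hb.rate_mem m (by omega) (by omega)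
  obtain ⟨u1, u2⟩ := hb.omega_mem m (by omega) (by omega)
  obtain ⟨v1, v2⟩ := hb.omega_mem (m + 1) (by omega) (by omega)
  have hr := hc.trans_le r1
  have hu := hc.trans_le u1
  have hv := hc.trans_le v1
  unfold edgeResistance
  constructor
  · refine div_le_div₀ (by positivity) (by linarith) (by positivity) ?_
    calc r m * ω m * ω (m + 1) ≤ C * C * C := by gcongr
      _ = C ^ 3 := by ring
  · refine div_le_div₀ (by positivity) (by linarith) (by positivity) ?_
    calc c ^ 3 = c * c * c := by ring
      _ ≤ r m * ω m * ω (m + 1) := by gcongr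

lemma BoundedChain.bath_resistance_mem (hb : BoundedChain L r ω c C) {m n : ℤ} (hm : 0 ≤ m)
    (hm' : m < L) (hn : 0 < n) (hn' : n < L) :
    c / C ^ 3 ≤ 1 / (r m * ω n) ∧ 1 / (r m * ω n) ≤ 1 / c ^ 2 := by
  have hc := hb.pos
  have hC := hc.trans_le hb.le
  obtain ⟨r1, r2⟩ := hb.rate_mem m hm hm'
  obtain ⟨u1, u2⟩ := hb.omega_mem n hn hn'
  have hr := hc.trans_le r1
  have hu := hc.trans_le u1
  constructor
  · calc c / C ^ 3 ≤ C / C ^ 3 := by gcongr; exact hb.le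
      _ = 1 / (C * C) := by field_simp
      _ ≤ 1 / (r m * ω n) := by gcongr
  · calc 1 / (r m * ω n) ≤ 1 / (c * c) := by gcongr
      _ = 1 / c ^ 2 := by ring

lemma BoundedChain.resistance_sub_mem (hb : BoundedChain L r ω c C) {m n : ℤ} (hm : 1 ≤ m)
    (hmn : m ≤ n) (hn : n < L) :
    c / C ^ 3 * (n - m : ℝ) ≤ resistance r ω n - resistance r ω m ∧
      resistance r ω n - resistance r ω m ≤ 2 * C / c ^ 3 * (n - m : ℝ) := by
  induction n, hmn using Int.leInduction with
  | base => simp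
  | succ k hk ih =>
    obtain ⟨i1, i2⟩ := ih (by omega)
    obtain ⟨e1, e2⟩ := hb.edgeResistance_mem (m := k) (by omega) hn
    rw [resistance_add_one (by omega)]
    push_cast
    constructor <;> linarith

lemma BoundedChain.abs_resistance_sub_le (hb : BoundedChain L r ω c C) {m n : ℤ} (hm : 1 ≤ m)
    (hm' : m < L) (hn : 1 ≤ n) (hn' : n < L) :
    |resistance r ω m - resistance r ω n| ≤ 2 * C / c ^ 3 * |(m - n : ℝ)| := by
  have hc := hb.pos
  have hC := hc.trans_le hb.le
  have key : ∀ {m n : ℤ}, 1 ≤ m → m ≤ n → n < L →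
      |resistance r ω n - resistance r ω m| ≤ 2 * C / c ^ 3 * |(n - m : ℝ)| := by
    intro m n hm hmn hn
    obtain ⟨h1, h2⟩ := hb.resistance_sub_mem hm hmn hn
    have h0 : (0 : ℝ) ≤ n - m := by
      have : (m : ℝ) ≤ n := by exact_mod_cast hmn
      linarith
    rw [abs_of_nonneg h0, abs_of_nonneg (le_trans (by positivity) h1)]
    exact h2
  rcases le_total m n with hle | hle
  · rw [abs_sub_comm, abs_sub_comm (m : ℝ)]
    exact key hm hle hn'
  · exact key hn hle hm'

lemma BoundedChain.totalResistance_ge (hb : BoundedChain L r ω c C) :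
    c / C ^ 3 * L ≤ totalResistance L r ω := by
  have hL := hb.two_le
  have h1 := (hb.resistance_sub_mem (m := 1) (n := (L : ℤ) - 1) le_rfl (by omega) (by omega)).1
  have h2 := (hb.bath_resistance_mem (m := 0) (n := 1) le_rfl (by omega) one_pos (by omega)).1
  have h3 := (hb.bath_resistance_mem (m := (L : ℤ) - 1) (n := (L : ℤ) - 1) (by omega) (by omega)
    (by omega) (by omega)).1
  have h4 : resistance r ω 1 = 1 / (r 0 * ω 1) := by simp [resistance]
  rw [h4] at h1
  unfold totalResistance
  push_cast at h1
  linarith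

/-- The cumulative sum of `psi` is the resistance coordinate, up to the doubled resistance of the
contact with the left bath. -/
lemma sum_psi (hL : 2 ≤ L) (hω : ω 1 ≠ 0) {n : ℤ} (hn : 1 ≤ n) (hn' : n < L) :
    ∑ m ∈ Finset.Icc (1 : ℤ) n, psi L r ω m = resistance r ω n + 1 / (r 0 * ω 1) := by
  induction n, hn using Int.leInduction with
  | base =>
    have h0 : omegaBar L ω 0 = ω 1 := by
      unfold omegaBar; congr 1; omega
    have h1 : omegaBar L ω 1 = ω 1 := by
      unfold omegaBar; congr 1; omega
    simp only [Finset.Icc_self, Finset.sum_singleton, psi, sub_self, h0, h1, resistance,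
      Finset.Ico_self, Finset.sum_empty]
    field_simp
    ring
  | succ k hk ih =>
    have hI : Finset.Icc 1 (k + 1) = insert (k + 1) (Finset.Icc 1 k) := by
      ext m; simp only [Finset.mem_insert, Finset.mem_Icc]; omega
    have h0 : omegaBar L ω k = ω k := by
      unfold omegaBar; congr 1; omega
    have h1 : omegaBar L ω (k + 1) = ω (k + 1) := by
      unfold omegaBar; congr 1; omega
    rw [hI, Finset.sum_insert (by simp), ih (by omega), resistance_add_one hk]
    simp only [psi, edgeResistance, add_sub_cancel_right, h0, h1]
    ring

lemma sum_psi_total (hL : 2 ≤ L) (hω : ω 1 ≠ 0) (hω' : ω ((L : ℤ) - 1) ≠ 0) :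
    ∑ m ∈ Finset.Icc (1 : ℤ) L, psi L r ω m = totalResistance L r ω + 1 / (r 0 * ω 1) +
      1 / (r ((L : ℤ) - 1) * ω ((L : ℤ) - 1)) := by
  have hI : Finset.Icc 1 (L : ℤ) = insert (L : ℤ) (Finset.Icc 1 ((L : ℤ) - 1)) := by
    ext m; simp only [Finset.mem_insert, Finset.mem_Icc]; omega
  have h0 : omegaBar L ω ((L : ℤ) - 1) = ω ((L : ℤ) - 1) := by
    unfold omegaBar; congr 1; omega
  have h1 : omegaBar L ω L = ω ((L : ℤ) - 1) := by
    unfold omegaBar; congr 1; omega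
  rw [hI, Finset.sum_insert (by simp), sum_psi hL hω (by omega) (by omega), totalResistance, psi,
    h0, h1]
  field_simp
  ring

/-- The cumulative profile of `psi` is close to the harmonic profile, with an error of the order of
the inverse of the total resistance. -/
lemma BoundedChain.cumulative_bounds (hb : BoundedChain L r ω c C) {x : ℝ} (hx1 : x < 1)
    (hxL : 1 ≤ x * L) {i : ℤ} (hi : 1 ≤ i) (hi' : i < L) :
    0 ≤ cumulative L r ω x ∧ cumulative L r ω x ≤ 1 ∧
      |resistance r ω i / totalResistance L r ω - cumulative L r ω x| ≤
        (2 * C / c ^ 3 * |(i - ⌊x * L⌋ : ℝ)| + 3 / c ^ 2) / totalResistance L r ω := by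
  have hL := hb.two_le
  have hadm := hb.admissible (T₀ := 0) (T₁ := 0) le_rfl le_rfl
  have hc := hb.pos
  have hLpos : (0 : ℝ) < L := by positivity
  set n := ⌊x * L⌋ with hn
  have hn1 : 1 ≤ n := Int.le_floor.2 (by simpa using hxL)
  have hnL : n < L := Int.floor_lt.2 (by push_cast; nlinarith)
  have hω1 := (hadm.2.1 1 one_pos (by omega)).ne'
  have hωL := (hadm.2.1 ((L : ℤ) - 1) (by omega) (by omega)).ne'
  have hZ := hadm.totalResistance_pos hL
  set Z := totalResistance L r ω with hZdef
  obtain ⟨-, hα⟩ := hb.bath_resistance_mem (m := 0) (n := 1) le_rfl (by omega) one_pos (by omega)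
  obtain ⟨-, hβ⟩ := hb.bath_resistance_mem (m := (L : ℤ) - 1) (n := (L : ℤ) - 1) (by omega)
    (by omega) (by omega) (by omega)
  obtain ⟨hα0, hβ0⟩ := hadm.bath_resistance_pos hL
  have hcum : cumulative L r ω x = (resistance r ω n + 1 / (r 0 * ω 1)) / (Z + 1 / (r 0 * ω 1) +
      1 / (r ((L : ℤ) - 1) * ω ((L : ℤ) - 1))) := by
    rw [cumulative, ← hn, sum_psi hL hω1 hn1 hnL, sum_psi_total hL hω1 hωL]
  set α := 1 / (r 0 * ω 1)
  set β := 1 / (r ((L : ℤ) - 1) * ω ((L : ℤ) - 1))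
  have hRn0 := hadm.resistance_pos ⟨n, by omega, hnL⟩
  have hRnZ := hadm.resistance_lt ⟨n, by omega, hnL⟩
  have hRi0 := hadm.resistance_pos ⟨i, by omega, hi'⟩
  have hRiZ := hadm.resistance_lt ⟨i, by omega, hi'⟩
  simp only [← hZdef] at hRn0 hRnZ hRi0 hRiZ
  have hdiff := hb.abs_resistance_sub_le hi hi' hn1 hnL
  have hW : 0 < Z + α + β := by positivity
  refine ⟨?_, ?_, ?_⟩
  · rw [hcum]; positivity
  · rw [hcum, div_le_one hW]; linarith
  · have e : resistance r ω i / Z - cumulative L r ω x =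
        ((resistance r ω i - resistance r ω n) + resistance r ω i / Z * (α + β) - α) /
          (Z + α + β) := by
      rw [hcum]; field_simp; ring
    have hq0 : 0 ≤ resistance r ω i / Z := by positivity
    have hq1 : resistance r ω i / Z ≤ 1 := (div_le_one hZ).2 hRiZ.le
    have hq2 : resistance r ω i / Z * (α + β) ≤ 1 * (α + β) :=
      mul_le_mul_of_nonneg_right hq1 (by positivity)
    have hq3 : 0 ≤ resistance r ω i / Z * (α + β) := mul_nonneg hq0 (by positivity)
    have hnum : |(resistance r ω i - resistance r ω n) + resistance r ω i / Z * (α + β) - α| ≤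
        2 * C / c ^ 3 * |(i - n : ℝ)| + 3 / c ^ 2 := by
      have h3 : 3 / c ^ 2 = 3 * (1 / c ^ 2) := by ring
      have hab := abs_le.1 hdiff
      rw [h3]
      exact abs_le.2 ⟨by linarith [hab.1], by linarith [hab.2]⟩
    rw [e, abs_div, abs_of_pos hW]
    exact div_le_div₀ ((abs_nonneg _).trans hnum) hnum hZ (by linarith)

/-- A constant which bounds, for all chains with parameters in `[c, C]`, the resistances to the
baths and the ratios `edgeResistance / (2 * noiseSpread)`. -/
def spreadConstant (c C : ℝ) : ℝ := 2 * C / c ^ 3 * (C * (2 * C + 2) / c ^ 2) + 1 / c ^ 2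

lemma BoundedChain.spreadConstant_spec (hb : BoundedChain L r ω c C) :
    (∀ e ∈ bulkEdges L, edgeResistance r ω e.1 ≤ 2 * noiseSpread ω e * spreadConstant c C) ∧
      1 / (r 0 * ω 1) ≤ spreadConstant c C ∧
      1 / (r ((L : ℤ) - 1) * ω ((L : ℤ) - 1)) ≤ spreadConstant c C := by
  have hc := hb.pos
  have hC := hc.trans_le hb.le
  have hL := hb.two_le
  have hbath : 1 / c ^ 2 ≤ spreadConstant c C := le_add_of_nonneg_left (by positivity)
  refine ⟨fun e he => ?_, ?_, ?_⟩
  · have h1 := mem_bulkEdges.1 he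
    have h2 := e.2.2.2
    have hρ := (hb.edgeResistance_mem (m := e.1) (by have := e.1.2.1; omega) (by omega)).2
    obtain ⟨u1, u2⟩ := hb.omega_mem e.1 e.1.2.1 e.1.2.2
    obtain ⟨v1, v2⟩ := hb.omega_mem e.2 e.2.2.1 e.2.2.2
    have hu := hc.trans_le u1
    have hv := hc.trans_le v1
    have hs : c ^ 2 / (2 * C * (2 * C + 2)) ≤ noiseSpread ω e := by
      unfold noiseSpread
      refine div_le_div₀ (by positivity) ?_ (by positivity) ?_
      · rw [sq]; gcongr
      · exact mul_le_mul (by linarith) (by linarith) (by positivity) (by positivity)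
    calc edgeResistance r ω e.1 ≤ 2 * C / c ^ 3 := hρ
      _ = 2 * (c ^ 2 / (2 * C * (2 * C + 2))) * (2 * C / c ^ 3 * (C * (2 * C + 2) / c ^ 2)) := by
        field_simp
      _ ≤ 2 * noiseSpread ω e * spreadConstant c C := by
        refine mul_le_mul (by linarith) (le_add_of_nonneg_right (by positivity)) (by positivity) ?_
        linarith [show 0 ≤ c ^ 2 / (2 * C * (2 * C + 2)) by positivity]
  · exact (hb.bath_resistance_mem le_rfl (by omega) one_pos (by omega)).2.trans hbath
  · exact (hb.bath_resistance_mem (by omega) (by omega) (by omega) (by omega)).2.trans hbath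

/-- Quadratic deviation of the hidden temperature at a site from the local temperature. -/
lemma IsHiddenStationary.integral_sub_temperature_le (hb : BoundedChain L r ω c C) (hT₀ : 0 ≤ T₀)
    (hT₁ : 0 ≤ T₁) (hν : IsHiddenStationary L r ω T₀ T₁ ν) {x : ℝ} (hx1 : x < 1)
    (hxL : 1 ≤ x * L) (i : Site L) {d : ℝ} (hd : |(i - ⌊x * L⌋ : ℝ)| ≤ d) :
    ∫ θ, (θ i - temperature L r ω T₀ T₁ x) ^ 2 ∂ν ≤
      2 * ((T₁ - T₀) ^ 2 * spreadConstant c C / (c / C ^ 3 * L)) +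
      2 * ((T₁ - T₀) ^ 2 * ((2 * C / c ^ 3 * d + 3 / c ^ 2) / (c / C ^ 3 * L)) ^ 2) := by
  have := hν.isProbabilityMeasure
  have h := hb.admissible hT₀ hT₁
  have hc := hb.pos
  have hC := hc.trans_le hb.le
  have hL := hb.two_le
  have hLpos : (0 : ℝ) < L := by positivity
  obtain ⟨s1, s2, s3⟩ := hb.spreadConstant_spec
  have hvar := hν.variance_le h s1 s2 s3 i
  have hi := i.2.1
  obtain ⟨-, -, hcum⟩ := hb.cumulative_bounds hx1 hxL (i := i) (by omega) i.2.2
  have hZ := hb.totalResistance_ge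
  have hlow : 0 < c / C ^ 3 * L := by positivity
  have hZpos : 0 < totalResistance L r ω := hlow.trans_le hZ
  set Z := totalResistance L r ω with hZdef
  set t := meanTemperature L r ω T₀ T₁ i with ht
  set u := temperature L r ω T₀ T₁ x with hu
  have hD : 0 ≤ spreadConstant c C := by unfold spreadConstant; positivity
  have hd0 : 0 ≤ d := (abs_nonneg _).trans hd
  have htu : (t - u) ^ 2 ≤
      (T₁ - T₀) ^ 2 * ((2 * C / c ^ 3 * d + 3 / c ^ 2) / (c / C ^ 3 * L)) ^ 2 := by
    have e : t - u = (T₁ - T₀) * (resistance r ω i / Z - cumulative L r ω x) := by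
      rw [ht, hu, meanTemperature, temperature, ← hZdef]; ring
    rw [e, mul_pow]
    refine mul_le_mul_of_nonneg_left ?_ (sq_nonneg _)
    rw [← sq_abs]
    refine pow_le_pow_left₀ (abs_nonneg _) (hcum.trans ?_) 2
    gcongr
  have hint : ∀ a : ℝ, Integrable (fun θ : Config L => (θ i - a) ^ 2) ν := by
    intro a
    have e : ∀ θ : Config L, (θ i - a) ^ 2 = (θ i * θ i - 2 * a * θ i) + a ^ 2 := fun θ => by ring
    simp_rw [e]
    exact ((hν.integrable_mul _ _).sub ((hν.integrable_apply _).const_mul _)).add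
      (integrable_const _)
  calc ∫ θ, (θ i - u) ^ 2 ∂ν ≤ ∫ θ, (2 * (θ i - t) ^ 2 + 2 * (t - u) ^ 2) ∂ν := by
        refine integral_mono (hint u) (((hint t).const_mul 2).add (integrable_const _)) fun θ => ?_
        dsimp only
        nlinarith [sq_nonneg ((θ i - t) - (t - u))]
    _ = 2 * ∫ θ, (θ i - t) ^ 2 ∂ν + 2 * (t - u) ^ 2 := by
        rw [integral_add ((hint t).const_mul 2) (integrable_const _), integral_const_mul]
        simp
    _ ≤ _ := by
        have : (T₁ - T₀) ^ 2 * spreadConstant c C / Z ≤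
            (T₁ - T₀) ^ 2 * spreadConstant c C / (c / C ^ 3 * L) := by gcongr
        linarith

/-! ### Local equilibrium -/

/-- Uniform bound, over the sites at distance at most `d` of `⌊x L⌋`, of the quadratic deviation of
the hidden temperatures of a chain of length `L` from the local temperature. -/
def deviationBound (c C T₀ T₁ d : ℝ) (L : ℕ) : ℝ :=
  2 * ((T₁ - T₀) ^ 2 * spreadConstant c C / (c / C ^ 3 * L)) +
    2 * ((T₁ - T₀) ^ 2 * ((2 * C / c ^ 3 * d + 3 / c ^ 2) / (c / C ^ 3 * L)) ^ 2)

lemma tendsto_deviationBound (hc : 0 < c) (hC : 0 < C) (T₀ T₁ d : ℝ) :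
    Tendsto (deviationBound c C T₀ T₁ d) atTop (𝓝 0) := by
  have hL : Tendsto (fun L : ℕ => c / C ^ 3 * (L : ℝ)) atTop atTop :=
    tendsto_natCast_atTop_atTop.const_mul_atTop (by positivity)
  have h1 := (hL.const_div_atTop ((T₁ - T₀) ^ 2 * spreadConstant c C)).const_mul 2
  have h2 := (((hL.const_div_atTop (2 * C / c ^ 3 * d + 3 / c ^ 2)).pow 2).const_mul
    ((T₁ - T₀) ^ 2)).const_mul 2
  have h := h1.add h2
  simp only [mul_zero, add_zero, ne_eq, OfNat.ofNat_ne_zero, not_false_eq_true, zero_pow] at h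
  exact h

lemma abs_round_add_sub_floor_le (y : ℝ) (s : ℤ) :
    |((round y + s : ℤ) - ⌊y⌋ : ℝ)| ≤ 2 + |(s : ℝ)| := by
  have h1 := abs_le.1 (abs_sub_round y)
  have h2 := Int.floor_le y
  have h3 := Int.lt_floor_add_one y
  push_cast
  have h4 := abs_le.1 (le_refl |(s : ℝ)|)
  exact abs_le.2 ⟨by linarith, by linarith⟩

lemma eventually_round_add_mem {x : ℝ} (hx : x ∈ Set.Ioo (0 : ℝ) 1) (s : ℤ) :
    ∀ᶠ L : ℕ in atTop, round (x * L) + s ∈ Set.Ioo (0 : ℤ) (L : ℤ) := by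
  have h1 := (tendsto_natCast_atTop_atTop (R := ℝ)).const_mul_atTop hx.1
  have h2 := (tendsto_natCast_atTop_atTop (R := ℝ)).const_mul_atTop (sub_pos.2 hx.2)
  filter_upwards [h1.eventually_gt_atTop (1 + |(s : ℝ)|),
    h2.eventually_gt_atTop (1 + |(s : ℝ)|)] with L a1 a2
  have hr := abs_le.1 (abs_sub_round (x * L))
  have hs := abs_le.1 (le_refl |(s : ℝ)|)
  constructor
  · have : (0 : ℝ) < (round (x * L) + s : ℤ) := by push_cast; linarith
    exact_mod_cast this
  · have : ((round (x * L) + s : ℤ) : ℝ) < (L : ℤ) := by push_cast; linarith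
    exact_mod_cast this

lemma BoundedChain.temperature_nonneg (hb : BoundedChain L r ω c C) (hT₀ : 0 ≤ T₀) (hT₁ : 0 ≤ T₁)
    {x : ℝ} (hx1 : x < 1) (hxL : 1 ≤ x * L) : 0 ≤ temperature L r ω T₀ T₁ x := by
  have hL := hb.two_le
  obtain ⟨h0, h1, -⟩ := hb.cumulative_bounds hx1 hxL (i := 1) le_rfl (by omega)
  exact add_nonneg (mul_nonneg (sub_nonneg.2 h1) hT₀) (mul_nonneg h0 hT₁)

/-- The Lévy–Prokhorov estimate for one chain. -/
lemma BoundedChain.levyProkhorovEDist_le (hb : BoundedChain L r ω c C) (hT₀ : 0 ≤ T₀)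
    (hT₁ : 0 ≤ T₁) {μ : Measure (Config L)} (hμ : IsInvariantMeasure L r ω T₀ T₁ μ) {x : ℝ}
    (hx1 : x < 1) (hxL : 1 ≤ x * L) {S : Finset ℤ}
    (hS : ∀ s ∈ S, round (x * L) + s ∈ Set.Ioo (0 : ℤ) (L : ℤ)) {ε : ℝ} (hε : 0 < ε)
    (hsum : ∑ s : S, deviationBound c C T₀ T₁ (2 + |((s : ℤ) : ℝ)|) L * (C / 2 * (C / 2 + 1)) ≤
      ε ^ 3) :
    levyProkhorovEDist (μ.map (localConfig L x S))
      (Measure.pi fun s : S => gammaLaw (ω (round (x * L) + (s : ℤ)) / 2)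
        (temperature L r ω T₀ T₁ x)) ≤ ENNReal.ofReal ε := by
  have h := hb.admissible hT₀ hT₁
  obtain ⟨ν, hp, hbox, hg⟩ := exists_hiddenGain_eq_smul h hb.two_le
  have hν : IsHiddenStationary L r ω T₀ T₁ ν := ⟨hp, hbox, hg⟩
  obtain rfl : μ = mixture L ω ν := hμ.eq h hb.two_le (isInvariantMeasure_mixture h hbox hg)
  let w : S → Site L := fun s => ⟨round (x * L) + (s : ℤ), hS s s.2⟩
  have hw : Function.Injective w := fun a b hab => by
    have := congrArg (Subtype.val) hab
    exact Subtype.ext (by simpa [w] using this)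
  have hloc : localConfig L x S = fun ξ s => ξ (w s) := by
    funext ξ s
    exact dif_pos (hS s s.2)
  rw [hloc]
  refine hν.levyProkhorovEDist_le h hw (hb.temperature_nonneg hT₀ hT₁ hx1 hxL) hε
    (le_trans (Finset.sum_le_sum fun s _ => ?_) hsum)
  obtain ⟨o1, o2⟩ := hb.omega_mem (w s) (w s).2.1 (w s).2.2
  have o0 := hb.pos.trans_le o1
  have hC := o0.trans_le o2
  have hdev := hν.integral_sub_temperature_le hb hT₀ hT₁ hx1 hxL (w s)
    (abs_round_add_sub_floor_le (x * L) s)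
  refine mul_le_mul hdev ?_ (by positivity) ((integral_nonneg fun θ => sq_nonneg _).trans hdev)
  gcongr

/-- Local equilibrium for invariant measures of chains with uniformly bounded parameters. -/
theorem approachesLocalEquilibrium {r ω : ℕ → ℤ → ℝ}
    (hb : ∀ L : ℕ, 2 ≤ L → BoundedChain L (r L) (ω L) c C) (hT₀ : 0 ≤ T₀) (hT₁ : 0 ≤ T₁)
    {μ : (L : ℕ) → Measure (Config L)}
    (hμ : ∀ L : ℕ, 2 ≤ L → IsInvariantMeasure L (r L) (ω L) T₀ T₁ (μ L)) :
    ApproachesLocalEquilibrium ω μ (fun L x => temperature L (r L) (ω L) T₀ T₁ x) := by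
  intro x hx S
  have hc := (hb 2 le_rfl).pos
  have hC := hc.trans_le (hb 2 le_rfl).le
  have hlim : Tendsto (fun L : ℕ => ∑ s : S,
      deviationBound c C T₀ T₁ (2 + |((s : ℤ) : ℝ)|) L * (C / 2 * (C / 2 + 1))) atTop (𝓝 0) := by
    simpa using tendsto_finsetSum (Finset.univ : Finset S) fun s _ =>
      (tendsto_deviationBound hc hC T₀ T₁ (2 + |((s : ℤ) : ℝ)|)).mul_const (C / 2 * (C / 2 + 1))
  refine ENNReal.tendsto_nhds_zero.2 fun ε hε => ?_
  rcases eq_or_ne ε ⊤ with rfl | hε'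
  · simp
  have hε0 : 0 < ε.toReal := ENNReal.toReal_pos hε.ne' hε'
  have hxL := ((tendsto_natCast_atTop_atTop (R := ℝ)).const_mul_atTop hx.1).eventually_ge_atTop 1
  filter_upwards [eventually_ge_atTop 2, hxL, hlim.eventually_le_const (pow_pos hε0 3),
    (Filter.eventually_all_finset S).2 fun s _ => eventually_round_add_mem hx s]
    with L hL hxL hsum hS
  exact ((hb L hL).levyProkhorovEDist_le hT₀ hT₁ (hμ L hL) hx.2 hxL hS hε0 hsum).trans
    (ENNReal.ofReal_toReal hε').le

end HeatChain

end

theorem theorem3 (r ω : ℕ → ℤ → ℝ) (T₀ T₁ c C : ℝ) (hc : 0 < c)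
    (hr : ∀ L : ℕ, 2 ≤ L → ∀ m : ℤ, 0 ≤ m → m < L → c ≤ r L m ∧ r L m ≤ C)
    (hω : ∀ L : ℕ, 2 ≤ L → ∀ m : ℤ, 0 < m → m < L → c ≤ ω L m ∧ ω L m ≤ C)
    (hT₀ : 0 ≤ T₀) (hT₁ : 0 ≤ T₁) :
    (∀ L : ℕ, 2 ≤ L →
      ∃! μ : MeasureTheory.Measure (HeatChain.Config L),
        HeatChain.IsInvariantMeasure L (r L) (ω L) T₀ T₁ μ) ∧
    ∀ μ : (L : ℕ) → MeasureTheory.Measure (HeatChain.Config L),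
      (∀ L : ℕ, 2 ≤ L → HeatChain.IsInvariantMeasure L (r L) (ω L) T₀ T₁ (μ L)) →
      HeatChain.ApproachesLocalEquilibrium ω μ
        (fun L x => HeatChain.temperature L (r L) (ω L) T₀ T₁ x) := by
  have hb : ∀ L : ℕ, 2 ≤ L → HeatChain.BoundedChain L (r L) (ω L) c C := fun L hL =>
    { two_le := hL, pos := hc, rate_mem := hr L hL, omega_mem := hω L hL }
  exact ⟨fun L hL => HeatChain.existsUnique_isInvariantMeasure ((hb L hL).admissible hT₀ hT₁) hL,
    fun μ hμ => HeatChain.approachesLocalEquilibrium hb hT₀ hT₁ hμ⟩
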